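/- **Model.** Fix prices $0\le\underline p<\overline p\le p_\infty$, an initial inventory $x>0$ and a horizon $T>0$. For positive constants $M,K,m_L,m_U$ let $\Gamma(M,K,m_L,m_U)$ be the set of demand functions $\lambda\ge 0$ that are strictly decreasing on $[\underline p,\overline p]$, with $\lambda(p_\infty)=0$, inverse $\gamma$ on $[\underline p,\overline p]$ and revenue rate $r(l)=l\gamma(l)$, such that (Assumption A) $|\lambda|\le M$ on $[\underline p,\overline p]$; $p\mapsto\lambda(p)$, $p\mapsto r(\lambda(p))$ and $\gamma$ are $K$-Lipschitz; $r''$ exists and $-m_L\le r''\le -m_U$ on the range of $\lambda$ on $[\underline p,\overline p]$. Let $p^u$ maximise $r(\lambda(p))$ and $p^c$ minimise $|\lambda(p)-x/T|$ over $[\underline p,\overline p]$, and $p^D=\max\{p^u,p^c\}$. Assumption B for a set $\Gamma$ of demand functions and $\epsilon>0$: $p^D\in[\underline p+\epsilon,\overline p-\epsilon]$ for every $\lambda\in\Gamma$. In the market of size $n$ the inventory is $nx$ and the demand function is $n\lambda$. A policy $\pi$ maps the demand observed before time $t$ to a price $p(t)\in[\underline p,\overline p]\cup\{p_\infty\}$;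 cumulative demand is $N^\pi(t)=N\big(\int_0^t n\lambda(p(s))\,ds\big)$ with $N$ a unit-rate Poisson process. It is admissible if this demand process is well defined and $N^\pi(T)\le nx$. Put $J_n^\pi=E\int_0^T p(s)\,dN^\pi(s)$, let $J_n^D$ be the supremum of $\int_0^T p(s)\,n\lambda(p(s))\,ds$ over measurable $p:[0,T]\to[\underline p,\overline p]\cup\{p_\infty\}$ with $\int_0^T n\lambda(p(s))\,ds\le nx$, and let $R_n^\pi(x,T;\lambda)=1-J_n^\pi/J_n^D$. **Algorithm DPA** with tuning parameter $\delta'<1/2$ in the market of size $n\ge2$. For $i\ge1$ let $$\kappa_i^u=n^{\frac15(\frac35)^{i-1}(1-\delta')}\log n,\quad \tau_i^u=T\,n^{1-2\delta'-(1-\delta')(\frac35)^{i-1}}(\log n)^5,\quad w_i^u=n^{-\frac12(1-\delta')(1-(\frac35)^{i-1})},$$ $$\kappa_i^c=n^{\frac13(\frac23)^{i-1}(1-\delta')}\log n,\quad \tau_i^c=T\,n^{1-2\delta'-(1-\delta')(\frac23)^{i-1}}(\log n)^3,\quad w_i^c=n^{-(1-\delta')(1-(\frac23)^{i-1})}.$$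 Let $N^u$ be the least $l\ge1$ with $(w_l^u/\kappa_l^u)^2\sqrt{\log n}<n^{-\delta'}(\log n)^{3.5}$ and $N^c$ the least $l\ge1$ with $(w_l^c/\kappa_l^c)\sqrt{\log n}<n^{-\delta'}(\log n)^{2.5}$ (and $1$ if there is none, which can happen only for $n=2$). *Step 2.* Start with $I_1^u=[\underline p,\overline p]$. In rounds $i=1,\dots,N^u$, of length $\tau_i^u$, test the left end points of $\lceil\kappa_i^u\rceil$ equal parts of $I_i^u$ one after the other for equal times. With $\hat d(p)$ the observed demand rate at a tested price $p$, let $\hat p_i^u$ be the tested price maximising $p\,\hat d(p)$, $\hat p_i^c$ the one minimising $|\hat d(p)-nx/T|$ (in both cases the smallest such price), and $g_i$ the distance of neighbouring test prices. If $\hat p_i^c>\hat p_i^u+2\sqrt{\log n}\,g_i$, go to Step 3 at the end of the round. Otherwise let $\hat p_i=\max\{\hat p_i^c,\hat p_i^u\}$ and $I_{i+1}^u=[\hat p_i-\frac{\log n}3g_i,\ \hat p_i+\frac{2\log n}3g_i]\cap[\underline p,\overline p]$. After round $N^u$ use the price $\min\{\overline p,\ \hat p_{N^u}+2\sqrt{\log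 n}\,g_{N^u}\}$ until $T$. *Step 3.* Start again with $I_1^c=[\underline p,\overline p]$. In rounds $i=1,\dots,N^c$, of length $\tau_i^c$, test in the same way the left end points of $\lceil\kappa_i^c\rceil$ equal parts of $I_i^c$; let $\hat q_i$ be the (smallest) tested price minimising $|\hat d(p)-nx/T|$, let $g_i$ be the distance of neighbouring test prices, and let $I_{i+1}^c=[\hat q_i-\frac{\log n}2g_i,\ \hat q_i+\frac{\log n}2g_i]\cap[\underline p,\overline p]$. Then use $\hat q_{N^c}$ until $T$. At any time, switch to $p_\infty$ as soon as less than one unit is left; everything stops at time $T$. **Theorem.** For every $\delta<1/2$ there is a tuning parameter $\delta'\in(\delta,1/2)$ such that for all positive $M,K,m_L,m_U,\epsilon,x,T$ there is a constant $C$, depending only on these and on $\delta$, with the following property. For all $0\le\underline p<\overline p\le p_\infty$, every $\Gamma\subseteq\Gamma(M,K,m_L,m_U)$ satisfying Assumption B with $\epsilon$, and every $n\ge2$, the policy $\pi_\delta$ generated by DPA with parameter $\delta'$ is admissible for every $\lambda\in\Gamma$, and $$\sup_{\lambda\in\Gamma}R_n^{\pi_\delta}(x,T;\lambda)\le\frac{C(\log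 n)^{3.5}}{n^{\delta}} .$$ -/

import Mathlib

open Set MeasureTheory ProbabilityTheory
open scoped NNReal

/-! ### The demand model -/

/-- The inverse demand function `γ` of `lam` on the price interval `[plo, phi]`. -/
noncomputable def inverseDemand (plo phi : ℝ) (lam : ℝ → ℝ) : ℝ → ℝ :=
  Function.invFunOn lam (Icc plo phi)

/-- The revenue rate `r(l) = l γ(l)` as a function of the demand rate `l`. -/
noncomputable def revenueRate (plo phi : ℝ) (lam : ℝ → ℝ) (l : ℝ) : ℝ :=
  l * inverseDemand plo phi lam l

/-- The class `Γ(M, K, mL, mU)` of demand functions on the prices `[plo, phi] ∪ {pInf}`. Only the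
values on this set of prices matter. Concavity of `r` on the range of demand rates is part of
`second_deriv`; derivatives at the end points of that range are one-sided. -/
structure IsDemandFunction (plo phi pInf M K mL mU : ℝ) (lam : ℝ → ℝ) : Prop where
  nonneg : ∀ p ∈ Icc plo phi, 0 ≤ lam p
  strictAnti : StrictAntiOn lam (Icc plo phi)
  cutoff : lam pInf = 0
  bounded : ∀ p ∈ Icc plo phi, |lam p| ≤ M
  lipschitz_demand : ∀ p ∈ Icc plo phi, ∀ q ∈ Icc plo phi, |lam p - lam q| ≤ K * |p - q|
  lipschitz_revenue : ∀ p ∈ Icc plo phi, ∀ q ∈ Icc plo phi,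
    |revenueRate plo phi lam (lam p) - revenueRate plo phi lam (lam q)| ≤ K * |p - q|
  lipschitz_inverse : ∀ l ∈ lam '' Icc plo phi, ∀ l' ∈ lam '' Icc plo phi,
    |inverseDemand plo phi lam l - inverseDemand plo phi lam l'| ≤ K * |l - l'|
  second_deriv : ∃ r' r'' : ℝ → ℝ, ∀ l ∈ lam '' Icc plo phi,
    HasDerivWithinAt (revenueRate plo phi lam) (r' l) (lam '' Icc plo phi) l ∧
    HasDerivWithinAt r' (r'' l) (lam '' Icc plo phi) l ∧
    -mL ≤ r'' l ∧ r'' l ≤ -mU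

/-- `p` is the deterministic price `p^D = max (p^u, p^c)`, where `p^u` maximises the revenue rate
and `p^c` minimises `|lam p - x / T|` over `[plo, phi]`. -/
def IsDeterministicPrice (plo phi x T : ℝ) (lam : ℝ → ℝ) (p : ℝ) : Prop :=
  ∃ pu ∈ Icc plo phi, ∃ pc ∈ Icc plo phi,
    IsMaxOn (fun q => revenueRate plo phi lam (lam q)) (Icc plo phi) pu ∧
    IsMinOn (fun q => |lam q - x / T|) (Icc plo phi) pc ∧
    p = max pu pc

/-- The value `J^D` of the full-information deterministic problem with inventory `X` and demand
function `lam`. The revenue rate at the price `p` is `p * lam p` (which is `0` at `pInf`). -/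
noncomputable def deterministicValue (plo phi pInf X T : ℝ) (lam : ℝ → ℝ) : ℝ :=
  sSup {v | ∃ p : ℝ → ℝ, Measurable p ∧ (∀ s ∈ Icc 0 T, p s ∈ Icc plo phi ∪ {pInf}) ∧
    (∫ s in (0 : ℝ)..T, lam (p s)) ≤ X ∧ v = ∫ s in (0 : ℝ)..T, p s * lam (p s)}

/-! ### Poisson demand, policies and regret -/

/-- A path of a counting process: it starts at `0`, is nondecreasing and right-continuous, and has
jumps of size one. -/
structure IsCountingPath (ν : ℝ≥0 → ℕ) : Prop where
  zero : ν 0 = 0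
  mono : Monotone ν
  rightCont : ∀ t, ContinuousWithinAt ν (Ici t) t
  unitJumps : ∀ t, 0 < t → ∃ s < t, ν t ≤ ν s + 1

/-- `N` is a unit-rate Poisson process under `μ`. -/
structure IsUnitPoissonProcess {Ω : Type*} [MeasurableSpace Ω] (μ : Measure Ω)
    (N : ℝ≥0 → Ω → ℕ) : Prop where
  measurable : ∀ t, Measurable (N t)
  paths : ∀ ω, IsCountingPath (fun t => N t ω)
  increments : ∀ s u, μ.map (fun ω => N (s + u) ω - N s ω) = poissonMeasure u
  indep : HasIndepIncrements N μ

/-- A pricing policy sends a path of cumulative realised demand to a path of prices. -/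
abbrev PricingPolicy := (ℝ → ℕ) → ℝ → ℝ

/-- `D` is the cumulative demand on `[0, T]` when the policy `π` is used against the demand function
`lam`, for the realisation `ν` of the unit-rate Poisson process:
`D(t) = ν(∫₀ᵗ lam(p(s)) ds)`, where `p = π D`. -/
def IsDemandPath (T : ℝ) (lam : ℝ → ℝ) (π : PricingPolicy) (ν : ℝ≥0 → ℕ) (D : ℝ → ℕ) : Prop :=
  ∀ t ∈ Icc 0 T, IntervalIntegrable (fun s => lam (π D s)) volume 0 t ∧
    D t = ν (∫ s in (0 : ℝ)..t, lam (π D s)).toNNReal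

/-- The cumulative demand under `π`; for an admissible policy it exists and is unique on
`[0, T]`. -/
noncomputable def demandPath (T : ℝ) (lam : ℝ → ℝ) (π : PricingPolicy) (ν : ℝ≥0 → ℕ) : ℝ → ℕ :=
  Classical.epsilon (IsDemandPath T lam π ν)

/-- Admissible policies for the inventory `X`, the horizon `T` and the demand function `lam`: prices
are allowed ones, the price at time `t` is determined by the demand observed before `t`, and for
every realisation of the driving Poisson process the demand process is well defined (exists and is
unique on `[0, T]`) and never exceeds the inventory. -/
structure IsAdmissible (plo phi pInf X T : ℝ) (lam : ℝ → ℝ) (π : PricingPolicy) : Prop where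
  price_mem : ∀ D : ℝ → ℕ, ∀ t ∈ Icc 0 T, π D t ∈ Icc plo phi ∪ {pInf}
  nonanticipating : ∀ D D' : ℝ → ℕ, ∀ t ∈ Icc 0 T,
    (∀ s, 0 ≤ s → s < t → D s = D' s) → π D t = π D' t
  inventory : ∀ ν : ℝ≥0 → ℕ, IsCountingPath ν →
    ∃ D : ℝ → ℕ, IsDemandPath T lam π ν D ∧ (D T : ℝ) ≤ X ∧
      ∀ D', IsDemandPath T lam π ν D' → EqOn D D' (Icc 0 T)

/-- The revenue `∫₀ᵀ p(s) dD(s)`, with `p = π D`: the `k`-th unit is sold at the time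
`inf {t | D t ≥ k}`, at the price prevailing at that time. -/
noncomputable def revenue (T : ℝ) (π : PricingPolicy) (D : ℝ → ℕ) : ℝ :=
  ∑ k ∈ Finset.Icc 1 (D T), π D (sInf {t | t ∈ Icc 0 T ∧ k ≤ D t})

/-- The expected revenue `J^π`, for the driving unit-rate Poisson process `N`. -/
noncomputable def expectedRevenue {Ω : Type*} [MeasurableSpace Ω] (μ : Measure Ω)
    (N : ℝ≥0 → Ω → ℕ) (T : ℝ) (lam : ℝ → ℝ) (π : PricingPolicy) : ℝ :=
  ∫ ω, revenue T π (demandPath T lam π (fun t => N t ω)) ∂μ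

/-- The regret `1 - J^π / J^D` of a policy, for inventory `X` and demand function `lam`. -/
noncomputable def regret {Ω : Type*} [MeasurableSpace Ω] (μ : Measure Ω) (N : ℝ≥0 → Ω → ℕ)
    (plo phi pInf X T : ℝ) (lam : ℝ → ℝ) (π : PricingPolicy) : ℝ :=
  1 - expectedRevenue μ N T lam π / deterministicValue plo phi pInf X T lam

/-! ### One learning round

A round starts at time `s`, lasts `τ`, and tests `κ` prices of the interval `I` (given by its two
end points), each for a time `τ / κ`. Prices are numbered `0, …, κ - 1`. -/

/-- The distance of neighbouring test prices. -/
noncomputable def gridGap (I : ℝ × ℝ) (κ : ℕ) : ℝ := (I.2 - I.1) / κ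

/-- The `j`-th test price: the left end point of the `j`-th of `κ` equal parts of `I`. -/
noncomputable def testPrice (I : ℝ × ℝ) (κ j : ℕ) : ℝ := I.1 + j * gridGap I κ

/-- The observed demand rate at the `j`-th test price. -/
noncomputable def observedRate (D : ℝ → ℕ) (s τ : ℝ) (κ j : ℕ) : ℝ :=
  ((D (s + (j + 1) * (τ / κ)) : ℝ) - D (s + j * (τ / κ))) / (τ / κ)

/-- The least index below `κ` at which `f` is maximal. -/
noncomputable def argMaxBelow (κ : ℕ) (f : ℕ → ℝ) : ℕ :=
  sInf {j | j < κ ∧ ∀ k < κ, f k ≤ f j}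

/-- The test price of largest observed revenue rate. -/
noncomputable def bestRevenuePrice (D : ℝ → ℕ) (s τ : ℝ) (κ : ℕ) (I : ℝ × ℝ) : ℝ :=
  testPrice I κ (argMaxBelow κ fun j => testPrice I κ j * observedRate D s τ κ j)

/-- The test price whose observed demand rate is closest to `target`. -/
noncomputable def bestInventoryPrice (target : ℝ) (D : ℝ → ℕ) (s τ : ℝ) (κ : ℕ) (I : ℝ × ℝ) : ℝ :=
  testPrice I κ (argMaxBelow κ fun j => -|observedRate D s τ κ j - target|)

/-- The price offered at time `t` of the round: the `j`-th test price is used on the time interval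
`(s + j τ / κ, s + (j + 1) τ / κ]`. -/
noncomputable def roundPrice (s τ : ℝ) (κ : ℕ) (I : ℝ × ℝ) (t : ℝ) : ℝ :=
  testPrice I κ (⌈(t - s) / (τ / κ)⌉₊ - 1)

/-! ### The dynamic pricing algorithm -/

/-- The input of the algorithm: market size `n`, tuning parameter `δ`, price interval `[plo, phi]`,
cut-off price `pInf`, inventory `X` (which is `n x` in a market of size `n`) and horizon `T`. -/
structure DPA where
  n : ℕ
  δ : ℝ
  plo : ℝ
  phi : ℝ
  pInf : ℝ
  X : ℝ
  T : ℝ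

namespace DPA

noncomputable section

/-- `log n` -/
def L (A : DPA) : ℝ := Real.log A.n

/-! Parameters of the rounds, which are numbered from `0` here. The names ending in `U` belong to the
learning of `p^u` (Step 2), those ending in `C` to the learning of `p^c` (Step 3). -/

/-- Length of round `i` of Step 2, with the selling season as unit of time. -/
def tauU (A : DPA) (i : ℕ) : ℝ :=
  A.T * ((A.n : ℝ) ^ (1 - 2 * A.δ - (1 - A.δ) * (3 / 5 : ℝ) ^ i) * A.L ^ 5)

/-- Number of test prices of round `i` of Step 2, before rounding. -/
def kappaU (A : DPA) (i : ℕ) : ℝ :=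
  (A.n : ℝ) ^ ((1 / 5 : ℝ) * (3 / 5 : ℝ) ^ i * (1 - A.δ)) * A.L

/-- Number of test prices of round `i` of Step 2. -/
def gridU (A : DPA) (i : ℕ) : ℕ := ⌈A.kappaU i⌉₊

/-- Nominal length of the price interval of round `i` of Step 2, relative to `phi - plo`. -/
def widthU (A : DPA) (i : ℕ) : ℝ :=
  (A.n : ℝ) ^ (-(1 / 2 : ℝ) * (1 - A.δ) * (1 - (3 / 5 : ℝ) ^ i))

/-- The last round of Step 2. -/
def lastU (A : DPA) : ℕ :=
  sInf {i | (A.widthU i / A.kappaU i) ^ 2 * √A.L < (A.n : ℝ) ^ (-A.δ) * A.L ^ (7 / 2 : ℝ)}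

/-- Time at which round `i` of Step 2 starts. -/
def startU (A : DPA) (i : ℕ) : ℝ := ∑ j ∈ Finset.range i, A.tauU j

/-- Length of round `i` of Step 3, with the selling season as unit of time. -/
def tauC (A : DPA) (i : ℕ) : ℝ :=
  A.T * ((A.n : ℝ) ^ (1 - 2 * A.δ - (1 - A.δ) * (2 / 3 : ℝ) ^ i) * A.L ^ 3)

/-- Number of test prices of round `i` of Step 3, before rounding. -/
def kappaC (A : DPA) (i : ℕ) : ℝ :=
  (A.n : ℝ) ^ ((1 / 3 : ℝ) * (2 / 3 : ℝ) ^ i * (1 - A.δ)) * A.L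

/-- Number of test prices of round `i` of Step 3. -/
def gridC (A : DPA) (i : ℕ) : ℕ := ⌈A.kappaC i⌉₊

/-- Nominal length of the price interval of round `i` of Step 3, relative to `phi - plo`. -/
def widthC (A : DPA) (i : ℕ) : ℝ :=
  (A.n : ℝ) ^ (-(1 - A.δ) * (1 - (2 / 3 : ℝ) ^ i))

/-- The last round of Step 3. -/
def lastC (A : DPA) : ℕ :=
  sInf {i | A.widthC i / A.kappaC i * √A.L < (A.n : ℝ) ^ (-A.δ) * A.L ^ (5 / 2 : ℝ)}

/-- Time, counted from the beginning of Step 3, at which round `i` of Step 3 starts. -/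
def startC (A : DPA) (i : ℕ) : ℝ := ∑ j ∈ Finset.range i, A.tauC j

/-- The interval `[a, b]` truncated to the feasible prices. -/
def truncate (A : DPA) (a b : ℝ) : ℝ × ℝ := (max A.plo a, min A.phi b)

/-! Step 2. -/

/-- `p̂^u` in round `i` of Step 2, when its price interval is `I`. -/
def hatUOn (A : DPA) (D : ℝ → ℕ) (i : ℕ) (I : ℝ × ℝ) : ℝ :=
  bestRevenuePrice D (A.startU i) (A.tauU i) (A.gridU i) I

/-- `p̂^c` in round `i` of Step 2, when its price interval is `I`. -/
def hatCOn (A : DPA) (D : ℝ → ℕ) (i : ℕ) (I : ℝ × ℝ) : ℝ :=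
  bestInventoryPrice (A.X / A.T) D (A.startU i) (A.tauU i) (A.gridU i) I

/-- `p̂` in round `i` of Step 2, when its price interval is `I`. -/
def hatOn (A : DPA) (D : ℝ → ℕ) (i : ℕ) (I : ℝ × ℝ) : ℝ :=
  max (A.hatCOn D i I) (A.hatUOn D i I)

/-- The price interval of round `i` of Step 2. -/
def intervalU (A : DPA) (D : ℝ → ℕ) : ℕ → ℝ × ℝ
  | 0 => (A.plo, A.phi)
  | i + 1 =>
    let I := intervalU A D i
    A.truncate (A.hatOn D i I - A.L / 3 * gridGap I (A.gridU i))
      (A.hatOn D i I + 2 * A.L / 3 * gridGap I (A.gridU i))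

/-- The transition condition of Step 2 holds in round `i`. -/
def Breaks (A : DPA) (D : ℝ → ℕ) (i : ℕ) : Prop :=
  A.hatUOn D i (A.intervalU D i) + 2 * √A.L * gridGap (A.intervalU D i) (A.gridU i)
    < A.hatCOn D i (A.intervalU D i)

/-- The price tested at time `t` of Step 2. -/
def priceU (A : DPA) (D : ℝ → ℕ) (t : ℝ) : ℝ :=
  let i := sInf {i | t ≤ A.startU (i + 1)}
  roundPrice (A.startU i) (A.tauU i) (A.gridU i) (A.intervalU D i) t

/-- The price `p̃` applied after Step 2, truncated to the feasible prices. -/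
def finalU (A : DPA) (D : ℝ → ℕ) : ℝ :=
  let I := A.intervalU D A.lastU
  min A.phi (A.hatOn D A.lastU I + 2 * √A.L * gridGap I (A.gridU A.lastU))

/-! Step 3, when it is entered at time `s₀`. -/

/-- `q̂` in round `i` of Step 3, when its price interval is `I`. -/
def hatQOn (A : DPA) (D : ℝ → ℕ) (s₀ : ℝ) (i : ℕ) (I : ℝ × ℝ) : ℝ :=
  bestInventoryPrice (A.X / A.T) D (s₀ + A.startC i) (A.tauC i) (A.gridC i) I

/-- The price interval of round `i` of Step 3. -/
def intervalC (A : DPA) (D : ℝ → ℕ) (s₀ : ℝ) : ℕ → ℝ × ℝ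
  | 0 => (A.plo, A.phi)
  | i + 1 =>
    let I := intervalC A D s₀ i
    A.truncate (A.hatQOn D s₀ i I - A.L / 2 * gridGap I (A.gridC i))
      (A.hatQOn D s₀ i I + A.L / 2 * gridGap I (A.gridC i))

/-- The price tested at time `t` of Step 3. -/
def priceC (A : DPA) (D : ℝ → ℕ) (s₀ t : ℝ) : ℝ :=
  let i := sInf {i | t ≤ s₀ + A.startC (i + 1)}
  roundPrice (s₀ + A.startC i) (A.tauC i) (A.gridC i) (A.intervalC D s₀ i) t

/-- The price `q̃` applied after Step 3. -/
def finalC (A : DPA) (D : ℝ → ℕ) (s₀ : ℝ) : ℝ :=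
  A.hatQOn D s₀ A.lastC (A.intervalC D s₀ A.lastC)

open Classical in
/-- The price at time `t` as long as the product is in stock. If the transition condition has held in
a round of Step 2 that ended before `t`, then Step 3 was entered at the end of the first such round;
otherwise Step 2 is still going on, or has ended without transition. -/
def priceInStock (A : DPA) (D : ℝ → ℕ) (t : ℝ) : ℝ :=
  if ∃ i ≤ A.lastU, A.Breaks D i ∧ A.startU (i + 1) < t then
    let s₀ := A.startU (sInf {i | A.Breaks D i} + 1)
    if t ≤ s₀ + A.startC (A.lastC + 1) then A.priceC D s₀ t else A.finalC D s₀
  else if t ≤ A.startU (A.lastU + 1) then A.priceU D t else A.finalU D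

open Classical in
/-- The pricing policy generated by the algorithm: the cut-off price is used as soon as less than one
unit is left. -/
def policy (A : DPA) : PricingPolicy := fun D t =>
  if ∃ s, 0 ≤ s ∧ s < t ∧ A.X < D s + 1 then A.pInf else A.priceInStock D t

end

end DPA

/-! Write `pD = max pu pc`. Keeping the price `pD` throughout is optimal in the deterministic
problem: the revenue rate is concave in the demand rate, and a multiplier `m` for the inventory
(zero if `pc ≤ pu`, otherwise the marginal revenue at `pc`) gives `p λ(p) ≤ pD λ(pD) + m (λ(p) -
x/T)` for every price. Hence `J^D ≤ n T pD λ(pD)`. It remains to show that, on all but a small part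
of the probability space, the policy earns at nearly the rate `n pD λ(pD)` and sells at a rate
hardly above `n x/T`; each unit demanded beyond the stock costs at most the largest price.

Chance is separated from analysis. By a Chernoff and a union bound, outside an event of probability
`O(1/n)` every increment of the driving Poisson process between integer times up to order `n`
deviates from its mean by at most order `√(log n · length)` (`IsRegularPath`, `IsConcentrated`). On
the good event everything is deterministic. A `Ledger` records, for a time interval, the shortfall
of revenue and the excess of demand; such accounts add up.

Consider a round on an interval of width `w` with grid gap `g` and observation error `err`. Strong
concavity and smoothness make the revenue loss comparable to the squared distance from `pu`, so `pu`
is located up to order `g + √err`; demand is bi-Lipschitz, so `pc` is located up to order `g + err`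
(`bestRevenuePrice_near`, `bestInventoryPrice_near`). The schedule makes both at most of order
`√(log n) g`, so the next interval, of length `log n · g`, still contains the prices that are sought
(`StateU`, `StateC`).

While Step 2 goes on, `pu` and `pD` both lie in the interval, so the revenue lost by testing is of
order `w²`. The excess of demand would be linear in `w`, but from the second round on the interval
is placed off centre so that the average test price is at least `pD` and the linear term has the
favourable sign (`sum_lam_le`). A transition certifies `pu < pc`; in Step 3 the loss is linear in
`w`. The exponents are such that `τ w²`, respectively `τ w`, is `n^(-δ')` up to logarithms in every
round, and the final price costs no more.

The parameter `δ'` is chosen irrational, so that the exponents `(1 - δ') q^i - (1 - 2δ')` never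
vanish: the rounds that are needed then take a vanishing fraction of the season, and their number is
bounded independently of `n`. The total is `O(n^(-δ') (log n)^6)`, and the logarithms are absorbed
since `δ < δ'`. For the finitely many small `n` the trivial bound `1` on the regret suffices. -/

/-! ### Analytic consequences of the assumptions on the demand function -/

/-- A function with slope at most `-c` satisfies the corresponding quadratic tangent bound. -/
theorem le_tangent_of_second_deriv {J : Set ℝ} (hJ : Convex ℝ J) {r r' r'' : ℝ → ℝ} {c : ℝ}
    (h1 : ∀ l ∈ J, HasDerivWithinAt r (r' l) J l)
    (h2 : ∀ l ∈ J, HasDerivWithinAt r' (r'' l) J l) (hc : ∀ l ∈ J, r'' l ≤ -c)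
    {a l : ℝ} (ha : a ∈ J) (hl : l ∈ J) :
    r l ≤ r a + r' a * (l - a) - c / 2 * (l - a) ^ 2 := by
  have hsub : interior J ⊆ J := interior_subset
  have key1 : AntitoneOn (fun y => r' y + c * y) J := by
    refine antitoneOn_of_hasDerivWithinAt_nonpos hJ (f' := fun y => r'' y + c * 1) ?_ ?_ ?_
    · intro y hy
      exact ((h2 y hy).continuousWithinAt).add (by fun_prop)
    · intro y hy
      exact ((h2 y (hsub hy)).add (((hasDerivAt_id y).const_mul c).hasDerivWithinAt)).mono hsub
    · intro y hy
      have := hc y (hsub hy)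
      linarith
  set φ : ℝ → ℝ := fun y => r y - (r a + r' a * (y - a) - c / 2 * (y - a) ^ 2) with hφ
  have hd : ∀ y ∈ J, HasDerivWithinAt φ (r' y - (r' a - c * (y - a))) J y := by
    intro y hy
    have e : HasDerivAt (fun y => r a + r' a * (y - a) - c / 2 * (y - a) ^ 2)
        (r' a - c * (y - a)) y := by
      have e1 : HasDerivAt (fun y : ℝ => y - a) 1 y := (hasDerivAt_id y).sub_const a
      have e2 := ((e1.const_mul (r' a)).const_add (r a)).sub ((e1.pow 2).const_mul (c / 2))
      refine HasDerivAt.congr_deriv e2 ?_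
      norm_num
      ring
    exact (h1 y hy).sub e.hasDerivWithinAt
  suffices h : φ l ≤ φ a by
    simp only [hφ, sub_self, mul_zero] at h
    nlinarith
  rcases le_total a l with hal | hal
  · have hsub2 : Icc a l ⊆ J := hJ.ordConnected.out ha hl
    have : AntitoneOn φ (Icc a l) := by
      refine antitoneOn_of_hasDerivWithinAt_nonpos (convex_Icc a l)
        (f' := fun y => r' y - (r' a - c * (y - a))) ?_ ?_ ?_
      · intro y hy
        exact ((hd y (hsub2 hy)).continuousWithinAt).mono hsub2
      · intro y hy
        exact (hd y (hsub2 (interior_subset hy))).mono (interior_subset.trans hsub2)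
      · intro y hy
        have hy' := interior_subset hy
        have := key1 ha (hsub2 hy') hy'.1
        simp only at this; linarith
    exact this (left_mem_Icc.2 hal) (right_mem_Icc.2 hal) hal
  · have hsub2 : Icc l a ⊆ J := hJ.ordConnected.out hl ha
    have : MonotoneOn φ (Icc l a) := by
      refine monotoneOn_of_hasDerivWithinAt_nonneg (convex_Icc l a)
        (f' := fun y => r' y - (r' a - c * (y - a))) ?_ ?_ ?_
      · intro y hy
        exact ((hd y (hsub2 hy)).continuousWithinAt).mono hsub2
      · intro y hy
        exact (hd y (hsub2 (interior_subset hy))).mono (interior_subset.trans hsub2)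
      · intro y hy
        have hy' := interior_subset hy
        have := key1 (hsub2 hy') ha hy'.2
        simp only at this; linarith
    exact this (left_mem_Icc.2 hal) (right_mem_Icc.2 hal) hal

/-- If `t * b ≤ t ^ 2 * c` for all small positive `t`, then `b ≤ 0`. -/
theorem nonpos_of_forall_mul_le_sq {b c η : ℝ} (hη : 0 < η)
    (h : ∀ t, 0 < t → t ≤ η → t * b ≤ t ^ 2 * c) : b ≤ 0 := by
  by_contra hb
  push Not at hb
  set t := min η (b / (2 * (|c| + 1))) with ht
  have hc : 0 < |c| + 1 := by positivity
  have htpos : 0 < t := lt_min hη (by positivity)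
  have h1 := h t htpos (min_le_left _ _)
  have h2 : t ≤ b / (2 * (|c| + 1)) := min_le_right _ _
  rw [le_div_iff₀ (by positivity)] at h2
  have h3 : b ≤ t * c := by
    have : t * b ≤ t * (t * c) := by nlinarith
    exact le_of_mul_le_mul_left this htpos
  have h4 : t * c ≤ t * |c| := mul_le_mul_of_nonneg_left (le_abs_self c) htpos.le
  nlinarith

namespace IsDemandFunction

variable {plo phi pInf M K mL mU : ℝ} {lam : ℝ → ℝ}

theorem inverse_apply (H : IsDemandFunction plo phi pInf M K mL mU lam) {p : ℝ}
    (hp : p ∈ Icc plo phi) : inverseDemand plo phi lam (lam p) = p :=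
  H.strictAnti.injOn.leftInvOn_invFunOn hp

theorem revenueRate_apply (H : IsDemandFunction plo phi pInf M K mL mU lam) {p : ℝ}
    (hp : p ∈ Icc plo phi) : revenueRate plo phi lam (lam p) = p * lam p := by
  rw [revenueRate, H.inverse_apply hp, mul_comm]

theorem abs_sub_le (H : IsDemandFunction plo phi pInf M K mL mU lam) {p q : ℝ}
    (hp : p ∈ Icc plo phi) (hq : q ∈ Icc plo phi) : |p - q| ≤ K * |lam p - lam q| := by
  have := H.lipschitz_inverse _ (mem_image_of_mem lam hp) _ (mem_image_of_mem lam hq)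
  rwa [H.inverse_apply hp, H.inverse_apply hq] at this

theorem lipschitz_mul (H : IsDemandFunction plo phi pInf M K mL mU lam) {p q : ℝ}
    (hp : p ∈ Icc plo phi) (hq : q ∈ Icc plo phi) :
    |p * lam p - q * lam q| ≤ K * |p - q| := by
  have := H.lipschitz_revenue p hp q hq
  rwa [H.revenueRate_apply hp, H.revenueRate_apply hq] at this

theorem le_bound (H : IsDemandFunction plo phi pInf M K mL mU lam) {p : ℝ}
    (hp : p ∈ Icc plo phi) : lam p ≤ M := (le_abs_self _).trans (H.bounded p hp)

/-- The assumptions bound the prices. -/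
theorem price_le (H : IsDemandFunction plo phi pInf M K mL mU lam) (hK : 0 < K)
    (h0 : 0 ≤ plo) (h : plo < phi) {p : ℝ} (hp : p ∈ Icc plo phi) : p ≤ K * (K + M) := by
  refine hp.2.trans ?_
  have hphi : phi ∈ Icc plo phi := right_mem_Icc.2 h.le
  have hplo : plo ∈ Icc plo phi := left_mem_Icc.2 h.le
  have h1 := H.lipschitz_mul hphi hplo
  have h2 := H.abs_sub_le hphi hplo
  have h3 := H.strictAnti hplo hphi h
  have h4 := H.le_bound hplo
  rw [abs_of_pos (sub_pos.2 h)] at h1 h2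
  rw [abs_of_neg (by linarith)] at h2
  have h5 := (abs_le.1 h1).1
  have hd : 0 < phi - plo := sub_pos.2 h
  -- The Lipschitz bound for the revenue controls `phi` times the drop in demand by `(K + M) * (phi
  -- - plo)`, and this drop is at least `(phi - plo) / K`; the length of the interval cancels.
  have h6 : phi * (phi - plo) ≤ K * (K + M) * (phi - plo) := by
    have : phi * (lam plo - lam phi) ≤ (K + M) * (phi - plo) := by nlinarith
    have h7 : phi * (phi - plo) ≤ phi * (K * -(lam phi - lam plo)) :=
      mul_le_mul_of_nonneg_left h2 (by linarith)
    nlinarith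
  exact le_of_mul_le_mul_right h6 hd

theorem continuousOn (H : IsDemandFunction plo phi pInf M K mL mU lam) (hK : 0 < K) :
    ContinuousOn lam (Icc plo phi) := by
  have : LipschitzOnWith K.toNNReal lam (Icc plo phi) := by
    refine LipschitzOnWith.of_dist_le_mul fun p hp q hq => ?_
    rw [Real.dist_eq, Real.dist_eq, Real.coe_toNNReal _ hK.le]
    exact H.lipschitz_demand p hp q hq
  exact this.continuousOn

theorem convex_range (H : IsDemandFunction plo phi pInf M K mL mU lam) (hK : 0 < K) :
    Convex ℝ (lam '' Icc plo phi) :=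
  Real.convex_iff_isPreconnected.2 (isPreconnected_Icc.image _ (H.continuousOn hK))

/-- The tangent bounds for the revenue rate as a function of the demand rate. -/
theorem exists_tangent (H : IsDemandFunction plo phi pInf M K mL mU lam) (hK : 0 < K) :
    ∃ r' : ℝ → ℝ, ∀ a ∈ Icc plo phi, ∀ p ∈ Icc plo phi,
      p * lam p ≤ a * lam a + r' a * (lam p - lam a) - mU / 2 * (lam p - lam a) ^ 2 ∧
      a * lam a + r' a * (lam p - lam a) - mL / 2 * (lam p - lam a) ^ 2 ≤ p * lam p := by
  obtain ⟨r', r'', h⟩ := H.second_deriv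
  refine ⟨fun a => r' (lam a), fun a ha p hp => ⟨?_, ?_⟩⟩
  · have := le_tangent_of_second_deriv (H.convex_range hK) (c := mU) (fun l hl => (h l hl).1)
      (fun l hl => (h l hl).2.1) (fun l hl => (h l hl).2.2.2) (mem_image_of_mem lam ha)
      (mem_image_of_mem lam hp)
    rwa [H.revenueRate_apply ha, H.revenueRate_apply hp] at this
  · have := le_tangent_of_second_deriv (H.convex_range hK) (c := -mL)
      (r := fun l => -revenueRate plo phi lam l) (r' := fun l => -r' l) (r'' := fun l => -r'' l)
      (fun l hl => (h l hl).1.neg)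
      (fun l hl => (h l hl).2.1.neg) (fun l hl => by linarith [(h l hl).2.2.1])
      (mem_image_of_mem lam ha) (mem_image_of_mem lam hp)
    rw [H.revenueRate_apply ha, H.revenueRate_apply hp] at this
    linarith

end IsDemandFunction

/-- What the analysis of the algorithm uses about the market: `B` bounds prices and demand rates,
`K` is a bi-Lipschitz constant, `Q` a constant of the quadratic bounds; `x` is the inventory per unit
of time, and `pu`, `pc` are the unconstrained and the clearing price. -/
structure MarketBounds (plo phi x B K Q ε : ℝ) (lam : ℝ → ℝ) (pu pc : ℝ) : Prop where
  plo_nonneg : 0 ≤ plo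
  pu_mem : pu ∈ Icc plo phi
  pc_mem : pc ∈ Icc plo phi
  max_mem : max pu pc ∈ Icc (plo + ε) (phi - ε)
  phi_le : phi ≤ B
  anti : StrictAntiOn lam (Icc plo phi)
  nonneg : ∀ p ∈ Icc plo phi, 0 ≤ lam p
  le_bound : ∀ p ∈ Icc plo phi, lam p ≤ B
  lipschitz : ∀ p ∈ Icc plo phi, ∀ q ∈ Icc plo phi, |lam p - lam q| ≤ K * |p - q|
  lipschitz_inv : ∀ p ∈ Icc plo phi, ∀ q ∈ Icc plo phi, |p - q| ≤ K * |lam p - lam q|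
  lipschitz_mul : ∀ p ∈ Icc plo phi, ∀ q ∈ Icc plo phi, |p * lam p - q * lam q| ≤ K * |p - q|
  isMax : ∀ p ∈ Icc plo phi, p * lam p ≤ pu * lam pu
  sq_le : ∀ p ∈ Icc plo phi, (p - pu) ^ 2 ≤ Q * (pu * lam pu - p * lam p)
  le_sq : pu = plo ∨ ∀ p ∈ Icc plo phi, pu * lam pu - p * lam p ≤ Q * (p - pu) ^ 2
  slope : ∃ s, 0 ≤ s ∧ ∀ p ∈ Icc plo phi,
    lam p ≤ lam (max pu pc) - s * (p - max pu pc) + Q * (p - max pu pc) ^ 2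
  clearing : lam pc = x ∨ (pc = plo ∧ lam pc ≤ x)
  multiplier : ∃ m, 0 ≤ m ∧ 0 ≤ max pu pc * lam (max pu pc) - m * x ∧ ∀ p ∈ Icc plo phi,
    p * lam p ≤ max pu pc * lam (max pu pc) + m * (lam p - x)
  value_pos : ε ^ 2 / K ≤ max pu pc * lam (max pu pc)

namespace IsDemandFunction

variable {plo phi pInf M K mL mU : ℝ} {lam : ℝ → ℝ}

/-- The slope of the demand function at an interior price. -/
theorem exists_slope (H : IsDemandFunction plo phi pInf M K mL mU lam) (hK : 0 < K)
    (hmL : 0 < mL)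
    {ε : ℝ} (hε : 0 < ε) {a : ℝ} (ha : a ∈ Icc plo phi) (haε : a ≤ phi - ε) {ra : ℝ}
    (hr : ∀ p ∈ Icc plo phi,
      p * lam p ≤ a * lam a + ra * (lam p - lam a) ∧
      a * lam a + ra * (lam p - lam a) - mL / 2 * (lam p - lam a) ^ 2 ≤ p * lam p) :
    ra ≤ a ∧ ∃ s, 0 ≤ s ∧ ∀ p ∈ Icc plo phi,
      lam p ≤ lam a - s * (p - a) +
        (mL / 2 * K ^ 2 + K) * K ^ 2 / ε * (p - a) ^ 2 := by
  set Q1 := mL / 2 * K ^ 2 + K with hQ1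
  have hQ1pos : 0 < Q1 := by positivity
  have hphi : phi ∈ Icc plo phi := right_mem_Icc.2 (ha.1.trans ha.2)
  have hl0 : ε / K ≤ lam a := by
    have h1 := H.abs_sub_le hphi ha
    have h2 := H.nonneg phi hphi
    have h3 := H.strictAnti ha hphi (by linarith)
    rw [abs_of_neg (by linarith : lam phi - lam a < 0), abs_of_pos (by linarith)] at h1
    rw [div_le_iff₀ hK]; nlinarith
  have hl0pos : 0 < lam a := lt_of_lt_of_le (by positivity) hl0
  -- Smoothness is assumed for `r` only, so the slope of `lam` is read off from the expansion of `p
  -- * lam p` at `a`: its first-order terms in `p - a` and `lam p - lam a` cancel up to a quadratic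
  -- error. Since `lam a ≥ ε / K`, the coefficient `a - ra` must be positive, in fact at least `ε /
  -- K ^ 2`, and one may divide by it.
  have hexp : ∀ p ∈ Icc plo phi,
      |lam a * (p - a) + (a - ra) * (lam p - lam a)| ≤ Q1 * (p - a) ^ 2 := by
    intro p hp
    obtain ⟨h1, h2⟩ := hr p hp
    have h3 := H.lipschitz_demand p hp a ha
    have h4 : (lam p - lam a) ^ 2 ≤ K ^ 2 * (p - a) ^ 2 := by
      rw [← mul_pow, ← sq_abs, ← sq_abs (K * (p - a)), abs_mul, abs_of_pos hK]
      exact pow_le_pow_left₀ (abs_nonneg _) h3 2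
    have h5 : |(p - a) * (lam p - lam a)| ≤ K * (p - a) ^ 2 := by
      rw [abs_mul, ← sq_abs (p - a)]
      nlinarith [abs_nonneg (p - a)]
    have h6 := abs_le.1 h5
    have h7 : mL / 2 * (lam p - lam a) ^ 2 ≤ mL / 2 * (K ^ 2 * (p - a) ^ 2) :=
      mul_le_mul_of_nonneg_left h4 (by linarith)
    rw [abs_le]
    constructor <;> nlinarith [h6.1, h6.2]
  have hright : ∀ t, 0 < t → t ≤ ε →
      lam a * t - Q1 * t ^ 2 ≤ (a - ra) * (lam a - lam (a + t)) ∧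
      0 < lam a - lam (a + t) ∧ lam a - lam (a + t) ≤ K * t := by
    intro t ht htε
    have hp : a + t ∈ Icc plo phi := ⟨by linarith [ha.1], by linarith⟩
    have h1 := abs_le.1 (hexp _ hp)
    have h2 := H.strictAnti ha hp (by linarith)
    have h3 := abs_le.1 (H.lipschitz_demand _ hp a ha)
    have e : a + t - a = t := by ring
    rw [e] at h1 h3
    rw [abs_of_pos ht] at h3
    refine ⟨by nlinarith [h1.2], by linarith, by linarith [h3.1]⟩
  have hc0 : 0 < a - ra := by
    by_contra hc
    push Not at hc
    have : lam a ≤ 0 := by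
      refine nonpos_of_forall_mul_le_sq (c := Q1) hε fun t ht htε => ?_
      obtain ⟨h1, h2, h3⟩ := hright t ht htε
      nlinarith
    linarith
  have hcK : lam a ≤ (a - ra) * K := by
    have : lam a - (a - ra) * K ≤ 0 := by
      refine nonpos_of_forall_mul_le_sq (c := Q1) hε fun t ht htε => ?_
      obtain ⟨h1, h2, h3⟩ := hright t ht htε
      nlinarith
    linarith
  refine ⟨by linarith, lam a / (a - ra), by positivity, fun p hp => ?_⟩
  have h1 := (abs_le.1 (hexp p hp)).2
  have hcmin : ε / K ^ 2 ≤ a - ra := by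
    rw [div_le_iff₀ hK] at hl0
    rw [div_le_iff₀ (by positivity)]; nlinarith
  have h2 : lam p - lam a ≤ - (lam a / (a - ra)) * (p - a) + Q1 * (p - a) ^ 2 / (a - ra) := by
    have e : - (lam a / (a - ra)) * (p - a) + Q1 * (p - a) ^ 2 / (a - ra)
        = (- lam a * (p - a) + Q1 * (p - a) ^ 2) / (a - ra) := by
      field_simp
    rw [e, le_div_iff₀ hc0]; nlinarith
  have h3 : Q1 * (p - a) ^ 2 / (a - ra) ≤ Q1 * K ^ 2 / ε * (p - a) ^ 2 := by
    rw [div_le_iff₀ hc0]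
    have : Q1 * (p - a) ^ 2 = Q1 * K ^ 2 / ε * (p - a) ^ 2 * (ε / K ^ 2) := by
      field_simp
    calc _ = Q1 * K ^ 2 / ε * (p - a) ^ 2 * (ε / K ^ 2) := this
      _ ≤ _ := mul_le_mul_of_nonneg_left hcmin (by positivity)
  linarith

/-- `B` and `Q` are fixed before the prices and the demand function, which makes the final constant
uniform over the class. The two quadratic bounds at `pu` reflect the two bounds on the second
derivative; the other items come from the intermediate value theorem and first-order conditions. -/
theorem exists_marketBounds (M K mL mU ε : ℝ) (hM : 0 < M) (hK : 0 < K) (hmL : 0 < mL)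
    (hmU : 0 < mU) (hε : 0 < ε) : ∃ B Q : ℝ, 0 < B ∧ 0 < Q ∧ ∀ (plo phi pInf x T : ℝ)
    (lam : ℝ → ℝ), 0 ≤ plo → plo < phi → 0 < x → 0 < T →
    IsDemandFunction plo phi pInf M K mL mU lam →
    (∃ p ∈ Icc (plo + ε) (phi - ε), IsDeterministicPrice plo phi x T lam p) →
    ∃ pu pc, MarketBounds plo phi (x / T) B K Q ε lam pu pc := by
  set Q := 2 * K ^ 2 / mU + mL / 2 * K ^ 2 + (mL / 2 * K ^ 2 + K) * K ^ 2 / ε with hQ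
  refine ⟨K * (K + M) + M, Q, by positivity, by positivity, ?_⟩
  rintro plo phi pInf x T lam h0 hlt hx hT H ⟨p, hpε, pu, hpu, pc, hpc, hmax, hmin, rfl⟩
  have hxT : 0 < x / T := by positivity
  have hphi : phi ∈ Icc plo phi := right_mem_Icc.2 hlt.le
  have hplo : plo ∈ Icc plo phi := left_mem_Icc.2 hlt.le
  have hD : max pu pc ∈ Icc plo phi := ⟨by linarith [hpε.1], by linarith [hpε.2]⟩
  obtain ⟨r', hr⟩ := H.exists_tangent hK
  have hmax' : ∀ q ∈ Icc plo phi, q * lam q ≤ pu * lam pu := by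
    intro q hq
    have := hmax hq
    simp only [mem_ofPred_eq] at this
    rwa [H.revenueRate_apply hq, H.revenueRate_apply hpu] at this
  have hmin' : ∀ q ∈ Icc plo phi, |lam pc - x / T| ≤ |lam q - x / T| := fun q hq => hmin hq
  have hpcε : pc ≤ phi - ε := (le_max_right _ _).trans hpε.2
  have hpuε : pu ≤ phi - ε := (le_max_left _ _).trans hpε.2
  -- directional derivative at the maximum
  have hdir : ∀ q ∈ Icc plo phi, r' pu * (lam q - lam pu) ≤ 0 := by
    intro q hq
    refine nonpos_of_forall_mul_le_sq (c := mL / 2 * (lam q - lam pu) ^ 2) one_pos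
      fun t ht ht1 => ?_
    have hmem : lam pu + t * (lam q - lam pu) ∈ lam '' Icc plo phi := by
      have := (H.convex_range hK) (mem_image_of_mem lam hpu) (mem_image_of_mem lam hq)
        (sub_nonneg.2 ht1) ht.le (by ring)
      convert this using 1
      simp only [smul_eq_mul]; ring
    obtain ⟨z, hz, hze⟩ := hmem
    have h1 := (hr pu hpu z hz).2
    have h2 := hmax' z hz
    rw [hze] at h1 h2
    have e : lam pu + t * (lam q - lam pu) - lam pu = t * (lam q - lam pu) := by ring
    rw [e] at h1
    nlinarith
  have hlipsq : ∀ p ∈ Icc plo phi, ∀ q ∈ Icc plo phi,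
      (lam p - lam q) ^ 2 ≤ K ^ 2 * (p - q) ^ 2 := by
    intro p hp q hq
    rw [← mul_pow, ← sq_abs, ← sq_abs (K * (p - q)), abs_mul, abs_of_pos hK]
    exact pow_le_pow_left₀ (abs_nonneg _) (H.lipschitz_demand p hp q hq) 2
  have hinvsq : ∀ p ∈ Icc plo phi, ∀ q ∈ Icc plo phi,
      (p - q) ^ 2 ≤ K ^ 2 * (lam p - lam q) ^ 2 := by
    intro p hp q hq
    rw [← mul_pow, ← sq_abs, ← sq_abs (K * (lam p - lam q)), abs_mul, abs_of_pos hK]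
    exact pow_le_pow_left₀ (abs_nonneg _) (H.abs_sub_le hp hq) 2
  -- Demand above `x / T` at `pc` is impossible, because `pc` keeps the distance `ε` from `phi` and
  -- a slightly higher price would be closer. Demand below it is possible only if no lower price is
  -- available.
  have hclear : lam pc = x / T ∨ (pc = plo ∧ lam pc ≤ x / T) := by
    rcases lt_trichotomy (lam pc) (x / T) with h | h | h
    · right
      refine ⟨?_, h.le⟩
      by_contra hne
      have hlt' : plo < pc := lt_of_le_of_ne hpc.1 (Ne.symm hne)
      have hl1 := H.strictAnti hplo hpc hlt'
      -- the intermediate value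
      obtain ⟨v, hv1, hv2⟩ : ∃ v, lam pc < v ∧ v < min (lam plo) (x / T) :=
        exists_between (lt_min hl1 h)
      have hvm : v ∈ lam '' Icc plo phi :=
        (H.convex_range hK).ordConnected.out (mem_image_of_mem lam hpc)
          (mem_image_of_mem lam hplo) ⟨hv1.le, (hv2.trans_le (min_le_left _ _)).le⟩
      obtain ⟨q, hq, rfl⟩ := hvm
      have h5 := hmin' q hq
      have h6 := hv2.trans_le (min_le_right _ _)
      rw [abs_of_neg (by linarith), abs_of_neg (by linarith)] at h5
      linarith
    · exact Or.inl h
    · exfalso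
      have hl1 := H.strictAnti hpc hphi (by linarith)
      obtain ⟨v, hv1, hv2⟩ : ∃ v, max (lam phi) (x / T) < v ∧ v < lam pc :=
        exists_between (max_lt hl1 h)
      have hvm : v ∈ lam '' Icc plo phi :=
        (H.convex_range hK).ordConnected.out (mem_image_of_mem lam hphi)
          (mem_image_of_mem lam hpc) ⟨((le_max_left _ _).trans_lt hv1).le, hv2.le⟩
      obtain ⟨q, hq, rfl⟩ := hvm
      have h5 := hmin' q hq
      have h6 := (le_max_right _ _).trans_lt hv1
      rw [abs_of_pos (by linarith), abs_of_pos (by linarith)] at h5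
      linarith
  have hslope := H.exists_slope hK hmL hε hD hpε.2 (ra := r' (max pu pc)) (fun p hp =>
    ⟨(hr _ hD p hp).1.trans (sub_le_self _ (by positivity)), (hr _ hD p hp).2⟩)
  have hQ1 : 2 * K ^ 2 / mU ≤ Q := by
    have : 0 ≤ mL / 2 * K ^ 2 := by positivity
    have : 0 ≤ (mL / 2 * K ^ 2 + K) * K ^ 2 / ε := by positivity
    rw [hQ]; linarith
  have hQ2 : mL / 2 * K ^ 2 ≤ Q := by
    have : 0 ≤ 2 * K ^ 2 / mU := by positivity
    have : 0 ≤ (mL / 2 * K ^ 2 + K) * K ^ 2 / ε := by positivity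
    rw [hQ]; linarith
  have hQ3 : (mL / 2 * K ^ 2 + K) * K ^ 2 / ε ≤ Q := by
    have : 0 ≤ 2 * K ^ 2 / mU := by positivity
    have : 0 ≤ mL / 2 * K ^ 2 := by positivity
    rw [hQ]; linarith
  refine ⟨pu, pc, ?_⟩
  refine
  { plo_nonneg := h0
    pu_mem := hpu
    pc_mem := hpc
    max_mem := hpε
    phi_le := by linarith [H.price_le hK h0 hlt hphi]
    anti := H.strictAnti
    nonneg := H.nonneg
    le_bound := fun p hp => by
      have := H.le_bound hp
      have : 0 ≤ K * (K + M) := by positivity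
      linarith
    lipschitz := H.lipschitz_demand
    lipschitz_inv := fun p hp q hq => H.abs_sub_le hp hq
    lipschitz_mul := fun p hp q hq => H.lipschitz_mul hp hq
    isMax := hmax'
    sq_le := ?_
    le_sq := ?_
    slope := ?_
    clearing := hclear
    multiplier := ?_
    value_pos := ?_ }
  · intro p hp
    have h1 := (hr pu hpu p hp).1
    have h2 := hdir p hp
    have h3 := hinvsq p hp pu hpu
    have h4 : mU / 2 * (lam p - lam pu) ^ 2 ≤ pu * lam pu - p * lam p := by linarith
    have h5 := hmax' p hp
    calc (p - pu) ^ 2 ≤ K ^ 2 * (lam p - lam pu) ^ 2 := h3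
      _ = 2 * K ^ 2 / mU * (mU / 2 * (lam p - lam pu) ^ 2) := by field_simp
      _ ≤ 2 * K ^ 2 / mU * (pu * lam pu - p * lam p) :=
        mul_le_mul_of_nonneg_left h4 (by positivity)
      _ ≤ _ := mul_le_mul_of_nonneg_right hQ1 (by linarith)
  · rcases eq_or_lt_of_le hpu.1 with h | h
    · exact Or.inl h.symm
    · right
      -- At an interior maximum both directions are admissible and the derivative vanishes. If `pu =
      -- plo` it need not, and the quadratic upper bound may fail; hence the alternative in `le_sq`.
      have hr0 : r' pu = 0 := by
        have h1 := hdir plo hplo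
        have h2 := hdir phi hphi
        have h3 := H.strictAnti hplo hpu h
        have h4 := H.strictAnti hpu hphi (by linarith)
        apply le_antisymm
        · by_contra hc; push Not at hc; nlinarith
        · by_contra hc; push Not at hc; nlinarith
      intro p hp
      have h1 := (hr pu hpu p hp).2
      rw [hr0, zero_mul, add_zero] at h1
      have h3 := hlipsq p hp pu hpu
      calc pu * lam pu - p * lam p ≤ mL / 2 * (lam p - lam pu) ^ 2 := by linarith
        _ ≤ mL / 2 * (K ^ 2 * (p - pu) ^ 2) := mul_le_mul_of_nonneg_left h3 (by positivity)
        _ = mL / 2 * K ^ 2 * (p - pu) ^ 2 := by ring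
        _ ≤ _ := mul_le_mul_of_nonneg_right hQ2 (sq_nonneg _)
  · obtain ⟨-, s, hs, h⟩ := hslope
    refine ⟨s, hs, fun p hp => (h p hp).trans ?_⟩
    have := mul_le_mul_of_nonneg_right hQ3 (sq_nonneg (p - max pu pc))
    linarith
  -- The inventory constraint matters only if `pu < pc`; then the multiplier is the marginal revenue
  -- at `pc`. It is nonnegative because `pu` sells more and earns no less, and it is at most `pc` by
  -- `exists_slope`, which takes care of `pInf`, where nothing is sold.
  · rcases le_or_gt pc pu with h | h
    · refine ⟨0, le_rfl, ?_, fun p hp => ?_⟩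
      · have := H.nonneg _ hD
        have : 0 ≤ max pu pc := h0.trans hD.1
        rw [zero_mul, sub_zero]; positivity
      · rw [max_eq_left h, zero_mul, add_zero]; exact hmax' p hp
    · have hm : max pu pc = pc := max_eq_right h.le
      have hxe : lam pc = x / T := by
        rcases hclear with h' | h'
        · exact h'
        · rw [hm, h'.1] at hpε; linarith [hpε.1]
      rw [hm] at hslope ⊢
      refine ⟨r' pc, ?_, ?_, fun p hp => ?_⟩
      · have h1 := (hr pc hpc pu hpu).1
        have h2 := hmax' pc hpc
        have h3 := H.strictAnti hpu hpc h
        have h4 : 0 ≤ mU / 2 * (lam pu - lam pc) ^ 2 := by positivity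
        by_contra hc
        push Not at hc
        nlinarith
      · rw [← hxe]
        have := hslope.1
        have := H.nonneg _ hpc
        nlinarith
      · rw [← hxe]
        exact (hr pc hpc p hp).1.trans (sub_le_self _ (by positivity))
  · have h1 := H.abs_sub_le hphi hD
    have h2 := H.nonneg phi hphi
    have h3 := H.strictAnti hD hphi (by linarith [hpε.2])
    rw [abs_of_neg (by linarith : lam phi - lam (max pu pc) < 0),
      abs_of_pos (by linarith [hpε.2])] at h1
    rw [div_le_iff₀ hK]
    have h4 : ε ≤ max pu pc := by linarith [hpε.1]
    have h5 : ε ≤ lam (max pu pc) * K := by nlinarith [hpε.2]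
    nlinarith

end IsDemandFunction

/-! ### The deterministic problem and its solution by a constant price. -/

namespace MarketBounds

variable {plo phi x B K Q ε : ℝ} {lam : ℝ → ℝ} {pu pc : ℝ}

theorem le (h : MarketBounds plo phi x B K Q ε lam pu pc) : plo ≤ phi :=
  h.pu_mem.1.trans h.pu_mem.2

theorem max_mem' (h : MarketBounds plo phi x B K Q ε lam pu pc) : max pu pc ∈ Icc plo phi :=
  max_rec' (· ∈ Icc plo phi) h.pu_mem h.pc_mem

/-- On the feasible prices the demand function agrees with a bounded measurable function. -/
theorem exists_measurable_eq (h : MarketBounds plo phi x B K Q ε lam pu pc) (hB : 0 ≤ B)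
    {pInf : ℝ} (h0 : lam pInf = 0) : ∃ g : ℝ → ℝ, Measurable g ∧ (∀ p, 0 ≤ g p ∧ g p ≤ B) ∧
      ∀ p ∈ Icc plo phi ∪ {pInf}, lam p = g p := by
  have hanti : Antitone (IccExtend h.le ((Icc plo phi).domRestrict lam)) := by
    intro a b hab
    exact h.anti.antitoneOn (projIcc plo phi h.le a).2 (projIcc plo phi h.le b).2
      (monotone_projIcc h.le hab)
  refine ⟨(Icc plo phi).indicator (IccExtend h.le ((Icc plo phi).domRestrict lam)),
    hanti.measurable.indicator measurableSet_Icc, fun p => ?_, fun p hp => ?_⟩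
  · by_cases hp : p ∈ Icc plo phi
    · rw [indicator_of_mem hp, IccExtend_of_mem _ _ hp]
      exact ⟨h.nonneg p hp, h.le_bound p hp⟩
    · rw [indicator_of_notMem hp]; exact ⟨le_rfl, hB⟩
  · by_cases hp' : p ∈ Icc plo phi
    · rw [indicator_of_mem hp', IccExtend_of_mem _ _ hp']; rfl
    · rw [indicator_of_notMem hp']
      rcases hp with hp | hp
      · exact absurd hp hp'
      · rw [mem_singleton_iff.1 hp, h0]

theorem lam_max_le (h : MarketBounds plo phi x B K Q ε lam pu pc) : lam (max pu pc) ≤ x := by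
  have h1 := h.anti.antitoneOn h.pc_mem h.max_mem' (le_max_right pu pc)
  rcases h.clearing with h2 | h2
  · linarith
  · linarith [h2.2]

/-- The deterministic value is positive and attained by a constant price. -/
theorem deterministicValue_bounds {T pInf n : ℝ}
    (h : MarketBounds plo phi (x / T) B K Q ε lam pu pc) (hB : 0 ≤ B)
    (hK : 0 < K) (hε : 0 < ε) (hT : 0 < T) (hn : 0 < n) (h0 : lam pInf = 0) :
    0 < deterministicValue plo phi pInf (n * x) T (fun p => n * lam p) ∧
    deterministicValue plo phi pInf (n * x) T (fun p => n * lam p) ≤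
      n * T * (max pu pc * lam (max pu pc)) := by
  set pD := max pu pc with hpD
  set f := pD * lam pD with hf
  obtain ⟨g, hgm, hgb, hg⟩ := h.exists_measurable_eq hB h0
  obtain ⟨m, hm0, hm1, hm2⟩ := h.multiplier
  have hub : ∀ v ∈ {v | ∃ p : ℝ → ℝ, Measurable p ∧
      (∀ s ∈ Icc 0 T, p s ∈ Icc plo phi ∪ {pInf}) ∧
      (∫ s in (0 : ℝ)..T, n * lam (p s)) ≤ n * x ∧ v = ∫ s in (0 : ℝ)..T, p s * (n * lam (p s))},
      v ≤ n * T * f := by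
    rintro v ⟨p, hp, hmem, hX, rfl⟩
    have hEq : EqOn (fun s => n * lam (p s)) (fun s => n * g (p s)) (uIcc 0 T) := by
      intro s hs
      rw [uIcc_of_le hT.le] at hs
      simp only [hg _ (hmem s hs)]
    -- Integrability has to be proved: the inventory constraint concerns an integral that would be
    -- `0` by convention otherwise.
    have hint : IntervalIntegrable (fun s => n * g (p s)) volume 0 T := by
      rw [intervalIntegrable_iff_integrableOn_Ioc_of_le hT.le]
      refine Measure.integrableOn_of_bounded (M := n * B) (by simp)
        ((hgm.comp hp).const_mul n).aestronglyMeasurable (Filter.Eventually.of_forall fun s => ?_)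
      rw [Real.norm_eq_abs, abs_of_nonneg (mul_nonneg hn.le (hgb _).1)]
      exact mul_le_mul_of_nonneg_left (hgb _).2 hn.le
    have hint' : IntervalIntegrable (fun s => n * lam (p s)) volume 0 T :=
  (intervalIntegrable_congr (hEq.mono uIoc_subset_uIcc)).2 hint
    -- Weak duality at each time; at `pInf` it is the second clause of `multiplier`.
    have hbd : ∀ s ∈ Icc 0 T, p s * (n * lam (p s)) ≤ n * f + m * (n * lam (p s)) - m * (n * (x / T)) := by
      intro s hs
      rcases hmem s hs with hs' | hs'
      · have := hm2 _ hs'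
        nlinarith
      · rw [mem_singleton_iff.1 hs', h0]
        nlinarith
    have hupint : IntervalIntegrable
        (fun s => n * f + m * (n * lam (p s)) - m * (n * (x / T))) volume 0 T :=
      ((intervalIntegrable_const).add (hint'.const_mul m)).sub intervalIntegrable_const
    have hle : ∫ s in (0 : ℝ)..T, p s * (n * lam (p s)) ≤
        ∫ s in (0 : ℝ)..T, (n * f + m * (n * lam (p s)) - m * (n * (x / T))) := by
      by_cases hi : IntervalIntegrable (fun s => p s * (n * lam (p s))) volume 0 T
      · exact intervalIntegral.integral_mono_on hT.le hi hupint hbd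
      · rw [intervalIntegral.integral_undef hi]
        refine intervalIntegral.integral_nonneg hT.le fun s hs => le_trans ?_ (hbd s hs)
        rcases hmem s hs with hs' | hs'
        · exact mul_nonneg (h.plo_nonneg.trans hs'.1) (mul_nonneg hn.le (h.nonneg _ hs'))
        · rw [mem_singleton_iff.1 hs', h0]; simp
    refine hle.trans ?_
    rw [intervalIntegral.integral_sub (intervalIntegrable_const.add (hint'.const_mul m))
      intervalIntegrable_const, intervalIntegral.integral_add intervalIntegrable_const
      (hint'.const_mul m), intervalIntegral.integral_const_mul m]
    simp only [intervalIntegral.integral_const, sub_zero, smul_eq_mul]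
    have e : T * (m * (n * (x / T))) = m * (n * x) := by field_simp
    rw [e]
    have := mul_le_mul_of_nonneg_left hX hm0
    linarith
  have hvpos : 0 < f := lt_of_lt_of_le (by positivity) h.value_pos
  have hmemv : n * T * f ∈ {v | ∃ p : ℝ → ℝ, Measurable p ∧
      (∀ s ∈ Icc 0 T, p s ∈ Icc plo phi ∪ {pInf}) ∧
      (∫ s in (0 : ℝ)..T, n * lam (p s)) ≤ n * x ∧
      v = ∫ s in (0 : ℝ)..T, p s * (n * lam (p s))} := by
    refine ⟨fun _ => pD, measurable_const, fun _ _ => Or.inl h.max_mem', ?_, ?_⟩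
    · simp only [intervalIntegral.integral_const, sub_zero, smul_eq_mul]
      have := h.lam_max_le
      rw [le_div_iff₀ hT] at this
      nlinarith
    · simp only [intervalIntegral.integral_const, sub_zero, smul_eq_mul]
      rw [hf]; ring
  refine ⟨lt_of_lt_of_le (by positivity) (le_csSup ⟨_, hub⟩ hmemv), csSup_le ⟨_, hmemv⟩ hub⟩

end MarketBounds

/-! ### Concentration of the Poisson process -/

theorem hasSum_exp_poissonMeasure (r : ℝ≥0) (θ : ℝ) :
    HasSum (fun k : ℕ => Real.exp (-r) * r ^ k / k.factorial * Real.exp (θ * k))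
      (Real.exp (r * (Real.exp θ - 1))) := by
  have h := NormedSpace.expSeries_div_hasSum_exp (𝔸 := ℝ) ((r : ℝ) * Real.exp θ)
  rw [← Real.exp_eq_exp_ℝ] at h
  have h2 := h.mul_left (Real.exp (-r))
  rw [← Real.exp_add] at h2
  rw [show (r : ℝ) * (Real.exp θ - 1) = -r + r * Real.exp θ by ring]
  refine h2.congr_fun fun k => ?_
  rw [mul_pow, ← Real.exp_nat_mul, mul_comm θ]
  ring

/-- Chernoff bound for the Poisson distribution. -/
theorem poissonMeasure_real_le (r : ℝ≥0) {θ a : ℝ} (hθ : |θ| ≤ 1) (s : Set ℕ)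
    (hs : ∀ k ∈ s, a ≤ θ * (k - r)) :
    (poissonMeasure r).real s ≤ Real.exp (r * θ ^ 2 - a) := by
  have hsum := hasSum_exp_poissonMeasure r θ
  have hint : Integrable (fun k : ℕ => Real.exp (θ * k)) (poissonMeasure r) := by
    rw [integrable_poissonMeasure_iff]
    refine hsum.summable.congr fun k => ?_
    rw [Real.norm_eq_abs, Real.abs_exp]
  have hE : ∫ k : ℕ, Real.exp (θ * k) ∂(poissonMeasure r) = Real.exp (r * (Real.exp θ - 1)) := by
    have h2 := (hasSum_integral_poissonMeasure hint).unique (by simpa [smul_eq_mul] using hsum)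
    exact h2
  have hprob : IsProbabilityMeasure (poissonMeasure r) := inferInstance
  have h1 : Real.exp (a + θ * r) * (poissonMeasure r).real s ≤ Real.exp (r * (Real.exp θ - 1)) := by
    rw [← hE]
    refine le_trans ?_ (mul_meas_ge_le_integral_of_nonneg
      (Filter.Eventually.of_forall fun k => (Real.exp_pos _).le) hint (Real.exp (a + θ * r)))
    refine mul_le_mul_of_nonneg_left (measureReal_mono (fun k hk => ?_)) (Real.exp_pos _).le
    have := hs k hk
    exact Real.exp_le_exp.2 (by nlinarith)
  have h2 : (poissonMeasure r).real s ≤ Real.exp (r * (Real.exp θ - 1) - (a + θ * r)) := by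
    rw [Real.exp_sub, le_div_iff₀ (Real.exp_pos _)]; linarith
  refine h2.trans (Real.exp_le_exp.2 ?_)
  -- For `|θ| ≤ 1` one has `exp θ - 1 - θ ≤ θ ^ 2`, which makes the exponent quadratic.
  have h3 := (abs_le.1 (Real.abs_exp_sub_one_sub_id_le hθ)).2
  have hr : (0 : ℝ) ≤ r := r.2
  nlinarith

/-- With the tilt `θ = √(c / (l + c))`, the product of `θ` and the threshold is `2 * c`, while `l *
θ ^ 2 ≤ c`. The additional `c` under the root keeps `θ ≤ 1` when `l` is small. -/
theorem poissonMeasure_real_deviation_le (l : ℕ) {c : ℝ} (hc : 0 < c) :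
    (poissonMeasure (l : ℝ≥0)).real {k : ℕ | 2 * √(c * (l + c)) ≤ |(k : ℝ) - l|} ≤
      2 * Real.exp (-c) := by
  have hlc : 0 < (l : ℝ) + c := by positivity
  set θ := √(c / (l + c)) with hθ
  have hθ2 : θ ^ 2 = c / (l + c) := Real.sq_sqrt (by positivity)
  have hθ0 : 0 ≤ θ := Real.sqrt_nonneg _
  have hθ1 : |θ| ≤ 1 := by
    rw [abs_of_nonneg hθ0]
    refine Real.sqrt_le_one.2 ((div_le_one hlc).2 ?_)
    linarith [(Nat.cast_nonneg l : (0 : ℝ) ≤ l)]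
  have hprod : θ * √(c * (l + c)) = c := by
    rw [hθ, ← Real.sqrt_mul (by positivity),
      show c / (l + c) * (c * (l + c)) = c ^ 2 by field_simp, Real.sqrt_sq hc.le]
  have hle : (l : ℝ) * θ ^ 2 ≤ c := by
    rw [hθ2, mul_div_assoc', div_le_iff₀ hlc]; nlinarith
  have hsub : {k : ℕ | 2 * √(c * (l + c)) ≤ |(k : ℝ) - l|} ⊆
      {k : ℕ | 2 * c ≤ θ * (k - ((l : ℝ≥0) : ℝ))} ∪ {k : ℕ | 2 * c ≤ -θ * (k - ((l : ℝ≥0) : ℝ))} := by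
    intro k hk
    simp only [mem_ofPred_eq] at hk
    simp only [mem_union, mem_ofPred_eq, NNReal.coe_natCast]
    have := mul_le_mul_of_nonneg_left hk hθ0
    rcases le_total 0 ((k : ℝ) - l) with h | h
    · left; rw [abs_of_nonneg h] at this; linarith
    · right; rw [abs_of_nonpos h] at this; linarith
  refine (measureReal_mono hsub).trans ((measureReal_union_le _ _).trans ?_)
  have b1 := poissonMeasure_real_le (l : ℝ≥0) (a := 2 * c) hθ1
    {k : ℕ | 2 * c ≤ θ * (k - ((l : ℝ≥0) : ℝ))} (fun k hk => hk)
  have b2 := poissonMeasure_real_le (l : ℝ≥0) (θ := -θ) (a := 2 * c) (by rwa [abs_neg])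
    {k : ℕ | 2 * c ≤ -θ * (k - ((l : ℝ≥0) : ℝ))} (fun k hk => hk)
  have e1 : Real.exp (((l : ℝ≥0) : ℝ) * θ ^ 2 - 2 * c) ≤ Real.exp (-c) :=
    Real.exp_le_exp.2 (by simp only [NNReal.coe_natCast]; linarith)
  rw [neg_sq] at b2
  linarith

/-- The paths which on `[0, H]` stay close to the identity, uniformly over all increments between
integer times. -/
def IsRegularPath (H : ℕ) (c : ℝ) (ν : ℝ≥0 → ℕ) : Prop :=
  ∀ a ≤ H, ∀ l ≤ H,
    |((ν ((a : ℝ≥0) + l) : ℝ) - ν a) - l| ≤ 2 * √(c * (l + c))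

/-- A union bound over the pairs of a starting time and a length. With `c = 3 log n` and `H` of
order `n` the result is of order `1 / n`. -/
theorem measure_not_isRegularPath_le {Ω : Type*} [MeasurableSpace Ω] {μ : Measure Ω}
    [IsProbabilityMeasure μ] {N : ℝ≥0 → Ω → ℕ} (hN : IsUnitPoissonProcess μ N) (H : ℕ) {c : ℝ}
    (hc : 0 < c) :
    μ.real {ω | ¬ IsRegularPath H c (fun t => N t ω)} ≤ 2 * (H + 1) ^ 2 * Real.exp (-c) := by
  have hsub : {ω | ¬ IsRegularPath H c (fun t => N t ω)} ⊆
      ⋃ i ∈ Finset.range (H + 1) ×ˢ Finset.range (H + 1),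
        (fun ω => N ((i.1 : ℝ≥0) + (i.2 : ℕ)) ω - N (i.1 : ℕ) ω) ⁻¹'
          {k : ℕ | 2 * √(c * ((i.2 : ℕ) + c)) ≤ |(k : ℝ) - (i.2 : ℕ)|} := by
    intro ω hω
    simp only [IsRegularPath, mem_ofPred_eq, not_forall] at hω
    obtain ⟨a, ha, l, hl, h⟩ := hω
    simp only [mem_iUnion]
    refine ⟨(a, l), by simp; omega, ?_⟩
    simp only [mem_preimage, mem_ofPred_eq]
    have hm : N (a : ℝ≥0) ω ≤ N ((a : ℝ≥0) + l) ω := (hN.paths ω).mono (by simp)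
    rw [Nat.cast_sub hm]
    push Not at h
    exact h.le
  refine (measureReal_mono hsub (measure_ne_top _ _)).trans ((measureReal_biUnion_finset_le _ _).trans ?_)
  have hterm : ∀ i ∈ Finset.range (H + 1) ×ˢ Finset.range (H + 1),
      μ.real ((fun ω => N ((i.1 : ℝ≥0) + (i.2 : ℕ)) ω - N (i.1 : ℕ) ω) ⁻¹'
          {k : ℕ | 2 * √(c * ((i.2 : ℕ) + c)) ≤ |(k : ℝ) - (i.2 : ℕ)|}) ≤ 2 * Real.exp (-c) := by
    intro i _
    have hmeas : Measurable (fun ω => N ((i.1 : ℝ≥0) + (i.2 : ℕ)) ω - N (i.1 : ℕ) ω) :=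
      (hN.measurable _).sub (hN.measurable _)
    rw [← map_measureReal_apply hmeas (MeasurableSet.of_discrete), hN.increments]
    exact poissonMeasure_real_deviation_le _ hc
  refine (Finset.sum_le_sum hterm).trans ?_
  rw [Finset.sum_const, Finset.card_product, Finset.card_range, nsmul_eq_mul]
  push_cast
  apply le_of_eq; ring

theorem IsRegularPath.measurableSet {Ω : Type*} [MeasurableSpace Ω] {N : ℝ≥0 → Ω → ℕ}
    (hN : ∀ t, Measurable (N t)) (H : ℕ) (c : ℝ) :
    MeasurableSet {ω | IsRegularPath H c (fun t => N t ω)} := by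
  have : {ω | IsRegularPath H c (fun t => N t ω)} = ⋂ a ∈ {a | a ≤ H}, ⋂ l ∈ {l | l ≤ H},
      {ω | |((N ((a : ℝ≥0) + (l : ℕ)) ω : ℝ) - N (a : ℕ) ω) - (l : ℕ)| ≤ 2 * √(c * ((l : ℕ) + c))} := by
    ext ω; simp [IsRegularPath]
  rw [this]
  refine MeasurableSet.biInter (to_countable _) fun a _ =>
    MeasurableSet.biInter (to_countable _) fun l _ => ?_
  have h1 : ∀ t, Measurable fun ω => (N t ω : ℝ) := fun t =>
    (measurable_from_nat (f := fun k : ℕ => (k : ℝ))).comp (hN t)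
  refine measurableSet_le ?_ measurable_const
  exact (((h1 _).sub (h1 _)).sub_const _).abs

/-- Monotonicity sandwiches real times between integer ones, at the price of changing the length by
at most `2`. For integer increments `2 √(3 L (V + 2 + 3 L)) ≤ 2 √(18 L V) ≤ 9 √(L V)`, and the
rounding adds `2 ≤ 2 √(L V)`. -/
theorem IsRegularPath.abs_sub_le {H : ℕ} {L : ℝ} {ν : ℝ≥0 → ℕ} (h : IsRegularPath H (3 * L) ν)
    (hν : Monotone ν) (hL : 1 ≤ L) {s t V : ℝ} (hs : 0 ≤ s) (hst : s ≤ t) (htH : t + 1 ≤ H)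
    (hV : t - s ≤ V) (hLV : L ≤ V) :
    |((ν t.toNNReal : ℝ) - ν s.toNNReal) - (t - s)| ≤ 11 * √(L * V) := by
  have hreg : ∀ a b : ℕ, a ≤ b → b ≤ H → ((b : ℝ) - a ≤ V + 2) →
      |((ν b : ℝ) - ν a) - (b - a)| ≤ 9 * √(L * V) := by
    intro a b hab hb hV'
    have h1 := h a (hab.trans hb) (b - a) ((Nat.sub_le _ _).trans hb)
    have e : ((a : ℝ≥0) + ((b - a : ℕ) : ℝ≥0)) = b := by
      rw [← Nat.cast_add, Nat.add_sub_cancel' hab]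
    rw [e, Nat.cast_sub hab] at h1
    refine h1.trans ?_
    have h2 : √(3 * L * ((b : ℝ) - a + 3 * L)) ≤ √(18 * (L * V)) := by
      apply Real.sqrt_le_sqrt; nlinarith
    have h3 : √(18 * (L * V)) ≤ 9 / 2 * √(L * V) := by
      rw [show 9 / 2 * √(L * V) = √((9 / 2) ^ 2 * (L * V)) by
        rw [Real.sqrt_mul (by norm_num) (L * V), Real.sqrt_sq (by norm_num)]]
      apply Real.sqrt_le_sqrt; nlinarith
    linarith
  have hLV1 : 1 ≤ √(L * V) := by
    rw [Real.one_le_sqrt]; nlinarith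
  have hcs : ∀ r : ℝ, 0 ≤ r → (r.toNNReal ≤ ((⌈r⌉₊ : ℕ) : ℝ≥0)) := fun r hr => by
    rw [Real.toNNReal_le_iff_le_coe]; exact Nat.le_ceil r
  have hfs : ∀ r : ℝ, 0 ≤ r → (((⌊r⌋₊ : ℕ) : ℝ≥0) ≤ r.toNNReal) := fun r hr => by
    exact NNReal.le_toNNReal_of_coe_le (Nat.floor_le hr)
  have ht : 0 ≤ t := hs.trans hst
  have c1 := Nat.ceil_lt_add_one ht
  have c2 := Nat.ceil_lt_add_one hs
  have c3 := Nat.le_ceil t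
  have c4 := Nat.le_ceil s
  have f1 := Nat.floor_le ht
  have f2 := Nat.floor_le hs
  have f3 := Nat.lt_floor_add_one t
  have f4 := Nat.lt_floor_add_one s
  rw [abs_le]
  constructor
  · rcases le_or_gt ⌈s⌉₊ ⌊t⌋₊ with hc | hc
    · have hb : ⌊t⌋₊ ≤ H := by
        have : (⌊t⌋₊ : ℝ) ≤ H := by linarith
        exact_mod_cast this
      have h1 := (abs_le.1 (hreg _ _ hc hb (by linarith))).1
      have m1 : (ν ((⌊t⌋₊ : ℕ) : ℝ≥0) : ℝ) ≤ ν t.toNNReal := by exact_mod_cast hν (hfs t ht)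
      have m2 : (ν s.toNNReal : ℝ) ≤ ν ((⌈s⌉₊ : ℕ) : ℝ≥0) := by exact_mod_cast hν (hcs s hs)
      linarith
    -- No integer lies between `s` and `t`; then `t - s < 1` and it is enough that the increment is
    -- nonnegative.
    · have hc' : (⌊t⌋₊ : ℝ) + 1 ≤ ⌈s⌉₊ := by exact_mod_cast hc
      have m1 : (ν s.toNNReal : ℝ) ≤ ν t.toNNReal := by
        exact_mod_cast hν (Real.toNNReal_le_toNNReal hst)
      linarith
  · have hab : ⌊s⌋₊ ≤ ⌈t⌉₊ := by
      have : (⌊s⌋₊ : ℝ) ≤ ⌈t⌉₊ := by linarith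
      exact_mod_cast this
    have hb : ⌈t⌉₊ ≤ H := Nat.ceil_le.2 (by linarith)
    have h1 := (abs_le.1 (hreg _ _ hab hb (by linarith))).2
    have m1 : (ν t.toNNReal : ℝ) ≤ ν ((⌈t⌉₊ : ℕ) : ℝ≥0) := by exact_mod_cast hν (hcs t ht)
    have m2 : (ν ((⌊s⌋₊ : ℕ) : ℝ≥0) : ℝ) ≤ ν s.toNNReal := by exact_mod_cast hν (hfs s hs)
    linarith

/-! ### Demand paths of policies that sample the demand at finitely many times -/

/-- The policy `π` uses, at time `t`, only the demand at the finitely many times in `S` before `t`. -/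
structure IsSampledPolicy (S : Finset ℝ) (T : ℝ) (π : PricingPolicy) : Prop where
  subset : ∀ s ∈ S, s ∈ Icc 0 T
  congr : ∀ D D' : ℝ → ℕ, ∀ t ∈ Icc 0 T, (∀ s ∈ S, s < t → D s = D' s) → π D t = π D' t

/-- Demand rates under `π` are nonnegative and integrable. -/
structure IsRegularRate (T : ℝ) (lam : ℝ → ℝ) (π : PricingPolicy) : Prop where
  nonneg : ∀ D, ∀ s ∈ Icc 0 T, 0 ≤ lam (π D s)
  integrable : ∀ D, IntervalIntegrable (fun s => lam (π D s)) volume 0 T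

/-- The demand that results from the prices which `π` charges if it observes `D`. -/
noncomputable def demandStep (lam : ℝ → ℝ) (π : PricingPolicy) (ν : ℝ≥0 → ℕ) (D : ℝ → ℕ) : ℝ → ℕ :=
  fun t => ν (∫ s in (0 : ℝ)..t, lam (π D s)).toNNReal

/-- The demand path of a sampled policy. -/
noncomputable def sampledDemand (lam : ℝ → ℝ) (π : PricingPolicy) (S : Finset ℝ) (ν : ℝ≥0 → ℕ) :
    ℝ → ℕ :=
  (demandStep lam π ν)^[S.card + 1] 0

theorem intervalIntegral_congr_Icc {f g : ℝ → ℝ} {t : ℝ} (ht : 0 ≤ t)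
    (h : ∀ s ∈ Icc 0 t, f s = g s) : ∫ s in (0 : ℝ)..t, f s = ∫ s in (0 : ℝ)..t, g s :=
  intervalIntegral.integral_congr fun s hs => h s (by rwa [uIcc_of_le ht] at hs)

namespace IsSampledPolicy

variable {S : Finset ℝ} {T : ℝ} {π : PricingPolicy} {lam : ℝ → ℝ} {ν : ℝ≥0 → ℕ}

theorem card_lt {s t : ℝ} (hs : s ∈ S) (hst : s < t) :
    (S.filter (· < s)).card < (S.filter (· < t)).card := by
  refine Finset.card_lt_card ⟨fun r hr => ?_, fun hsub => ?_⟩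
  · simp only [Finset.mem_filter] at hr ⊢
    exact ⟨hr.1, hr.2.trans hst⟩
  · have := hsub (Finset.mem_filter.2 ⟨hs, hst⟩)
    simp at this

theorem demandStep_congr (h : IsSampledPolicy S T π) {D D' : ℝ → ℕ} {t : ℝ} (ht : t ∈ Icc 0 T)
    (hD : ∀ s ∈ S, s < t → D s = D' s) : demandStep lam π ν D t = demandStep lam π ν D' t := by
  unfold demandStep
  rw [intervalIntegral_congr_Icc ht.1 fun s hs => ?_]
  rw [h.congr D D' s ⟨hs.1, hs.2.trans ht.2⟩ fun r hr hrs => hD r hr (hrs.trans_le hs.2)]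

/-- The demand at time `t` depends on the past only through the samples strictly before `t`, so
every application of `demandStep` settles one more sample time, whatever the starting point. -/
theorem iterate_eq (h : IsSampledPolicy S T π) (D : ℝ → ℕ) (k : ℕ) :
    ∀ t ∈ Icc 0 T, (S.filter (· < t)).card < k →
      (demandStep lam π ν)^[k] D t = (demandStep lam π ν)^[k + 1] D t := by
  induction k with
  | zero => intro t _ h; simp at h
  | succ k ih =>
    intro t ht hcard
    rw [Function.iterate_succ_apply', Function.iterate_succ_apply' _ (k + 1)]
    refine h.demandStep_congr ht fun s hs hst => ih s (h.subset s hs) ?_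
    have := card_lt hs hst
    omega

theorem sampledDemand_eq (h : IsSampledPolicy S T π) {t : ℝ} (ht : t ∈ Icc 0 T) :
    sampledDemand lam π S ν t = demandStep lam π ν (sampledDemand lam π S ν) t := by
  have := h.iterate_eq (lam := lam) (ν := ν) 0 (S.card + 1) t ht
    (Nat.lt_succ_of_le (Finset.card_filter_le _ _))
  rwa [Function.iterate_succ_apply' _ (S.card + 1)] at this

theorem isDemandPath (h : IsSampledPolicy S T π) (hr : IsRegularRate T lam π) :
    IsDemandPath T lam π ν (sampledDemand lam π S ν) := fun t ht =>
  ⟨(hr.integrable _).mono_set (by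
    rw [uIcc_of_le ht.1, uIcc_of_le (ht.1.trans ht.2)]; exact Icc_subset_Icc le_rfl ht.2),
    h.sampledDemand_eq ht⟩

/-- The same induction on the number of earlier samples gives uniqueness. The horizon `τ` may be
shorter than `T`, so that paths can be compared up to the time at which the stock runs out. -/
theorem eqOn_of_isDemandPath (h : IsSampledPolicy S T π) {τ : ℝ} (hτ : τ ≤ T) {D D' : ℝ → ℕ}
    (hD : IsDemandPath τ lam π ν D) (hD' : IsDemandPath τ lam π ν D') : EqOn D D' (Icc 0 τ) := by
  have key : ∀ k : ℕ, ∀ t ∈ Icc 0 τ, (S.filter (· < t)).card < k → D t = D' t := by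
    intro k
    induction k with
    | zero => intro t _ h; simp at h
    | succ k ih =>
      intro t ht hcard
      rw [(hD t ht).2, (hD' t ht).2]
      refine h.demandStep_congr ⟨ht.1, ht.2.trans hτ⟩ fun s hs hst =>
        ih s ⟨(h.subset s hs).1, (hst.trans_le ht.2).le⟩ ?_
      have := card_lt hs hst
      omega
  exact fun t ht => key _ t ht (Nat.lt_succ_self _)

end IsSampledPolicy

/-- The regularity of cumulative demand as a function of time. -/
structure IsDemandProfile (T : ℝ) (D : ℝ → ℕ) : Prop where
  zero : D 0 = 0
  mono : MonotoneOn D (Icc 0 T)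
  right : ∀ t ∈ Ico 0 T, ∃ u, t < u ∧ ∀ s ∈ Ico t u, s ≤ T → D s = D t
  jump : ∀ t ∈ Ioc 0 T, ∃ s ∈ Ico 0 t, D t ≤ D s + 1

theorem IsDemandPath.monotoneOn_integral {T : ℝ} {lam : ℝ → ℝ} {π : PricingPolicy} {ν : ℝ≥0 → ℕ}
    {D : ℝ → ℕ} (h : IsDemandPath T lam π ν D)
    (hn : ∀ s ∈ Icc 0 T, 0 ≤ lam (π D s)) {s t : ℝ} (hs : 0 ≤ s) (hst : s ≤ t) (ht : t ≤ T) :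
    0 ≤ ∫ r in s..t, lam (π D r) ∧ (∫ r in (0 : ℝ)..t, lam (π D r)) =
      (∫ r in (0 : ℝ)..s, lam (π D r)) + ∫ r in s..t, lam (π D r) := by
  have i1 := (h s ⟨hs, hst.trans ht⟩).1
  have i2 := (h t ⟨hs.trans hst, ht⟩).1
  refine ⟨intervalIntegral.integral_nonneg hst fun r hr => hn r ⟨hs.trans hr.1, hr.2.trans ht⟩, ?_⟩
  rw [intervalIntegral.integral_add_adjacent_intervals i1 (i1.symm.trans i2)]

/-- The path is a counting path run along the continuous nondecreasing clock `Λ`; right-continuity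
and unit jumps survive such a change of time. -/
theorem IsDemandPath.isDemandProfile {T : ℝ} {lam : ℝ → ℝ} {π : PricingPolicy} {ν : ℝ≥0 → ℕ}
    {D : ℝ → ℕ} (hT : 0 ≤ T) (h : IsDemandPath T lam π ν D) (hν : IsCountingPath ν)
    (hn : ∀ s ∈ Icc 0 T, 0 ≤ lam (π D s)) : IsDemandProfile T D := by
  set Λ : ℝ → ℝ := fun t => ∫ s in (0 : ℝ)..t, lam (π D s) with hΛ
  have hD : ∀ t ∈ Icc 0 T, D t = ν (Λ t).toNNReal := fun t ht => (h t ht).2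
  have hΛ0 : Λ 0 = 0 := by simp [hΛ]
  have hmono : MonotoneOn Λ (Icc 0 T) := by
    intro s hs t ht hst
    obtain ⟨h1, h2⟩ := h.monotoneOn_integral hn hs.1 hst ht.2
    simp only [hΛ]; linarith
  have hcont : ContinuousOn Λ (Icc 0 T) := by
    have hi : IntegrableOn (fun s => lam (π D s)) (uIcc 0 T) volume := by
      have := (h T ⟨hT, le_rfl⟩).1
      rwa [intervalIntegrable_iff', ] at this
    have := intervalIntegral.continuousOn_primitive_interval hi
    rwa [uIcc_of_le hT] at this
  have hnn : ∀ t ∈ Icc 0 T, 0 ≤ Λ t := fun t ht => by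
    have := hmono ⟨le_rfl, hT⟩ ht ht.1
    rwa [hΛ0] at this
  refine ⟨?_, ?_, ?_, ?_⟩
  · rw [hD 0 ⟨le_rfl, hT⟩, hΛ0, Real.toNNReal_zero, hν.zero]
  · intro s hs t ht hst
    rw [hD s hs, hD t ht]
    exact hν.mono (Real.toNNReal_le_toNNReal (hmono hs ht hst))
  · intro t ht
    have htI : t ∈ Icc 0 T := ⟨ht.1, ht.2.le⟩
    have h1 := hν.rightCont (Λ t).toNNReal
    have h2 : Filter.Tendsto (fun s => (Λ s).toNNReal) (nhdsWithin t (Icc t T))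
        (nhdsWithin (Λ t).toNNReal (Ici (Λ t).toNNReal)) := by
      refine tendsto_nhdsWithin_iff.2 ⟨?_, ?_⟩
      · have := (hcont t htI).mono (Icc_subset_Icc ht.1 le_rfl : Icc t T ⊆ Icc 0 T)
        exact (continuous_real_toNNReal.tendsto _).comp this
      · filter_upwards [self_mem_nhdsWithin] with s hs
        exact Real.toNNReal_le_toNNReal (hmono htI ⟨ht.1.trans hs.1, hs.2⟩ hs.1)
    have h3 := h1.tendsto.comp h2
    have h4 : ∀ᶠ s in nhdsWithin t (Icc t T), ν (Λ s).toNNReal = ν (Λ t).toNNReal := by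
      have := h3 (by rw [nhds_discrete]; exact Filter.mem_pure.2 (mem_singleton _) :
        {ν (Λ t).toNNReal} ∈ nhds (ν (Λ t).toNNReal))
      filter_upwards [this] with s hs using hs
    rw [Filter.Eventually, mem_nhdsWithin] at h4
    obtain ⟨U, hU, htU, hsub⟩ := h4
    obtain ⟨e, he, hball⟩ := Metric.isOpen_iff.1 hU t htU
    refine ⟨t + e, by linarith, fun s hs hsT => ?_⟩
    have hs' : s ∈ U ∩ Icc t T := ⟨hball (by
      rw [Metric.mem_ball, Real.dist_eq, abs_of_nonneg (by linarith [hs.1])]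
      linarith [hs.2]), hs.1, hsT⟩
    rw [hD s ⟨ht.1.trans hs.1, hsT⟩, hD t htI]
    exact hsub hs'
  · intro t ht
    have htI : t ∈ Icc 0 T := ⟨ht.1.le, ht.2⟩
    rcases eq_or_lt_of_le (hnn t htI) with h0 | h0
    · refine ⟨0, ⟨le_rfl, ht.1⟩, ?_⟩
      rw [hD t htI, ← h0, Real.toNNReal_zero, hν.zero]; omega
    · obtain ⟨r, hr, hν'⟩ := hν.unitJumps (Λ t).toNNReal (Real.toNNReal_pos.2 h0)
      have hr' : (r : ℝ) < Λ t := Real.lt_toNNReal_iff_coe_lt.1 hr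
      have h1 : ∀ᶠ s in nhdsWithin t (Icc 0 T), (r : ℝ) < Λ s :=
        (hcont t htI).eventually (lt_mem_nhds hr')
      rw [Filter.Eventually, mem_nhdsWithin] at h1
      obtain ⟨U, hU, htU, hsub⟩ := h1
      obtain ⟨e, he, hball⟩ := Metric.isOpen_iff.1 hU t htU
      have hs1 : max 0 (t - e / 2) < t := max_lt ht.1 (by linarith)
      have hsI : max 0 (t - e / 2) ∈ Icc 0 T := ⟨le_max_left _ _, hs1.le.trans ht.2⟩
      refine ⟨max 0 (t - e / 2), ⟨le_max_left _ _, hs1⟩, ?_⟩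
      have hs' : (r : ℝ) < Λ (max 0 (t - e / 2)) := hsub ⟨hball (by
        rw [Metric.mem_ball, Real.dist_eq, abs_of_neg (by linarith)]
        linarith [le_max_right 0 (t - e / 2)]), hsI⟩
      rw [hD t htI, hD _ hsI]
      refine hν'.trans (Nat.add_le_add_right (hν.mono ?_) 1)
      exact NNReal.le_toNNReal_of_coe_le hs'.le

namespace IsDemandProfile

variable {T : ℝ} {D : ℝ → ℕ}

/-- The time at which the demand reaches `k`. -/
noncomputable def _root_.hitTime (T : ℝ) (D : ℝ → ℕ) (k : ℕ) : ℝ := sInf {t | t ∈ Icc 0 T ∧ k ≤ D t}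

/-- The path is constant immediately to the right of each time before `T`, so the infimum defining
the hitting time is attained. -/
theorem hit (h : IsDemandProfile T D) {k : ℕ} {t : ℝ} (ht : t ∈ Icc 0 T) (hk : k ≤ D t) :
    hitTime T D k ∈ Icc 0 t ∧ k ≤ D (hitTime T D k) ∧
      ∀ s, 0 ≤ s → s < hitTime T D k → D s < k := by
  set A := {t | t ∈ Icc 0 T ∧ k ≤ D t} with hA
  have hne : A.Nonempty := ⟨t, ht, hk⟩
  have hbdd : BddBelow A := ⟨0, fun s hs => hs.1.1⟩
  have h0 : 0 ≤ sInf A := le_csInf hne fun s hs => hs.1.1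
  have h1 : sInf A ≤ t := csInf_le hbdd ⟨ht, hk⟩
  refine ⟨⟨h0, h1⟩, ?_, fun s hs hlt => ?_⟩
  · change k ≤ D (sInf A)
    rcases eq_or_lt_of_le (h1.trans ht.2) with he | hlt
    · have : sInf A = t := le_antisymm h1 (by rw [he]; exact ht.2)
      rwa [this]
    · obtain ⟨u, hu, hconst⟩ := h.right _ ⟨h0, hlt⟩
      obtain ⟨s, hs, hsu⟩ := (csInf_lt_iff hbdd hne).1 hu
      rw [← hconst s ⟨csInf_le hbdd hs, hsu⟩ hs.1.2]
      exact hs.2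
  · by_contra hc
    push Not at hc
    have hlt' : s < sInf A := hlt
    exact absurd (csInf_le hbdd (show s ∈ A from ⟨⟨hs, (hlt'.le.trans h1).trans ht.2⟩, hc⟩))
      (not_le.2 hlt')

theorem hitTime_le_iff (h : IsDemandProfile T D) {k : ℕ} {t : ℝ} (ht : t ∈ Icc 0 T)
    (hk : k ≤ D T) : hitTime T D k ≤ t ↔ k ≤ D t := by
  have hT : T ∈ Icc 0 T := ⟨ht.1.trans ht.2, le_rfl⟩
  obtain ⟨h1, h2, h3⟩ := h.hit hT hk
  refine ⟨fun hle => h2.trans (h.mono h1 ht hle), fun hle => ?_⟩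
  exact ((h.hit ht hle).1).2

/-- Unit jumps exclude overshooting a level when it is first reached. This is why the inventory is
never exceeded. -/
theorem le_of_forall_lt (h : IsDemandProfile T D) {m : ℕ} {t : ℝ} (ht : t ∈ Icc 0 T)
    (hm : ∀ s, 0 ≤ s → s < t → D s < m) : D t ≤ m := by
  rcases eq_or_lt_of_le ht.1 with h0 | h0
  · rw [← h0, h.zero]; exact Nat.zero_le _
  · obtain ⟨s, hs, hle⟩ := h.jump t ⟨h0, ht.2⟩
    have := hm s hs.1 hs.2
    omega

end IsDemandProfile

open Classical in
/-- The policy `π`, with the price `pInf` as soon as less than one unit of the inventory `X` is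
left. -/
noncomputable def stopPolicy (X pInf : ℝ) (π : PricingPolicy) : PricingPolicy := fun D t =>
  if ∃ s, 0 ≤ s ∧ s < t ∧ X < D s + 1 then pInf else π D t

/-! ### Running out of stock: existence, uniqueness and measurability for stopped policies. -/

section Stopping

variable {S : Finset ℝ} {T X pInf : ℝ} {π : PricingPolicy} {lam : ℝ → ℝ} {ν : ℝ≥0 → ℕ}

theorem lt_add_one_iff_floor_le (hX : 0 ≤ X) (k : ℕ) : X < (k : ℝ) + 1 ↔ ⌊X⌋₊ ≤ k := by
  rw [← Nat.lt_add_one_iff, Nat.floor_lt hX]; push_cast; rfl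

theorem stopPolicy_of_lt {D : ℝ → ℕ} {t : ℝ} (hX : 0 ≤ X)
    (h : ∀ s, 0 ≤ s → s < t → D s < ⌊X⌋₊) : stopPolicy X pInf π D t = π D t := by
  refine if_neg ?_
  rintro ⟨s, h0, hst, hs⟩
  rw [lt_add_one_iff_floor_le hX] at hs
  exact absurd (h s h0 hst) (not_lt.2 hs)

theorem stopPolicy_of_le {D : ℝ → ℕ} {s t : ℝ} (hX : 0 ≤ X) (hs : 0 ≤ s) (hst : s < t)
    (h : ⌊X⌋₊ ≤ D s) : stopPolicy X pInf π D t = pInf :=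
  if_pos ⟨s, hs, hst, (lt_add_one_iff_floor_le hX _).2 h⟩

theorem stopPolicy_nonneg (hr : IsRegularRate T lam π) (h0 : lam pInf = 0) (D : ℝ → ℕ) {s : ℝ}
    (hs : s ∈ Icc 0 T) : 0 ≤ lam (stopPolicy X pInf π D s) := by
  unfold stopPolicy
  split_ifs
  · exact h0.ge
  · exact hr.nonneg D s hs

/-- After the inventory has been sold the cumulative demand rate stays constant. -/
theorem integral_stopPolicy_of_le {D : ℝ → ℕ} {s t : ℝ} (hX : 0 ≤ X) (h0 : lam pInf = 0)
    (hs : 0 ≤ s) (hst : s ≤ t) (h : ⌊X⌋₊ ≤ D s)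
    (hint : IntervalIntegrable (fun r => lam (stopPolicy X pInf π D r)) volume 0 s) :
    IntervalIntegrable (fun r => lam (stopPolicy X pInf π D r)) volume 0 t ∧
    (∫ r in (0 : ℝ)..t, lam (stopPolicy X pInf π D r)) =
      ∫ r in (0 : ℝ)..s, lam (stopPolicy X pInf π D r) := by
  have hz : EqOn (fun r => lam (stopPolicy X pInf π D r)) (fun _ => 0) (uIoc s t) := by
    intro r hr
    rw [uIoc_of_le hst] at hr
    simp only [stopPolicy_of_le hX hs hr.1 h, h0]
  have hi : IntervalIntegrable (fun r => lam (stopPolicy X pInf π D r)) volume s t :=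
    (intervalIntegrable_congr hz).2 intervalIntegrable_const
  refine ⟨hint.trans hi, ?_⟩
  rw [← intervalIntegral.integral_add_adjacent_intervals hint hi,
    intervalIntegral.integral_zero_ae (Filter.Eventually.of_forall hz), add_zero]

/-- The stopped path follows the unrestricted one until that reaches `⌊X⌋`. This happens without
overshooting, and from then on the price `pInf` freezes the demand. -/
theorem isDemandPath_stopPolicy (hS : IsSampledPolicy S T π) (hr : IsRegularRate T lam π)
    (hν : IsCountingPath ν) (hT : 0 ≤ T) (hX : 0 ≤ X) (h0 : lam pInf = 0) :
    IsDemandPath T lam (stopPolicy X pInf π) ν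
      (fun t => min (sampledDemand lam π S ν t) ⌊X⌋₊) := by
  set D := sampledDemand lam π S ν with hD
  have hpath : IsDemandPath T lam π ν D := hS.isDemandPath hr
  have hprof := hpath.isDemandProfile hT hν (hr.nonneg D)
  set m := ⌊X⌋₊ with hm
  set E : ℝ → ℕ := fun t => min (D t) m with hE
  have hprice : ∀ t ∈ Icc 0 T, (∀ s, 0 ≤ s → s < t → D s < m) →
      stopPolicy X pInf π E t = π D t := by
    intro t ht hlt
    rw [stopPolicy_of_lt hX fun s hs hst => min_lt_iff.2 (Or.inl (hlt s hs hst))]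
    refine hS.congr _ _ t ht fun s hs hst => ?_
    exact min_eq_left (hlt s (hS.subset s hs).1 hst).le
  have before : ∀ t ∈ Icc 0 T, (∀ s, 0 ≤ s → s < t → D s < m) →
      IntervalIntegrable (fun s => lam (stopPolicy X pInf π E s)) volume 0 t ∧
      (∫ s in (0 : ℝ)..t, lam (stopPolicy X pInf π E s)) = ∫ s in (0 : ℝ)..t, lam (π D s) := by
    intro t ht hlt
    have heq : EqOn (fun s => lam (stopPolicy X pInf π E s)) (fun s => lam (π D s)) (uIcc 0 t) := by
      intro s hs
      rw [uIcc_of_le ht.1] at hs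
      simp only [hprice s ⟨hs.1, hs.2.trans ht.2⟩ fun r hr hrs => hlt r hr (hrs.trans_le hs.2)]
    exact ⟨(intervalIntegrable_congr (heq.mono uIoc_subset_uIcc)).2 (hpath t ht).1,
      intervalIntegral.integral_congr heq⟩
  intro t ht
  by_cases hlt : ∀ s, 0 ≤ s → s < t → D s < m
  · obtain ⟨h1, h2⟩ := before t ht hlt
    refine ⟨h1, ?_⟩
    rw [h2, ← (hpath t ht).2]
    exact min_eq_left (hprof.le_of_forall_lt ht hlt)
  · push Not at hlt
    obtain ⟨r, hr0, hrt, hmr⟩ := hlt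
    obtain ⟨k1, k2, k3⟩ := hprof.hit ⟨hr0, hrt.le.trans ht.2⟩ hmr
    set σ := hitTime T D m
    have hσ : σ ∈ Icc 0 T := ⟨k1.1, k1.2.trans (hrt.le.trans ht.2)⟩
    obtain ⟨h1, h2⟩ := before σ hσ k3
    have hEσ : m ≤ E σ := le_min k2 le_rfl
    obtain ⟨h3, h4⟩ := integral_stopPolicy_of_le (π := π) (lam := lam) hX h0 k1.1
      (k1.2.trans hrt.le) hEσ h1
    refine ⟨h3, ?_⟩
    rw [h4, h2, ← (hpath σ hσ).2]
    have h5 := hprof.le_of_forall_lt hσ k3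
    have h6 : D σ ≤ D t := hprof.mono hσ ht (k1.2.trans hrt.le)
    change min (D t) m = D σ
    rw [min_eq_right (k2.trans h6)]; exact le_antisymm k2 h5

/-- Until it reaches `⌊X⌋`, any path of the stopped policy is also a path of `π`, and uniqueness for
sampled policies identifies it; afterwards it is constant. -/
theorem eqOn_stopPolicy (hS : IsSampledPolicy S T π) (hr : IsRegularRate T lam π)
    (hν : IsCountingPath ν) (hT : 0 ≤ T) (hX : 0 ≤ X) (h0 : lam pInf = 0) {D : ℝ → ℕ}
    (hD : IsDemandPath T lam (stopPolicy X pInf π) ν D) :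
    EqOn (fun t => min (sampledDemand lam π S ν t) ⌊X⌋₊) D (Icc 0 T) := by
  have hprof := hD.isDemandProfile hT hν fun s hs => stopPolicy_nonneg hr h0 D hs
  have hpath0 : IsDemandPath T lam π ν (sampledDemand lam π S ν) := hS.isDemandPath hr
  have hprof0 := hpath0.isDemandProfile hT hν (hr.nonneg _)
  set D0 := sampledDemand lam π S ν with hD0
  set m := ⌊X⌋₊ with hm
  have before : ∀ t ∈ Icc 0 T, (∀ s, 0 ≤ s → s < t → D s < m) → D0 t = D t := by
    intro t ht hlt
    have hp : IsDemandPath t lam π ν D := by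
      intro s hs
      obtain ⟨h1, h2⟩ := hD s ⟨hs.1, hs.2.trans ht.2⟩
      have heq : EqOn (fun s => lam (stopPolicy X pInf π D s)) (fun s => lam (π D s))
          (uIcc 0 s) := by
        intro r hr
        rw [uIcc_of_le hs.1] at hr
        simp only [stopPolicy_of_lt hX fun q hq hqr => hlt q hq (hqr.trans_le (hr.2.trans hs.2))]
      rw [intervalIntegral.integral_congr heq] at h2
      exact ⟨(intervalIntegrable_congr (heq.mono uIoc_subset_uIcc)).1 h1, h2⟩
    have hp0 : IsDemandPath t lam π ν D0 := fun s hs => hpath0 s ⟨hs.1, hs.2.trans ht.2⟩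
    exact hS.eqOn_of_isDemandPath ht.2 hp0 hp ⟨ht.1, le_rfl⟩
  intro t ht
  change min (D0 t) m = D t
  by_cases hlt : ∀ s, 0 ≤ s → s < t → D s < m
  · rw [before t ht hlt]
    exact min_eq_left (hprof.le_of_forall_lt ht hlt)
  · push Not at hlt
    obtain ⟨r, hr0, hrt, hmr⟩ := hlt
    obtain ⟨k1, k2, k3⟩ := hprof.hit ⟨hr0, hrt.le.trans ht.2⟩ hmr
    set σ := hitTime T D m
    have hσ : σ ∈ Icc 0 T := ⟨k1.1, k1.2.trans (hrt.le.trans ht.2)⟩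
    have h1 := before σ hσ k3
    have h5 := hprof.le_of_forall_lt hσ k3
    obtain ⟨-, h4⟩ := integral_stopPolicy_of_le (π := π) (lam := lam) hX h0 k1.1
      (k1.2.trans hrt.le) k2 (hD σ hσ).1
    have h6 : D0 σ ≤ D0 t := hprof0.mono hσ ht (k1.2.trans hrt.le)
    rw [(hD t ht).2, h4, ← (hD σ hσ).2, min_eq_right (by omega)]
    omega

theorem isDemandPath_demandPath (hS : IsSampledPolicy S T π) (hr : IsRegularRate T lam π)
    (hν : IsCountingPath ν) (hT : 0 ≤ T) (hX : 0 ≤ X) (h0 : lam pInf = 0) :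
    IsDemandPath T lam (stopPolicy X pInf π) ν (demandPath T lam (stopPolicy X pInf π) ν) :=
  Classical.epsilon_spec (p := IsDemandPath T lam (stopPolicy X pInf π) ν)
    ⟨_, isDemandPath_stopPolicy hS hr hν hT hX h0⟩

/-- The revenue in terms of the demand path of the policy that ignores the inventory. -/
theorem revenue_stopPolicy (hS : IsSampledPolicy S T π) (hr : IsRegularRate T lam π)
    (hν : IsCountingPath ν) (hT : 0 ≤ T) (hX : 0 ≤ X) (h0 : lam pInf = 0) :
    revenue T (stopPolicy X pInf π) (demandPath T lam (stopPolicy X pInf π) ν) =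
      ∑ k ∈ Finset.Icc 1 (min (sampledDemand lam π S ν T) ⌊X⌋₊),
        π (sampledDemand lam π S ν) (hitTime T (sampledDemand lam π S ν) k) := by
  have hpath := isDemandPath_demandPath hS hr hν hT hX h0 (pInf := pInf)
  have heq := eqOn_stopPolicy hS hr hν hT hX h0 hpath
  have hpath0 : IsDemandPath T lam π ν (sampledDemand lam π S ν) := hS.isDemandPath hr
  have hprof0 := hpath0.isDemandProfile hT hν (hr.nonneg _)
  set D0 := sampledDemand lam π S ν with hD0
  set D := demandPath T lam (stopPolicy X pInf π) ν
  have hTI : T ∈ Icc 0 T := ⟨hT, le_rfl⟩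
  have hDT : D T = min (D0 T) ⌊X⌋₊ := (heq hTI).symm
  unfold revenue
  rw [hDT]
  refine Finset.sum_congr rfl fun k hk => ?_
  rw [Finset.mem_Icc, le_min_iff] at hk
  have hset : {t | t ∈ Icc 0 T ∧ k ≤ D t} = {t | t ∈ Icc 0 T ∧ k ≤ D0 t} := by
    ext t
    simp only [mem_ofPred_eq]
    refine and_congr_right fun ht => ?_
    rw [← heq ht]
    simp only [le_min_iff, and_iff_left hk.2.2]
  rw [hset]
  change stopPolicy X pInf π D (hitTime T D0 k) = _
  obtain ⟨k1, k2, k3⟩ := hprof0.hit hTI hk.2.1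
  have hDD : ∀ s, 0 ≤ s → s < hitTime T D0 k → D s < ⌊X⌋₊ ∧ D s = D0 s := by
    intro s hs hst
    have h1 := heq (show s ∈ Icc 0 T from ⟨hs, hst.le.trans k1.2⟩)
    simp only at h1
    have h2 := k3 s hs hst
    omega
  rw [stopPolicy_of_lt hX fun s hs hst => (hDD s hs hst).1]
  exact hS.congr _ _ _ k1 fun s hs hst => (hDD s (hS.subset s hs).1 hst).2

/-- The samples form a random element of the countable space `S → ℕ`. For each fixed history the
Poisson process is evaluated at a constant, so measurability holds history by history. -/
theorem sampledDemand_measurable {Ω : Type*} [MeasurableSpace Ω] {N : ℝ≥0 → Ω → ℕ}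
    (hN : ∀ t, Measurable (N t)) (hS : IsSampledPolicy S T π) {t : ℝ} (ht : t ∈ Icc 0 T) :
    Measurable fun ω => sampledDemand lam π S (fun u => N u ω) t := by
  unfold sampledDemand
  generalize S.card + 1 = k
  induction k generalizing t with
  | zero => exact measurable_const
  | succ k ih =>
    simp only [Function.iterate_succ_apply']
    classical
    set ext : (S → ℕ) → ℝ → ℕ := fun h s => if hs : s ∈ S then h ⟨s, hs⟩ else 0 with hext
    set G : (S → ℕ) → ℝ≥0 := fun h => (∫ s in (0 : ℝ)..t, lam (π (ext h) s)).toNNReal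
    set hist : Ω → S → ℕ := fun ω s => (demandStep lam π (fun u => N u ω))^[k] 0 s
    have hh : Measurable hist := measurable_pi_lambda _ fun s => ih (hS.subset s s.2)
    have e : (fun ω => demandStep lam π (fun u => N u ω)
        ((demandStep lam π (fun u => N u ω))^[k] 0) t) =
        (fun p : (S → ℕ) × Ω => N (G p.1) p.2) ∘ fun ω => (hist ω, ω) := by
      ext ω
      rw [hS.demandStep_congr (D' := ext (hist ω)) ht fun s hs _ => by simp [hext, hs, hist]]
      rfl
    rw [e]
    refine Measurable.comp ?_ (hh.prodMk measurable_id)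
    exact measurable_from_prod_countable_right fun h => hN (G h)

/-- Again the prices depend on one of countably many histories. Hitting times are measurable because
`hitTime ≤ a` means that the demand at `a` has reached the level; `T` serves as default where the
level is never reached. -/
theorem revenue_measurable {Ω : Type*} [MeasurableSpace Ω] {N : ℝ≥0 → Ω → ℕ}
    (hN : ∀ t, Measurable (N t)) (hpath : ∀ ω, IsCountingPath (fun t => N t ω))
    (hS : IsSampledPolicy S T π) (hr : IsRegularRate T lam π)
    (hπ : ∀ D, Measurable (π D)) (hT : 0 ≤ T) (hX : 0 ≤ X) (h0 : lam pInf = 0) :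
    Measurable fun ω => revenue T (stopPolicy X pInf π)
      (demandPath T lam (stopPolicy X pInf π) (fun t => N t ω)) := by
  have hTI : T ∈ Icc 0 T := ⟨hT, le_rfl⟩
  have e : (fun ω => revenue T (stopPolicy X pInf π)
      (demandPath T lam (stopPolicy X pInf π) (fun t => N t ω))) =
      fun ω => ∑ k ∈ Finset.Icc 1 ⌊X⌋₊,
        if k ≤ sampledDemand lam π S (fun t => N t ω) T then
          π (sampledDemand lam π S (fun t => N t ω))
            (hitTime T (sampledDemand lam π S (fun t => N t ω)) k) else 0 := by
    ext ω
    rw [revenue_stopPolicy hS hr (hpath ω) hT hX h0, ← Finset.sum_filter]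
    refine Finset.sum_congr ?_ fun _ _ => rfl
    ext k; simp only [Finset.mem_Icc, Finset.mem_filter]; omega
  rw [e]
  refine Finset.measurable_sum _ fun k _ => ?_
  have hset : MeasurableSet {ω | k ≤ sampledDemand lam π S (fun t => N t ω) T} :=
    measurableSet_le measurable_const (sampledDemand_measurable hN hS hTI)
  classical
  set τ : Ω → ℝ := fun ω => if k ≤ sampledDemand lam π S (fun t => N t ω) T then
    hitTime T (sampledDemand lam π S (fun t => N t ω)) k else T with hτ
  have hτm : Measurable τ := by
    refine measurable_of_Iic fun a => ?_
    rcases lt_or_ge a 0 with ha | ha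
    · convert MeasurableSet.empty
      rw [eq_empty_iff_forall_notMem]
      intro ω hω
      simp only [mem_preimage, mem_Iic, hτ] at hω
      split_ifs at hω with hk
      · have hprof := (hS.isDemandPath hr (ν := fun t => N t ω)).isDemandProfile hT (hpath ω)
          (hr.nonneg _)
        linarith [(hprof.hit hTI hk).1.1]
      · linarith
    · rcases lt_or_ge a T with haT | haT
      · have haI : a ∈ Icc 0 T := ⟨ha, haT.le⟩
        have : τ ⁻¹' Iic a = {ω | k ≤ sampledDemand lam π S (fun t => N t ω) a} := by
          ext ω
          have hprof := (hS.isDemandPath hr (ν := fun t => N t ω)).isDemandProfile hT (hpath ω)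
            (hr.nonneg _)
          simp only [mem_preimage, mem_Iic, hτ, mem_ofPred_eq]
          split_ifs with hk
          · exact hprof.hitTime_le_iff haI hk
          · have := hprof.mono haI hTI haT.le
            constructor
            · intro h; linarith
            · intro h; omega
        rw [this]
        exact measurableSet_le measurable_const (sampledDemand_measurable hN hS haI)
      · convert MeasurableSet.univ
        rw [eq_univ_iff_forall]
        intro ω
        simp only [mem_preimage, mem_Iic, hτ]
        split_ifs with hk
        · have hprof := (hS.isDemandPath hr (ν := fun t => N t ω)).isDemandProfile hT (hpath ω)
            (hr.nonneg _)
          exact (hprof.hit hTI hk).1.2.trans haT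
        · exact haT
  set ext : (S → ℕ) → ℝ → ℕ := fun h s => if hs : s ∈ S then h ⟨s, hs⟩ else 0 with hext
  set hist : Ω → S → ℕ := fun ω s => sampledDemand lam π S (fun t => N t ω) s with hhist
  have hh : Measurable hist :=
    measurable_pi_lambda _ fun s => sampledDemand_measurable hN hS (hS.subset s s.2)
  have hprice : Measurable fun ω => π (ext (hist ω)) (τ ω) := by
    have : Measurable (fun p : (S → ℕ) × ℝ => π (ext p.1) p.2) :=
      measurable_from_prod_countable_right fun h => hπ (ext h)
    exact this.comp (hh.prodMk hτm)
  have e2 : (fun ω => if k ≤ sampledDemand lam π S (fun t => N t ω) T then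
      π (sampledDemand lam π S (fun t => N t ω))
        (hitTime T (sampledDemand lam π S (fun t => N t ω)) k) else 0) =
      fun ω => if k ≤ sampledDemand lam π S (fun t => N t ω) T then π (ext (hist ω)) (τ ω)
        else 0 := by
    ext ω
    split_ifs with hk
    · have hprof := (hS.isDemandPath hr (ν := fun t => N t ω)).isDemandProfile hT (hpath ω)
        (hr.nonneg _)
      simp only [hτ, if_pos hk]
      refine hS.congr _ _ _ (hprof.hit hTI hk).1 fun s hs _ => by simp [hext, hhist, hs]
    · rfl
  rw [e2]
  exact Measurable.ite hset hprice measurable_const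

end Stopping

/-! ### One learning round: elementary properties -/

theorem argMaxBelow_spec {κ : ℕ} (hκ : 0 < κ) (f : ℕ → ℝ) :
    argMaxBelow κ f < κ ∧ ∀ k < κ, f k ≤ f (argMaxBelow κ f) := by
  have hne : {j | j < κ ∧ ∀ k < κ, f k ≤ f j}.Nonempty := by
    obtain ⟨j, hj, hmax⟩ := Finset.exists_max_image (Finset.range κ) f ⟨0, by simpa using hκ⟩
    exact ⟨j, by simpa using hj, fun k hk => hmax k (by simpa using hk)⟩
  exact Nat.sInf_mem hne

theorem argMaxBelow_congr {κ : ℕ} {f g : ℕ → ℝ} (h : ∀ j < κ, f j = g j) :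
    argMaxBelow κ f = argMaxBelow κ g := by
  unfold argMaxBelow
  congr 1
  ext j
  refine and_congr_right fun hj => forall₂_congr fun k hk => ?_
  rw [h j hj, h k hk]

/-- The times at which the demand is sampled in a round. -/
noncomputable def roundTimes (s τ : ℝ) (κ : ℕ) : Finset ℝ :=
  (Finset.range (κ + 1)).image fun j : ℕ => s + j * (τ / κ)

theorem observedRate_congr {D D' : ℝ → ℕ} {s τ : ℝ} {κ : ℕ}
    (h : ∀ r ∈ roundTimes s τ κ, D r = D' r) {j : ℕ} (hj : j < κ) :
    observedRate D s τ κ j = observedRate D' s τ κ j := by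
  have h1 : D (s + j * (τ / κ)) = D' (s + j * (τ / κ)) :=
    h _ (Finset.mem_image.2 ⟨j, by simp; omega, rfl⟩)
  have h2 : D (s + (j + 1) * (τ / κ)) = D' (s + (j + 1) * (τ / κ)) :=
    h _ (Finset.mem_image.2 ⟨j + 1, by simp; omega, by push_cast; rfl⟩)
  rw [observedRate, observedRate, h1, h2]

theorem bestRevenuePrice_congr {D D' : ℝ → ℕ} {s τ : ℝ} {κ : ℕ}
    (h : ∀ r ∈ roundTimes s τ κ, D r = D' r) (I : ℝ × ℝ) :
    bestRevenuePrice D s τ κ I = bestRevenuePrice D' s τ κ I := by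
  rw [bestRevenuePrice, bestRevenuePrice]
  congr 1
  exact argMaxBelow_congr fun j hj => by rw [observedRate_congr h hj]

theorem bestInventoryPrice_congr {D D' : ℝ → ℕ} {s τ : ℝ} {κ : ℕ}
    (h : ∀ r ∈ roundTimes s τ κ, D r = D' r) (x : ℝ) (I : ℝ × ℝ) :
    bestInventoryPrice x D s τ κ I = bestInventoryPrice x D' s τ κ I := by
  rw [bestInventoryPrice, bestInventoryPrice]
  congr 1
  exact argMaxBelow_congr fun j hj => by rw [observedRate_congr h hj]

theorem roundTimes_le {s τ : ℝ} {κ : ℕ} (hκ : 0 < κ) (hτ : 0 ≤ τ) {r : ℝ}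
    (hr : r ∈ roundTimes s τ κ) : s ≤ r ∧ r ≤ s + τ := by
  obtain ⟨j, hj, rfl⟩ := Finset.mem_image.1 hr
  have hj' : (j : ℝ) ≤ κ := by
    have : j ≤ κ := by simpa [Nat.lt_succ_iff] using hj
    exact_mod_cast this
  have hκ' : (0 : ℝ) < κ := by exact_mod_cast hκ
  have h1 : (j : ℝ) * (τ / κ) ≤ κ * (τ / κ) := mul_le_mul_of_nonneg_right hj' (by positivity)
  rw [mul_div_cancel₀ _ hκ'.ne'] at h1
  have h2 : 0 ≤ (j : ℝ) * (τ / κ) := by positivity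
  constructor <;> linarith

theorem roundPrice_eq {s τ : ℝ} {κ : ℕ} (hΔ : 0 < τ / κ) (I : ℝ × ℝ) {j : ℕ} {t : ℝ}
    (ht : t ∈ Ioc (s + j * (τ / κ)) (s + (j + 1) * (τ / κ))) :
    roundPrice s τ κ I t = testPrice I κ j := by
  have : ⌈(t - s) / (τ / κ)⌉₊ = j + 1 := by
    rw [Nat.ceil_eq_iff (by omega)]
    constructor
    · rw [lt_div_iff₀ hΔ]; push_cast; linarith [ht.1]
    · rw [div_le_iff₀ hΔ]; push_cast; linarith [ht.2]
  rw [roundPrice, this, Nat.add_sub_cancel]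

theorem testPrice_mem {I : ℝ × ℝ} (hI : I.1 ≤ I.2) {κ j : ℕ} (hj : j < κ) :
    testPrice I κ j ∈ Icc I.1 I.2 := by
  have hκ : (0 : ℝ) < κ := by exact_mod_cast (Nat.zero_le j).trans_lt hj
  have hj' : (j : ℝ) ≤ κ := by exact_mod_cast hj.le
  have h1 : (j : ℝ) * ((I.2 - I.1) / κ) ≤ κ * ((I.2 - I.1) / κ) :=
    mul_le_mul_of_nonneg_right hj' (div_nonneg (by linarith) hκ.le)
  rw [mul_div_cancel₀ _ hκ.ne'] at h1
  have h2 : 0 ≤ (j : ℝ) * ((I.2 - I.1) / κ) :=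
    mul_nonneg (Nat.cast_nonneg _) (div_nonneg (by linarith) hκ.le)
  unfold testPrice gridGap
  constructor <;> linarith

theorem roundPrice_mem {s τ : ℝ} {κ : ℕ} (hκ : 0 < κ) (hτ : 0 < τ) {I : ℝ × ℝ} (hI : I.1 ≤ I.2)
    {t : ℝ} (ht : t ≤ s + τ) : roundPrice s τ κ I t ∈ Icc I.1 I.2 := by
  have hκ' : (0 : ℝ) < κ := by exact_mod_cast hκ
  refine testPrice_mem hI ?_
  -- The natural ceiling and truncated subtraction send every `t ≤ s` to the index `0`, so only an
  -- upper bound on `t` is needed.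
  have : ⌈(t - s) / (τ / κ)⌉₊ ≤ κ := by
    refine Nat.ceil_le.2 ?_
    rw [div_le_iff₀ (by positivity), mul_div_cancel₀ _ hκ'.ne']; linarith
  omega

theorem measurable_roundPrice (s τ : ℝ) (κ : ℕ) (I : ℝ × ℝ) : Measurable (roundPrice s τ κ I) := by
  have h : Measurable fun k : ℕ => testPrice I κ (k - 1) := measurable_from_nat
  exact h.comp (Nat.measurable_ceil.comp ((measurable_id.sub_const s).div_const _))

theorem measurable_sInf_le (b : ℕ → ℝ) : Measurable fun t => sInf {i | t ≤ b i} := by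
  refine measurable_to_countable' fun k => ?_
  have hk : ∀ j, MeasurableSet {t : ℝ | t ≤ b j} := fun j => measurableSet_Iic
  -- The second set accounts for the value `0` of the infimum of the empty set.
  have e : (fun t => sInf {i | t ≤ b i}) ⁻¹' {k} =
      ({t | t ≤ b k} ∩ ⋂ j ∈ {j | j < k}, {t | t ≤ b j}ᶜ) ∪
        ({_t | k = 0} ∩ ⋂ j, {t | t ≤ b j}ᶜ) := by
    ext t
    simp only [mem_preimage, mem_singleton_iff, mem_union, mem_inter_iff, mem_ofPred_eq, mem_iInter,
      mem_compl_iff]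
    constructor
    · rintro rfl
      by_cases hne : {i | t ≤ b i}.Nonempty
      · exact Or.inl ⟨Nat.sInf_mem hne, fun j hj => Nat.notMem_of_lt_sInf hj⟩
      · rw [not_nonempty_iff_eq_empty] at hne
        right
        refine ⟨by rw [hne, Nat.sInf_empty], fun j hj => ?_⟩
        have : j ∈ {i | t ≤ b i} := hj
        rw [hne] at this; exact this
    · rintro (⟨h1, h2⟩ | ⟨rfl, h2⟩)
      · refine le_antisymm (Nat.sInf_le h1) ?_
        by_contra hc
        push Not at hc
        exact h2 _ hc (Nat.sInf_mem (s := {i | t ≤ b i}) ⟨k, h1⟩)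
      · have : {i | t ≤ b i} = ∅ := eq_empty_iff_forall_notMem.2 h2
        rw [this, Nat.sInf_empty]
  rw [e]
  refine ((hk k).inter (MeasurableSet.biInter (to_countable _) fun j _ => (hk j).compl)).union
    ((MeasurableSet.const _).inter (MeasurableSet.iInter fun j => (hk j).compl))

theorem Nat.sInf_eq_of_mem {s : Set ℕ} {m : ℕ} (hm : m ∈ s) (h : ∀ j < m, j ∉ s) : sInf s = m := by
  refine le_antisymm (Nat.sInf_le hm) ?_
  by_contra hc
  push Not at hc
  exact h _ hc (Nat.sInf_mem ⟨m, hm⟩)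

/-- The round of a schedule that contains the time `t`. -/
theorem sInf_schedule_spec {b : ℕ → ℝ} {t : ℝ} {m : ℕ} (ht : t ≤ b (m + 1)) :
    sInf {i | t ≤ b (i + 1)} ≤ m ∧ t ≤ b (sInf {i | t ≤ b (i + 1)} + 1) ∧
      (sInf {i | t ≤ b (i + 1)} = 0 ∨ b (sInf {i | t ≤ b (i + 1)}) < t) := by
  have hne : {i | t ≤ b (i + 1)}.Nonempty := ⟨m, ht⟩
  refine ⟨Nat.sInf_le ht, Nat.sInf_mem hne, ?_⟩
  rcases Nat.eq_zero_or_pos (sInf {i | t ≤ b (i + 1)}) with h | h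
  · exact Or.inl h
  · right
    have := Nat.notMem_of_lt_sInf (Nat.sub_lt h one_pos)
    simp only [mem_ofPred_eq, not_le] at this
    rwa [Nat.sub_add_cancel (show 1 ≤ _ from h)] at this

/-! ### The algorithm is well posed: feasible prices, measurability, non-anticipation. -/

namespace DPA

/-- The parameters for which the algorithm makes sense. -/
structure Valid (A : DPA) : Prop where
  two_le : 2 ≤ A.n
  lt : A.plo < A.phi
  T_pos : 0 < A.T

variable {A : DPA}

namespace Valid

theorem n_pos (h : A.Valid) : (0 : ℝ) < A.n := by
  have := h.two_le
  have : 0 < A.n := by omega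
  exact_mod_cast this

theorem L_pos (h : A.Valid) : 0 < A.L := by
  refine Real.log_pos ?_
  have : (2 : ℝ) ≤ A.n := by exact_mod_cast h.two_le
  linarith

theorem tauU_pos (h : A.Valid) (i : ℕ) : 0 < A.tauU i :=
  mul_pos h.T_pos (mul_pos (Real.rpow_pos_of_pos h.n_pos _) (pow_pos h.L_pos _))

theorem tauC_pos (h : A.Valid) (i : ℕ) : 0 < A.tauC i :=
  mul_pos h.T_pos (mul_pos (Real.rpow_pos_of_pos h.n_pos _) (pow_pos h.L_pos _))

theorem kappaU_pos (h : A.Valid) (i : ℕ) : 0 < A.kappaU i :=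
  mul_pos (Real.rpow_pos_of_pos h.n_pos _) h.L_pos

theorem kappaC_pos (h : A.Valid) (i : ℕ) : 0 < A.kappaC i :=
  mul_pos (Real.rpow_pos_of_pos h.n_pos _) h.L_pos

theorem gridU_pos (h : A.Valid) (i : ℕ) : 0 < A.gridU i := Nat.ceil_pos.2 (h.kappaU_pos i)

theorem gridC_pos (h : A.Valid) (i : ℕ) : 0 < A.gridC i := Nat.ceil_pos.2 (h.kappaC_pos i)

theorem stepU_pos (h : A.Valid) (i : ℕ) : 0 < A.tauU i / A.gridU i :=
  div_pos (h.tauU_pos i) (by exact_mod_cast h.gridU_pos i)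

theorem stepC_pos (h : A.Valid) (i : ℕ) : 0 < A.tauC i / A.gridC i :=
  div_pos (h.tauC_pos i) (by exact_mod_cast h.gridC_pos i)

end Valid

theorem startU_succ (A : DPA) (i : ℕ) : A.startU (i + 1) = A.startU i + A.tauU i :=
  Finset.sum_range_succ _ _

theorem startC_succ (A : DPA) (i : ℕ) : A.startC (i + 1) = A.startC i + A.tauC i :=
  Finset.sum_range_succ _ _

theorem startU_zero (A : DPA) : A.startU 0 = 0 := Finset.sum_range_zero _

theorem startC_zero (A : DPA) : A.startC 0 = 0 := Finset.sum_range_zero _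

theorem Valid.startU_strictMono (h : A.Valid) : StrictMono A.startU :=
  strictMono_nat_of_lt_succ fun i => by rw [startU_succ]; linarith [h.tauU_pos i]

theorem Valid.startC_strictMono (h : A.Valid) : StrictMono A.startC :=
  strictMono_nat_of_lt_succ fun i => by rw [startC_succ]; linarith [h.tauC_pos i]

theorem Valid.startU_nonneg (h : A.Valid) (i : ℕ) : 0 ≤ A.startU i := by
  rw [← A.startU_zero]; exact h.startU_strictMono.monotone (Nat.zero_le i)

theorem Valid.startC_nonneg (h : A.Valid) (i : ℕ) : 0 ≤ A.startC i := by
  rw [← A.startC_zero]; exact h.startC_strictMono.monotone (Nat.zero_le i)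

/-- `I` is a nonempty interval of feasible prices. -/
structure IsPriceInterval (A : DPA) (I : ℝ × ℝ) : Prop where
  left : A.plo ≤ I.1
  le : I.1 ≤ I.2
  right : I.2 ≤ A.phi

theorem IsPriceInterval.subset {I : ℝ × ℝ} (h : A.IsPriceInterval I) {p : ℝ}
    (hp : p ∈ Icc I.1 I.2) : p ∈ Icc A.plo A.phi :=
  ⟨h.left.trans hp.1, hp.2.trans h.right⟩

theorem isPriceInterval_truncate {c a b : ℝ} (hc : c ∈ Icc A.plo A.phi) (ha : a ≤ c)
    (hb : c ≤ b) : A.IsPriceInterval (A.truncate a b) :=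
  ⟨le_max_left _ _, (max_le hc.1 ha).trans (le_min hc.2 hb), min_le_left _ _⟩

theorem IsPriceInterval.gridGap_nonneg {I : ℝ × ℝ} (h : A.IsPriceInterval I) (κ : ℕ) :
    0 ≤ gridGap I κ := div_nonneg (sub_nonneg.2 h.le) (Nat.cast_nonneg _)

theorem Valid.hatUOn_mem (h : A.Valid) (D : ℝ → ℕ) (i : ℕ) {I : ℝ × ℝ} (hI : A.IsPriceInterval I) :
    A.hatUOn D i I ∈ Icc I.1 I.2 :=
  testPrice_mem hI.le (argMaxBelow_spec (h.gridU_pos i) _).1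

theorem Valid.hatCOn_mem (h : A.Valid) (D : ℝ → ℕ) (i : ℕ) {I : ℝ × ℝ} (hI : A.IsPriceInterval I) :
    A.hatCOn D i I ∈ Icc I.1 I.2 :=
  testPrice_mem hI.le (argMaxBelow_spec (h.gridU_pos i) _).1

theorem Valid.hatOn_mem (h : A.Valid) (D : ℝ → ℕ) (i : ℕ) {I : ℝ × ℝ} (hI : A.IsPriceInterval I) :
    A.hatOn D i I ∈ Icc I.1 I.2 :=
  max_rec' (· ∈ Icc I.1 I.2) (h.hatCOn_mem D i hI) (h.hatUOn_mem D i hI)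

theorem Valid.hatQOn_mem (h : A.Valid) (D : ℝ → ℕ) (s₀ : ℝ) (i : ℕ) {I : ℝ × ℝ}
    (hI : A.IsPriceInterval I) : A.hatQOn D s₀ i I ∈ Icc I.1 I.2 :=
  testPrice_mem hI.le (argMaxBelow_spec (h.gridC_pos i) _).1

theorem Valid.isPriceInterval_intervalU (h : A.Valid) (D : ℝ → ℕ) (i : ℕ) :
    A.IsPriceInterval (A.intervalU D i) := by
  induction i with
  | zero => exact ⟨le_rfl, h.lt.le, le_rfl⟩
  | succ i ih =>
    have hg := mul_nonneg h.L_pos.le (ih.gridGap_nonneg (A.gridU i))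
    exact isPriceInterval_truncate (ih.subset (h.hatOn_mem D i ih)) (by linarith) (by linarith)

theorem Valid.isPriceInterval_intervalC (h : A.Valid) (D : ℝ → ℕ) (s₀ : ℝ) (i : ℕ) :
    A.IsPriceInterval (A.intervalC D s₀ i) := by
  induction i with
  | zero => exact ⟨le_rfl, h.lt.le, le_rfl⟩
  | succ i ih =>
    have hg := mul_nonneg h.L_pos.le (ih.gridGap_nonneg (A.gridC i))
    exact isPriceInterval_truncate (ih.subset (h.hatQOn_mem D s₀ i ih)) (by linarith) (by linarith)

theorem Valid.finalU_mem (h : A.Valid) (D : ℝ → ℕ) : A.finalU D ∈ Icc A.plo A.phi := by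
  have hI := h.isPriceInterval_intervalU D A.lastU
  have h1 := hI.subset (h.hatOn_mem D A.lastU hI)
  have hg := mul_nonneg (Real.sqrt_nonneg A.L) (hI.gridGap_nonneg (A.gridU A.lastU))
  exact ⟨le_min h.lt.le (by linarith [h1.1]), min_le_left _ _⟩

theorem Valid.finalC_mem (h : A.Valid) (D : ℝ → ℕ) (s₀ : ℝ) : A.finalC D s₀ ∈ Icc A.plo A.phi :=
  (h.isPriceInterval_intervalC D s₀ _).subset
    (h.hatQOn_mem D s₀ A.lastC (h.isPriceInterval_intervalC D s₀ _))

theorem Valid.priceInStock_mem (h : A.Valid) (D : ℝ → ℕ) (t : ℝ) :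
    A.priceInStock D t ∈ Icc A.plo A.phi := by
  unfold priceInStock
  dsimp only
  split_ifs with h1 h2 h3
  · set s₀ := A.startU (sInf {i | A.Breaks D i} + 1)
    obtain ⟨-, ht, -⟩ := sInf_schedule_spec (b := fun i => s₀ + A.startC i) h2
    unfold priceC
    have hI := h.isPriceInterval_intervalC D s₀ (sInf {i | t ≤ s₀ + A.startC (i + 1)})
    refine hI.subset (roundPrice_mem (h.gridC_pos _) (h.tauC_pos _) hI.le ?_)
    rw [add_assoc, ← startC_succ]; exact ht
  · exact h.finalC_mem D _
  · obtain ⟨-, ht, -⟩ := sInf_schedule_spec (b := A.startU) h3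
    have hI := h.isPriceInterval_intervalU D (sInf {i | t ≤ A.startU (i + 1)})
    refine hI.subset (roundPrice_mem (h.gridU_pos _) (h.tauU_pos _) hI.le ?_)
    rw [← startU_succ]; exact ht
  · exact h.finalU_mem D

theorem measurable_priceInStock (A : DPA) (D : ℝ → ℕ) : Measurable (A.priceInStock D) := by
  have hround : ∀ (b : ℕ → ℝ) (τ : ℕ → ℝ) (κ : ℕ → ℕ) (I : ℕ → ℝ × ℝ) (c : ℕ → ℝ), Measurable fun t =>
      roundPrice (c (sInf {i | t ≤ b i})) (τ (sInf {i | t ≤ b i})) (κ (sInf {i | t ≤ b i}))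
        (I (sInf {i | t ≤ b i})) t := by
    intro b τ κ I c
    have : Measurable fun p : ℕ × ℝ => roundPrice (c p.1) (τ p.1) (κ p.1) (I p.1) p.2 :=
      measurable_from_prod_countable_right fun k =>
        measurable_roundPrice (c k) (τ k) (κ k) (I k)
    exact this.comp ((measurable_sInf_le b).prodMk measurable_id)
  unfold priceInStock
  refine Measurable.ite ?_ (Measurable.ite measurableSet_Iic ?_ measurable_const)
    (Measurable.ite measurableSet_Iic ?_ measurable_const)
  · have : {t | ∃ i ≤ A.lastU, A.Breaks D i ∧ A.startU (i + 1) < t} =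
        ⋃ i ∈ {i | i ≤ A.lastU ∧ A.Breaks D i}, Ioi (A.startU (i + 1)) := by
      ext t; simp [and_assoc]
    rw [this]
    exact MeasurableSet.biUnion (to_countable _) fun _ _ => measurableSet_Ioi
  · exact hround (fun i => A.startU (sInf {i | A.Breaks D i} + 1) + A.startC (i + 1)) _ _ _
      (fun i => A.startU (sInf {i | A.Breaks D i} + 1) + A.startC i)
  · exact hround (fun i => A.startU (i + 1)) _ _ _ _

/-- All times at which the algorithm may sample the demand. -/
noncomputable def sampleTimes (A : DPA) : Finset ℝ := by
  classical
  exact (((Finset.range (A.lastU + 1)).biUnion fun i =>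
      roundTimes (A.startU i) (A.tauU i) (A.gridU i)) ∪
    (Finset.range (A.lastU + 1)).biUnion fun i => (Finset.range (A.lastC + 1)).biUnion fun k =>
      roundTimes (A.startU (i + 1) + A.startC k) (A.tauC k) (A.gridC k)).filter (· ≤ A.T)

section Congr

variable {D D' : ℝ → ℕ} {t : ℝ}

theorem Valid.eq_roundU (h : A.Valid) (htT : t ≤ A.T)
    (hD : ∀ s ∈ A.sampleTimes, s < t → D s = D' s) {i : ℕ} (hi : i ≤ A.lastU)
    (ht : A.startU (i + 1) < t) : ∀ r ∈ roundTimes (A.startU i) (A.tauU i) (A.gridU i),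
    D r = D' r := by
  intro r hr
  have h1 := (roundTimes_le (h.gridU_pos i) (h.tauU_pos i).le hr).2
  rw [← startU_succ] at h1
  refine hD r ?_ (by linarith)
  simp only [sampleTimes, Finset.mem_filter, Finset.mem_union, Finset.mem_biUnion, Finset.mem_range]
  exact ⟨Or.inl ⟨i, by omega, hr⟩, by linarith⟩

theorem Valid.eq_roundC (h : A.Valid) (htT : t ≤ A.T)
    (hD : ∀ s ∈ A.sampleTimes, s < t → D s = D' s) {i k : ℕ} (hi : i ≤ A.lastU) (hk : k ≤ A.lastC)
    (ht : A.startU (i + 1) + A.startC (k + 1) < t) :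
    ∀ r ∈ roundTimes (A.startU (i + 1) + A.startC k) (A.tauC k) (A.gridC k), D r = D' r := by
  intro r hr
  have h1 := (roundTimes_le (h.gridC_pos k) (h.tauC_pos k).le hr).2
  rw [add_assoc, ← startC_succ] at h1
  refine hD r ?_ (by linarith)
  simp only [sampleTimes, Finset.mem_filter, Finset.mem_union, Finset.mem_biUnion, Finset.mem_range]
  exact ⟨Or.inr ⟨i, by omega, k, by omega, hr⟩, by linarith⟩

theorem Valid.hatOn_congr (h : A.Valid) (htT : t ≤ A.T)
    (hD : ∀ s ∈ A.sampleTimes, s < t → D s = D' s) {i : ℕ} (hi : i ≤ A.lastU)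
    (ht : A.startU (i + 1) < t) (I : ℝ × ℝ) :
    A.hatUOn D i I = A.hatUOn D' i I ∧ A.hatCOn D i I = A.hatCOn D' i I ∧
      A.hatOn D i I = A.hatOn D' i I := by
  have h1 := h.eq_roundU htT hD hi ht
  have e1 : A.hatUOn D i I = A.hatUOn D' i I := bestRevenuePrice_congr h1 I
  have e2 : A.hatCOn D i I = A.hatCOn D' i I := bestInventoryPrice_congr h1 _ I
  exact ⟨e1, e2, by rw [hatOn, hatOn, e1, e2]⟩

theorem Valid.intervalU_congr (h : A.Valid) (htT : t ≤ A.T)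
    (hD : ∀ s ∈ A.sampleTimes, s < t → D s = D' s) {i : ℕ} (hi : i ≤ A.lastU + 1)
    (ht : i = 0 ∨ A.startU i < t) : A.intervalU D i = A.intervalU D' i := by
  induction i with
  | zero => rfl
  | succ i ih =>
    have ht' : A.startU (i + 1) < t := by
      rcases ht with h | h
      · omega
      · exact h
    have ih' := ih (by omega) (Or.inr ((h.startU_strictMono (Nat.lt_succ_self i)).trans ht'))
    simp only [intervalU]
    rw [ih', (h.hatOn_congr htT hD (by omega) ht' _).2.2]

theorem Valid.breaks_congr (h : A.Valid) (htT : t ≤ A.T)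
    (hD : ∀ s ∈ A.sampleTimes, s < t → D s = D' s) {i : ℕ} (hi : i ≤ A.lastU)
    (ht : A.startU (i + 1) < t) : A.Breaks D i ↔ A.Breaks D' i := by
  unfold Breaks
  obtain ⟨e1, e2, -⟩ := h.hatOn_congr htT hD hi ht (A.intervalU D i)
  rw [e1, e2, h.intervalU_congr htT hD (by omega)
    (Or.inr ((h.startU_strictMono (Nat.lt_succ_self i)).trans ht))]

theorem Valid.intervalC_congr (h : A.Valid) (htT : t ≤ A.T)
    (hD : ∀ s ∈ A.sampleTimes, s < t → D s = D' s) {i k : ℕ} (hi : i ≤ A.lastU)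
    (hk : k ≤ A.lastC + 1) (ht : k = 0 ∨ A.startU (i + 1) + A.startC k < t) :
    A.intervalC D (A.startU (i + 1)) k = A.intervalC D' (A.startU (i + 1)) k := by
  induction k with
  | zero => rfl
  | succ k ih =>
    have ht' : A.startU (i + 1) + A.startC (k + 1) < t := by
      rcases ht with h | h
      · omega
      · exact h
    have := h.startC_strictMono (Nat.lt_succ_self k)
    have ih' := ih (by omega) (Or.inr (by linarith))
    have e : ∀ I, A.hatQOn D (A.startU (i + 1)) k I = A.hatQOn D' (A.startU (i + 1)) k I := fun I =>
      bestInventoryPrice_congr (h.eq_roundC htT hD hi (by omega) ht') _ I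
    simp only [intervalC]
    rw [ih', e]

/-- The first round of Step 2 in which the transition condition holds. -/
theorem exists_first_break (hex : ∃ i ≤ A.lastU, A.Breaks D i ∧ A.startU (i + 1) < t)
    (h : A.Valid) : ∃ i ≤ A.lastU, A.Breaks D i ∧ A.startU (i + 1) < t ∧ ∀ j < i, ¬ A.Breaks D j := by
  obtain ⟨i, hi, hb, hit⟩ := hex
  have hle : sInf {i | A.Breaks D i} ≤ i := Nat.sInf_le hb
  exact ⟨_, hle.trans hi, Nat.sInf_mem (s := {i | A.Breaks D i}) ⟨i, hb⟩,
    (h.startU_strictMono.monotone (Nat.succ_le_succ hle)).trans_lt hit,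
    fun j hj => Nat.notMem_of_lt_sInf hj⟩

theorem priceInStock_of_break {i : ℕ} (hi : i ≤ A.lastU)
    (hb : A.Breaks D i) (hfirst : ∀ j < i, ¬ A.Breaks D j) (ht : A.startU (i + 1) < t) :
    A.priceInStock D t = if t ≤ A.startU (i + 1) + A.startC (A.lastC + 1) then
      A.priceC D (A.startU (i + 1)) t else A.finalC D (A.startU (i + 1)) := by
  have e : sInf {i | A.Breaks D i} = i := Nat.sInf_eq_of_mem hb hfirst
  unfold priceInStock
  rw [if_pos ⟨i, hi, hb, ht⟩, e]

theorem priceInStock_of_not_break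
    (hno : ∀ i ≤ A.lastU, A.startU (i + 1) < t → ¬ A.Breaks D i) :
    A.priceInStock D t = if t ≤ A.startU (A.lastU + 1) then A.priceU D t else A.finalU D := by
  unfold priceInStock
  rw [if_neg]
  rintro ⟨i, hi, hb, ht⟩
  exact hno i hi ht hb

/-- The price at `t` is computed from rounds completed before `t`. The infimum over all rounds with
a transition does no harm: once a completed round satisfies the condition, so does a first one, and
that is completed too. -/
theorem Valid.priceInStock_congr (h : A.Valid) (htT : t ≤ A.T)
    (hD : ∀ s ∈ A.sampleTimes, s < t → D s = D' s) : A.priceInStock D t = A.priceInStock D' t := by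
  by_cases hex : ∃ i ≤ A.lastU, A.Breaks D i ∧ A.startU (i + 1) < t
  · obtain ⟨i, hi, hb, hit, hfirst⟩ := exists_first_break hex h
    have hb' := (h.breaks_congr htT hD hi hit).1 hb
    have hfirst' : ∀ j < i, ¬ A.Breaks D' j := fun j hj hbj =>
      hfirst j hj ((h.breaks_congr htT hD (hj.le.trans hi)
        ((h.startU_strictMono (Nat.succ_lt_succ hj)).trans hit)).2 hbj)
    rw [priceInStock_of_break hi hb hfirst hit, priceInStock_of_break hi hb' hfirst' hit]
    split_ifs with h2
    · obtain ⟨k1, k2, k3⟩ :=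
        sInf_schedule_spec (b := fun k => A.startU (i + 1) + A.startC k) h2
      unfold priceC
      dsimp only
      rw [h.intervalC_congr htT hD hi (by omega) k3]
    · push Not at h2
      have := h.startC_strictMono (Nat.lt_succ_self A.lastC)
      unfold finalC
      rw [h.intervalC_congr htT hD hi (by omega) (Or.inr (by linarith))]
      exact bestInventoryPrice_congr (h.eq_roundC htT hD hi le_rfl h2) _ _
  · have hno : ∀ i ≤ A.lastU, A.startU (i + 1) < t → ¬ A.Breaks D i :=
      fun i hi hit hb => hex ⟨i, hi, hb, hit⟩
    have hno' : ∀ i ≤ A.lastU, A.startU (i + 1) < t → ¬ A.Breaks D' i :=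
      fun i hi hit hb => hno i hi hit ((h.breaks_congr htT hD hi hit).2 hb)
    rw [priceInStock_of_not_break hno, priceInStock_of_not_break hno']
    split_ifs with h2
    · obtain ⟨k1, k2, k3⟩ := sInf_schedule_spec (b := A.startU) h2
      unfold priceU
      dsimp only
      rw [h.intervalU_congr htT hD (by omega) k3]
    · push Not at h2
      have := h.startU_strictMono (Nat.lt_succ_self A.lastU)
      unfold finalU
      rw [h.intervalU_congr htT hD (by omega) (Or.inr (by linarith))]
      simp only [(h.hatOn_congr htT hD le_rfl h2 _).2.2]

end Congr

/-- The round of the transition is random, but there are finitely many possibilities. `sampleTimes`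
contains the schedule of Step 3 for each of them and so does not depend on the demand. -/
theorem Valid.isSampledPolicy (h : A.Valid) : IsSampledPolicy A.sampleTimes A.T A.priceInStock := by
  refine ⟨fun s hs => ?_, fun D D' t ht hD => h.priceInStock_congr ht.2 hD⟩
  simp only [sampleTimes, Finset.mem_filter, Finset.mem_union, Finset.mem_biUnion] at hs
  obtain ⟨h1 | h1, h2⟩ := hs
  · obtain ⟨i, -, hi⟩ := h1
    exact ⟨(h.startU_nonneg i).trans (roundTimes_le (h.gridU_pos i) (h.tauU_pos i).le hi).1, h2⟩
  · obtain ⟨i, -, k, -, hk⟩ := h1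
    exact ⟨(add_nonneg (h.startU_nonneg _) (h.startC_nonneg k)).trans
      (roundTimes_le (h.gridC_pos k) (h.tauC_pos k).le hk).1, h2⟩

theorem policy_eq (A : DPA) : A.policy = stopPolicy A.X A.pInf A.priceInStock := rfl

theorem Valid.isRegularRate (h : A.Valid) {lam g : ℝ → ℝ} {B : ℝ} (hg : Measurable g)
    (hgb : ∀ p, 0 ≤ g p ∧ g p ≤ B) (hlam : ∀ p ∈ Icc A.plo A.phi, lam p = g p) :
    IsRegularRate A.T lam A.priceInStock := by
  refine ⟨fun D s _ => ?_, fun D => ?_⟩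
  · rw [hlam _ (h.priceInStock_mem D s)]; exact (hgb _).1
  · have e : (fun s => lam (A.priceInStock D s)) = fun s => g (A.priceInStock D s) := by
      ext s; exact hlam _ (h.priceInStock_mem D s)
    rw [e, intervalIntegrable_iff_integrableOn_Ioc_of_le h.T_pos.le]
    refine Measure.integrableOn_of_bounded (M := B) (by simp)
      (hg.comp (A.measurable_priceInStock D)).aestronglyMeasurable
      (Filter.Eventually.of_forall fun s => ?_)
    rw [Real.norm_eq_abs, abs_of_nonneg (hgb _).1]; exact (hgb _).2

theorem Valid.isAdmissible (h : A.Valid) {lam : ℝ → ℝ} (hr : IsRegularRate A.T lam A.priceInStock)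
    (hX : 0 ≤ A.X) (h0 : lam A.pInf = 0) :
    IsAdmissible A.plo A.phi A.pInf A.X A.T lam A.policy := by
  rw [policy_eq]
  refine ⟨fun D t _ => ?_, fun D D' t ht hD => ?_, fun ν hν => ?_⟩
  · unfold stopPolicy
    split_ifs
    · exact Or.inr rfl
    · exact Or.inl (h.priceInStock_mem D t)
  · have hcond : (∃ s, 0 ≤ s ∧ s < t ∧ A.X < D s + 1) ↔ ∃ s, 0 ≤ s ∧ s < t ∧ A.X < D' s + 1 := by
      refine exists_congr fun s => and_congr_right fun hs => and_congr_right fun hst => ?_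
      rw [hD s hs hst]
    unfold stopPolicy
    rw [h.priceInStock_congr ht.2 fun s hs hst => hD s (h.isSampledPolicy.subset s hs).1 hst]
    by_cases hc : ∃ s, 0 ≤ s ∧ s < t ∧ A.X < D s + 1
    · rw [if_pos hc, if_pos (hcond.1 hc)]
    · rw [if_neg hc, if_neg fun hc' => hc (hcond.2 hc')]
  · refine ⟨_, isDemandPath_stopPolicy h.isSampledPolicy hr hν h.T_pos.le hX h0, ?_,
      fun D' hD' => eqOn_stopPolicy h.isSampledPolicy hr hν h.T_pos.le hX h0 hD'⟩
    exact (Nat.cast_le.2 (min_le_right _ _)).trans (Nat.floor_le hX)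

/-! The prices in the test periods. -/

theorem Valid.priceInStock_roundU (h : A.Valid) {D : ℝ → ℕ} {i j : ℕ} (hi : i ≤ A.lastU)
    (hno : ∀ k < i, ¬ A.Breaks D k) (hj : j < A.gridU i) {t : ℝ}
    (ht : t ∈ Ioc (A.startU i + j * (A.tauU i / A.gridU i))
      (A.startU i + (j + 1) * (A.tauU i / A.gridU i))) :
    A.priceInStock D t = testPrice (A.intervalU D i) (A.gridU i) j := by
  have hstep := h.stepU_pos i
  have hκ : (0 : ℝ) < A.gridU i := by exact_mod_cast h.gridU_pos i
  have hj' : (j : ℝ) + 1 ≤ A.gridU i := by exact_mod_cast hj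
  have hlt : A.startU i < t := by
    have : 0 ≤ (j : ℝ) * (A.tauU i / A.gridU i) := by positivity
    linarith [ht.1]
  have hle : t ≤ A.startU (i + 1) := by
    have := mul_le_mul_of_nonneg_right hj' hstep.le
    rw [mul_div_cancel₀ _ hκ.ne'] at this
    rw [startU_succ]; linarith [ht.2]
  have hle' : t ≤ A.startU (A.lastU + 1) :=
    hle.trans (h.startU_strictMono.monotone (by omega))
  rw [priceInStock_of_not_break, if_pos hle']
  · have e : sInf {i | t ≤ A.startU (i + 1)} = i := by
      refine Nat.sInf_eq_of_mem hle fun k hk hc => ?_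
      have := h.startU_strictMono.monotone (show k + 1 ≤ i by omega)
      have hc' : t ≤ A.startU (k + 1) := hc
      linarith
    simp only [priceU, e]
    exact roundPrice_eq hstep _ ht
  · intro k hk hkt
    refine hno k ?_
    by_contra hc
    have := h.startU_strictMono.monotone (show i + 1 ≤ k + 1 by omega)
    linarith

theorem priceInStock_finalU {D : ℝ → ℕ} (hno : ∀ k ≤ A.lastU, ¬ A.Breaks D k)
    {t : ℝ} (ht : A.startU (A.lastU + 1) < t) : A.priceInStock D t = A.finalU D := by
  rw [priceInStock_of_not_break fun i hi _ => hno i hi, if_neg (not_le.2 ht)]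

theorem Valid.priceInStock_roundC (h : A.Valid) {D : ℝ → ℕ} {i k j : ℕ} (hi : i ≤ A.lastU)
    (hb : A.Breaks D i) (hno : ∀ k < i, ¬ A.Breaks D k) (hk : k ≤ A.lastC) (hj : j < A.gridC k)
    {t : ℝ} (ht : t ∈ Ioc (A.startU (i + 1) + A.startC k + j * (A.tauC k / A.gridC k))
      (A.startU (i + 1) + A.startC k + (j + 1) * (A.tauC k / A.gridC k))) :
    A.priceInStock D t = testPrice (A.intervalC D (A.startU (i + 1)) k) (A.gridC k) j := by
  have hstep := h.stepC_pos k
  have hκ : (0 : ℝ) < A.gridC k := by exact_mod_cast h.gridC_pos k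
  have hj' : (j : ℝ) + 1 ≤ A.gridC k := by exact_mod_cast hj
  have hlt : A.startU (i + 1) + A.startC k < t := by
    have : 0 ≤ (j : ℝ) * (A.tauC k / A.gridC k) := by positivity
    linarith [ht.1]
  have hle : t ≤ A.startU (i + 1) + A.startC (k + 1) := by
    have := mul_le_mul_of_nonneg_right hj' hstep.le
    rw [mul_div_cancel₀ _ hκ.ne'] at this
    rw [startC_succ]; linarith [ht.2]
  have hle' : t ≤ A.startU (i + 1) + A.startC (A.lastC + 1) := by
    have := h.startC_strictMono.monotone (show k + 1 ≤ A.lastC + 1 by omega)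
    linarith
  rw [priceInStock_of_break hi hb hno (by linarith [h.startC_nonneg k]), if_pos hle']
  have e : sInf {m | t ≤ A.startU (i + 1) + A.startC (m + 1)} = k := by
    refine Nat.sInf_eq_of_mem hle fun m hm hc => ?_
    have := h.startC_strictMono.monotone (show m + 1 ≤ k by omega)
    have hc' : t ≤ A.startU (i + 1) + A.startC (m + 1) := hc
    linarith
  simp only [priceC, e]
  exact roundPrice_eq hstep _ ht

theorem Valid.priceInStock_finalC (h : A.Valid) {D : ℝ → ℕ} {i : ℕ} (hi : i ≤ A.lastU)
    (hb : A.Breaks D i) (hno : ∀ k < i, ¬ A.Breaks D k) {t : ℝ}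
    (ht : A.startU (i + 1) + A.startC (A.lastC + 1) < t) :
    A.priceInStock D t = A.finalC D (A.startU (i + 1)) := by
  rw [priceInStock_of_break hi hb hno (by linarith [h.startC_nonneg (A.lastC + 1)]),
    if_neg (not_le.2 ht)]

end DPA

/-! ### Revenue and demand accounting along a path -/

/-- The revenue collected on the time interval `(s, t]` when the price at time `r` is `P r`. -/
noncomputable def periodRevenue (T : ℝ) (P : ℝ → ℝ) (D : ℝ → ℕ) (s t : ℝ) : ℝ :=
  ∑ k ∈ Finset.Ioc (D s) (D t), P (hitTime T D k)

section Period

variable {T : ℝ} {P : ℝ → ℝ} {D : ℝ → ℕ}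

theorem IsDemandProfile.hitTime_mem_Ioc (h : IsDemandProfile T D) {s t : ℝ} (hs : s ∈ Icc 0 T)
    (ht : t ∈ Icc 0 T) {k : ℕ} (hk : k ∈ Finset.Ioc (D s) (D t)) : hitTime T D k ∈ Ioc s t := by
  rw [Finset.mem_Ioc] at hk
  obtain ⟨h1, h2, -⟩ := h.hit ht hk.2
  refine ⟨?_, h1.2⟩
  by_contra hc
  push Not at hc
  have := h.mono ⟨h1.1, h1.2.trans ht.2⟩ hs hc
  omega

theorem periodRevenue_add (h : IsDemandProfile T D) {s t u : ℝ} (hs : 0 ≤ s) (hst : s ≤ t)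
    (htu : t ≤ u) (hu : u ≤ T) :
    periodRevenue T P D s u = periodRevenue T P D s t + periodRevenue T P D t u := by
  have h1 := h.mono ⟨hs, hst.trans (htu.trans hu)⟩ ⟨hs.trans hst, htu.trans hu⟩ hst
  have h2 := h.mono ⟨hs.trans hst, htu.trans hu⟩ ⟨hs.trans (hst.trans htu), hu⟩ htu
  unfold periodRevenue
  rw [← Finset.sum_union]
  · rw [Finset.Ioc_union_Ioc_eq_Ioc h1 h2]
  · exact Finset.Ioc_disjoint_Ioc_of_le le_rfl

theorem periodRevenue_const (h : IsDemandProfile T D) {s t p : ℝ} (hs : 0 ≤ s) (hst : s ≤ t)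
    (ht : t ≤ T) (hP : ∀ r ∈ Ioc s t, P r = p) :
    periodRevenue T P D s t = p * ((D t : ℝ) - D s) := by
  have h1 := h.mono ⟨hs, hst.trans ht⟩ ⟨hs.trans hst, ht⟩ hst
  unfold periodRevenue
  rw [Finset.sum_congr rfl fun k hk =>
    hP _ (h.hitTime_mem_Ioc ⟨hs, hst.trans ht⟩ ⟨hs.trans hst, ht⟩ hk)]
  rw [Finset.sum_const, Nat.card_Ioc, nsmul_eq_mul, Nat.cast_sub h1, mul_comm]

/-- The revenue lost by running out of stock. -/
theorem periodRevenue_le_sum_min (h : IsDemandProfile T D) {B : ℝ} (hB : 0 ≤ B) (hP : ∀ t, P t ≤ B)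
    (m : ℕ) : periodRevenue T P D 0 T - B * max ((D T : ℝ) - m) 0 ≤
      ∑ k ∈ Finset.Icc 1 (min (D T) m), P (hitTime T D k) := by
  have e1 : Finset.Icc 1 (min (D T) m) = Finset.Ioc 0 (min (D T) m) := by
    ext k; simp only [Finset.mem_Icc, Finset.mem_Ioc]; omega
  have hsplit : periodRevenue T P D 0 T = ∑ k ∈ Finset.Ioc 0 (min (D T) m), P (hitTime T D k) +
      ∑ k ∈ Finset.Ioc (min (D T) m) (D T), P (hitTime T D k) := by
    unfold periodRevenue
    rw [h.zero, ← Finset.sum_union, Finset.Ioc_union_Ioc_eq_Ioc (Nat.zero_le _) (min_le_left _ _)]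
    exact Finset.Ioc_disjoint_Ioc_of_le le_rfl
  have hbd : ∑ k ∈ Finset.Ioc (min (D T) m) (D T), P (hitTime T D k) ≤
      B * max ((D T : ℝ) - m) 0 := by
    refine (Finset.sum_le_card_nsmul _ _ B fun k _ => hP _).trans ?_
    rw [Nat.card_Ioc, nsmul_eq_mul, mul_comm]
    refine mul_le_mul_of_nonneg_left ?_ hB
    rcases le_total (D T) m with hle | hle
    · rw [min_eq_left hle]; simp
    · rw [min_eq_right hle, Nat.cast_sub hle]; exact le_max_left _ _
  rw [e1]; linarith

/-- On `(s, t]` the revenue falls short of the ideal `n (t - s) f` by at most `n e`, and the demand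
exceeds `n (t - s) x` by at most `n e`. -/
structure Ledger (n f x T : ℝ) (P : ℝ → ℝ) (D : ℝ → ℕ) (s t e : ℝ) : Prop where
  nonneg : 0 ≤ s
  le : s ≤ t
  le_end : t ≤ T
  rev : n * ((t - s) * f - e) ≤ periodRevenue T P D s t
  dem : (D t : ℝ) - D s ≤ n * ((t - s) * x + e)

theorem Ledger.trans (h : IsDemandProfile T D) {n f x s t u e e' : ℝ}
    (h1 : Ledger n f x T P D s t e) (h2 : Ledger n f x T P D t u e') :
    Ledger n f x T P D s u (e + e') := by
  refine ⟨h1.nonneg, h1.le.trans h2.le, h2.le_end, ?_, ?_⟩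
  · rw [periodRevenue_add h h1.nonneg h1.le h2.le h2.le_end]
    linarith [h1.rev, h2.rev]
  · linarith [h1.dem, h2.dem]

theorem Ledger.mono {n f x s t e e' : ℝ} (hn : 0 ≤ n) (h1 : Ledger n f x T P D s t e)
    (he : e ≤ e') : Ledger n f x T P D s t e' := by
  have := mul_le_mul_of_nonneg_left he hn
  exact ⟨h1.nonneg, h1.le, h1.le_end, by linarith [h1.rev], by linarith [h1.dem]⟩

theorem Ledger.refl {n f x s : ℝ} (hs : 0 ≤ s) (hsT : s ≤ T) :
    Ledger n f x T P D s s 0 := by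
  refine ⟨hs, le_rfl, hsT, ?_, ?_⟩ <;> simp [periodRevenue]

theorem Ledger.sum (h : IsDemandProfile T D) {n f x s : ℝ} {b e : ℕ → ℝ} {m : ℕ} (hs : 0 ≤ s)
    (hm : s + ∑ i ∈ Finset.range m, b i ≤ T) (hb : ∀ i, 0 ≤ b i)
    (hl : ∀ i < m, Ledger n f x T P D (s + ∑ j ∈ Finset.range i, b j)
      (s + ∑ j ∈ Finset.range (i + 1), b j) (e i)) :
    Ledger n f x T P D s (s + ∑ i ∈ Finset.range m, b i) (∑ i ∈ Finset.range m, e i) := by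
  induction m with
  | zero => simpa using Ledger.refl hs (by simpa using hm)
  | succ m ih =>
    have hm' : s + ∑ i ∈ Finset.range m, b i ≤ T := by
      rw [Finset.sum_range_succ] at hm; linarith [hb m]
    rw [Finset.sum_range_succ e]
    exact (ih hm' fun i hi => hl i (by omega)).trans h (hl m (by omega))

theorem ledger_const (h : IsDemandProfile T D) {n f x s t p l e : ℝ} (hn : 0 ≤ n) (hs : 0 ≤ s)
    (hst : s ≤ t) (ht : t ≤ T) (hP : ∀ r ∈ Ioc s t, P r = p) (hp : 0 ≤ p) {B err e0 : ℝ}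
    (hpB : p ≤ B) (hdev : |((D t : ℝ) - D s) - n * (t - s) * l| ≤ n * err) (herr : 0 ≤ err)
    (he0 : 0 ≤ e0) (hf : f - e0 ≤ p * l) (hx : l ≤ x + e0)
    (he : T * e0 + (B + 1) * err ≤ e) : Ledger n f x T P D s t e := by
  have hd := abs_le.1 hdev
  have hB : 0 ≤ B := hp.trans hpB
  have hT : (t - s) * e0 ≤ T * e0 := mul_le_mul_of_nonneg_right (by linarith) he0
  have hts : 0 ≤ t - s := sub_nonneg.2 hst
  refine ⟨hs, hst, ht, ?_, ?_⟩
  · rw [periodRevenue_const h hs hst ht hP]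
    have h1 : p * (n * (t - s) * l - n * err) ≤ p * ((D t : ℝ) - D s) :=
      mul_le_mul_of_nonneg_left (by linarith [hd.1]) hp
    refine le_trans ?_ h1
    have h2 : n * ((t - s) * f - e) ≤ n * ((t - s) * (p * l) - p * err) := by
      refine mul_le_mul_of_nonneg_left ?_ hn
      have := mul_le_mul_of_nonneg_left hf hts
      have := mul_le_mul_of_nonneg_right hpB herr
      nlinarith
    linarith
  · have h2 : n * ((t - s) * l + err) ≤ n * ((t - s) * x + e) := by
      refine mul_le_mul_of_nonneg_left ?_ hn
      have := mul_le_mul_of_nonneg_left hx hts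
      have := mul_nonneg hB herr
      nlinarith
    linarith [hd.2]

/-- The account of one learning round. -/
theorem ledger_round (h : IsDemandProfile T D) {n f x s τ : ℝ} {κ : ℕ} {I : ℝ × ℝ} {lam : ℝ → ℝ}
    (hn : 0 ≤ n) (hs : 0 ≤ s) (hτ : 0 < τ) (hκ : 0 < κ) (hT : s + τ ≤ T)
    (hP : ∀ j < κ, ∀ r ∈ Ioc (s + j * (τ / κ)) (s + (j + 1) * (τ / κ)), P r = testPrice I κ j)
    {B err e1 e2 e : ℝ} (hp : ∀ j < κ, 0 ≤ testPrice I κ j ∧ testPrice I κ j ≤ B)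
    (hobs : ∀ j < κ, |observedRate D s τ κ j - n * lam (testPrice I κ j)| ≤ n * err)
    (herr : 0 ≤ err)
    (hf : ∀ j < κ, f - e1 ≤ testPrice I κ j * lam (testPrice I κ j))
    (hx : ∑ j ∈ Finset.range κ, lam (testPrice I κ j) ≤ κ * (x + e2))
    (he1 : e1 + B * err ≤ e) (he2 : e2 + err ≤ e) :
    Ledger n f x T P D s (s + τ) (τ * e) := by
  have hκ' : (0 : ℝ) < κ := by exact_mod_cast hκ
  set Δ := τ / κ with hΔ
  have hΔ0 : 0 < Δ := by positivity
  have hκΔ : κ * Δ = τ := mul_div_cancel₀ _ hκ'.ne'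
  have hobsD : ∀ j : ℕ, ((D (s + (j + 1 : ℕ) * Δ) : ℝ) - D (s + j * Δ)) =
      Δ * observedRate D s τ κ j := by
    intro j
    rw [observedRate, ← hΔ, mul_div_cancel₀ _ hΔ0.ne']
    push_cast; rfl
  have hle : ∀ j : ℕ, j ≤ κ → s + j * Δ ≤ T := by
    intro j hj
    have : (j : ℝ) * Δ ≤ κ * Δ :=
      mul_le_mul_of_nonneg_right (by exact_mod_cast hj) hΔ0.le
    linarith
  have hrev : ∀ m : ℕ, m ≤ κ → n * (m * (Δ * (f - e))) ≤ periodRevenue T P D s (s + m * Δ) := by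
    intro m
    induction m with
    | zero => intro _; simp [periodRevenue]
    | succ m ih =>
      intro hm
      have hm0 : (0 : ℝ) ≤ m := Nat.cast_nonneg m
      have e3 : s + ((m + 1 : ℕ) : ℝ) * Δ = s + (m + 1) * Δ := by push_cast; ring
      have hmΔ : 0 ≤ m * Δ := by positivity
      rw [periodRevenue_add h hs (t := s + m * Δ) (by linarith) (by push_cast; linarith)
        (hle _ hm), periodRevenue_const h (by linarith) (by push_cast; linarith) (hle _ hm)
        (p := testPrice I κ m) (fun r hr => hP m (by omega) r (by rwa [e3] at hr)), hobsD]
      have h1 := ih (by omega)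
      have h2 := (abs_le.1 (hobs m (by omega))).1
      obtain ⟨hp0, hpB⟩ := hp m (by omega)
      have h3 := hf m (by omega)
      have h4 : testPrice I κ m * (n * lam (testPrice I κ m) - n * err) ≤
          testPrice I κ m * observedRate D s τ κ m :=
        mul_le_mul_of_nonneg_left (by linarith) hp0
      have h5 : f - e ≤ testPrice I κ m * lam (testPrice I κ m) - testPrice I κ m * err := by
        have := mul_le_mul_of_nonneg_right hpB herr
        linarith
      have h6 := mul_le_mul_of_nonneg_left h5 hn
      have h7 : Δ * (n * (f - e)) ≤ Δ * (testPrice I κ m * observedRate D s τ κ m) :=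
        mul_le_mul_of_nonneg_left (by linarith) hΔ0.le
      push_cast
      linarith
  -- Only the average of the tested demand rates enters here, not each rate separately; this makes a
  -- quadratic bound on the excess possible.
  have hdem : (D (s + κ * Δ) : ℝ) - D s ≤ n * (κ * Δ * (x + e)) := by
    have e4 := Finset.sum_range_sub (fun j : ℕ => (D (s + j * Δ) : ℝ)) κ
    simp only [Nat.cast_zero, zero_mul, add_zero] at e4
    rw [← e4]
    have h1 : ∑ j ∈ Finset.range κ, ((D (s + (j + 1 : ℕ) * Δ) : ℝ) - D (s + j * Δ)) ≤
        ∑ j ∈ Finset.range κ, Δ * (n * (lam (testPrice I κ j) + err)) := by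
      refine Finset.sum_le_sum fun j hj => ?_
      rw [hobsD]
      have := (abs_le.1 (hobs j (Finset.mem_range.1 hj))).2
      exact mul_le_mul_of_nonneg_left (by linarith) hΔ0.le
    refine h1.trans ?_
    rw [← Finset.mul_sum, ← Finset.mul_sum, Finset.sum_add_distrib, Finset.sum_const,
      Finset.card_range, nsmul_eq_mul]
    have h2 : ∑ j ∈ Finset.range κ, lam (testPrice I κ j) + κ * err ≤ κ * (x + e) := by
      have := mul_le_mul_of_nonneg_left he2 hκ'.le
      linarith
    have h3 := mul_le_mul_of_nonneg_left (mul_le_mul_of_nonneg_left h2 hn) hΔ0.le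
    linarith
  have h8 := hrev κ le_rfl
  rw [hκΔ] at h8 hdem
  refine ⟨hs, by linarith, hT, ?_, ?_⟩
  · have : n * ((s + τ - s) * f - τ * e) = n * (κ * (Δ * (f - e))) := by
      rw [← mul_assoc (κ : ℝ), hκΔ]; ring
    rw [this]; exact h8
  · have : n * ((s + τ - s) * x + τ * e) = n * (τ * (x + e)) := by ring
    rw [this]; exact hdem

end Period

/-- The regularity of a realised demand path, for the prices `P`: in a period with a constant price
the demand deviates little from its mean. -/
structure IsConcentrated (n L B T : ℝ) (lam P : ℝ → ℝ) (D : ℝ → ℕ) : Prop where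
  profile : IsDemandProfile T D
  dev : ∀ s t p V, 0 ≤ s → s ≤ t → t ≤ T → (∀ r ∈ Ioc s t, P r = p) → n * B * (t - s) ≤ V → L ≤ V →
    |((D t : ℝ) - D s) - n * (t - s) * lam p| ≤ 11 * √(L * V)

/-- While the price is `p`, the clock of the Poisson process advances by `n (t - s) λ(p) ≤ V`. It
never passes `n B T`, and `hH` leaves room for rounding up to an integer time. -/
theorem IsDemandPath.isConcentrated {n L B T : ℝ} {lam : ℝ → ℝ} {π : PricingPolicy} {ν : ℝ≥0 → ℕ}
    {D : ℝ → ℕ} {H : ℕ} (hT : 0 ≤ T) (hL : 1 ≤ L)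
    (h : IsDemandPath T (fun p => n * lam p) π ν D)
    (hν : IsCountingPath ν) (hreg : IsRegularPath H (3 * L) ν)
    (hb : ∀ s, 0 ≤ n * lam (π D s) ∧ n * lam (π D s) ≤ n * B)
    (hH : n * B * T + 1 ≤ H) : IsConcentrated n L B T lam (π D) D := by
  refine ⟨h.isDemandProfile hT hν fun s _ => (hb s).1, fun s t p V hs hst ht hP hV hLV => ?_⟩
  obtain ⟨h1, h2⟩ := h.monotoneOn_integral (fun s _ => (hb s).1) hs hst ht
  have hconst : ∫ r in s..t, n * lam (π D r) = n * (t - s) * lam p := by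
    rw [intervalIntegral.integral_congr_ae (g := fun _ => n * lam p)
      (Filter.Eventually.of_forall fun r hr => by rw [uIoc_of_le hst] at hr; rw [hP r hr])]
    simp only [intervalIntegral.integral_const, smul_eq_mul]; ring
  obtain ⟨h3, -⟩ := h.monotoneOn_integral (fun s _ => (hb s).1) le_rfl hs (hst.trans ht)
  have hub : ∀ a b : ℝ, 0 ≤ a → a ≤ b → b ≤ T → ∫ r in a..b, n * lam (π D r) ≤ n * B * (b - a) := by
    intro a b ha hab hbT
    have hi : IntervalIntegrable (fun r => n * lam (π D r)) volume a b :=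
      (h a ⟨ha, hab.trans hbT⟩).1.symm.trans (h b ⟨ha.trans hab, hbT⟩).1
    have := intervalIntegral.integral_mono_on hab hi
      (intervalIntegrable_const (c := n * B)) fun r _ => (hb r).2
    rw [intervalIntegral.integral_const, smul_eq_mul] at this
    linarith
  have h4 := hub 0 t le_rfl (hs.trans hst) ht
  have h5 := hub s t hs hst ht
  have hnB : 0 ≤ n * B := (hb 0).1.trans (hb 0).2
  have h6 : n * B * (t - 0) ≤ n * B * T := mul_le_mul_of_nonneg_left (by linarith) hnB
  have := hreg.abs_sub_le hν.mono hL h3 (t := ∫ r in (0 : ℝ)..t, n * lam (π D r))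
    (by linarith) (by linarith) (V := V) (by linarith) hLV
  rw [← (h s ⟨hs, hst.trans ht⟩).2, ← (h t ⟨hs.trans hst, ht⟩).2] at this
  rwa [h2, add_sub_cancel_left, hconst] at this

/-! ### Estimates for one learning round -/

theorem exists_testPrice_near {I : ℝ × ℝ} {κ : ℕ} (hκ : 0 < κ) {p : ℝ} (hp : p ∈ Icc I.1 I.2) :
    ∃ j < κ, testPrice I κ j ≤ p ∧ p ≤ testPrice I κ j + gridGap I κ := by
  have hκ' : (0 : ℝ) < κ := by exact_mod_cast hκ
  have h0 : testPrice I κ 0 ≤ p := by simpa [testPrice] using hp.1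
  classical
  set j := Nat.findGreatest (fun j => testPrice I κ j ≤ p) (κ - 1) with hj
  have hjle : j ≤ κ - 1 := Nat.findGreatest_le _
  have hspec : testPrice I κ j ≤ p :=
    Nat.findGreatest_spec (P := fun j => testPrice I κ j ≤ p) (Nat.zero_le _) h0
  have hsucc : testPrice I κ (j + 1) = testPrice I κ j + gridGap I κ := by
    unfold testPrice; push_cast; ring
  refine ⟨j, by omega, hspec, ?_⟩
  rw [← hsucc]
  rcases eq_or_lt_of_le hjle with he | hlt
  · have : testPrice I κ (j + 1) = I.2 := by
      have e : ((j + 1 : ℕ) : ℝ) = κ := by exact_mod_cast (by omega : j + 1 = κ)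
      rw [testPrice, e, gridGap, mul_div_cancel₀ _ hκ'.ne']; ring
    rw [this]; exact hp.2
  · have := Nat.findGreatest_is_greatest (P := fun j => testPrice I κ j ≤ p) (n := κ - 1)
      (Nat.lt_succ_self j) (by omega)
    push Not at this
    exact this.le

namespace MarketBounds

variable {plo phi x B K Q ε : ℝ} {lam : ℝ → ℝ} {pu pc : ℝ}

/-- Some test price loses at most `Q * gridGap ^ 2`: a neighbour of `pu`, or `pu` itself if `pu =
plo`, which is then the first test price. The observed maximiser loses at most `2 * B * err` more,
and strong concavity turns the loss into a squared distance. -/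
theorem bestRevenuePrice_near (h : MarketBounds plo phi x B K Q ε lam pu pc) (hQ : 0 ≤ Q)
    {I : ℝ × ℝ} {κ : ℕ} (hκ : 0 < κ) (ha : plo ≤ I.1) (hb : I.2 ≤ phi) (hpu : pu ∈ Icc I.1 I.2)
    {D : ℝ → ℕ} {s τ n err : ℝ} (hn : 0 < n)
    (hobs : ∀ j < κ, |observedRate D s τ κ j - n * lam (testPrice I κ j)| ≤ n * err) :
    (bestRevenuePrice D s τ κ I - pu) ^ 2 ≤ Q * (Q * gridGap I κ ^ 2 + 2 * B * err) := by
  have hmem : ∀ j < κ, testPrice I κ j ∈ Icc plo phi := fun j hj =>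
    have := testPrice_mem (hpu.1.trans hpu.2) hj
    ⟨ha.trans this.1, this.2.trans hb⟩
  have herr : 0 ≤ err := by
    have := (abs_nonneg _).trans (hobs 0 hκ)
    exact le_of_mul_le_mul_left (by simpa using this) hn
  obtain ⟨j, hj, hnear⟩ : ∃ j < κ, pu * lam pu - testPrice I κ j * lam (testPrice I κ j) ≤
      Q * gridGap I κ ^ 2 := by
    rcases h.le_sq with h1 | h1
    · refine ⟨0, hκ, ?_⟩
      have e : testPrice I κ 0 = pu := by
        simp only [testPrice, Nat.cast_zero, zero_mul, add_zero]
        exact le_antisymm hpu.1 (h1 ▸ ha)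
      rw [e, sub_self]; positivity
    · obtain ⟨j, hj, h2, h3⟩ := exists_testPrice_near hκ hpu
      refine ⟨j, hj, (h1 _ (hmem j hj)).trans (mul_le_mul_of_nonneg_left ?_ hQ)⟩
      rw [← sq_abs (testPrice I κ j - pu)]
      exact pow_le_pow_left₀ (abs_nonneg _) (abs_le.2 ⟨by linarith, by linarith⟩) 2
  unfold bestRevenuePrice
  obtain ⟨k1, k2⟩ := argMaxBelow_spec hκ fun j => testPrice I κ j * observedRate D s τ κ j
  set k := argMaxBelow κ fun j => testPrice I κ j * observedRate D s τ κ j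
  refine (h.sq_le _ (hmem k k1)).trans (mul_le_mul_of_nonneg_left ?_ hQ)
  have k3 := k2 j hj
  have pj := hmem j hj
  have pk := hmem k k1
  have pj0 : 0 ≤ testPrice I κ j := h.plo_nonneg.trans pj.1
  have pk0 : 0 ≤ testPrice I κ k := h.plo_nonneg.trans pk.1
  have pjB : testPrice I κ j ≤ B := pj.2.trans h.phi_le
  have pkB : testPrice I κ k ≤ B := pk.2.trans h.phi_le
  have oj := abs_le.1 (hobs j hj)
  have ok := abs_le.1 (hobs k k1)
  have hne : 0 ≤ n * err := mul_nonneg hn.le herr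
  have a1 : testPrice I κ j * (n * lam (testPrice I κ j) - n * err) ≤
      testPrice I κ k * (n * lam (testPrice I κ k) + n * err) :=
    (mul_le_mul_of_nonneg_left (by linarith [oj.1]) pj0).trans
      (k3.trans (mul_le_mul_of_nonneg_left (by linarith [ok.2]) pk0))
  have a2 := mul_le_mul_of_nonneg_right pjB hne
  have a3 := mul_le_mul_of_nonneg_right pkB hne
  have a4 : n * (testPrice I κ j * lam (testPrice I κ j)) ≤
      n * (testPrice I κ k * lam (testPrice I κ k) + 2 * B * err) := by nlinarith
  have a5 := le_of_mul_le_mul_left a4 hn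
  linarith

/-- The estimate can only find the feasible price closest to `pc` within the interval, whence `max
pc I.1`. Here distances and demand differences are comparable, so the error enters linearly and not
through a square root. -/
theorem bestInventoryPrice_near (h : MarketBounds plo phi x B K Q ε lam pu pc) (hK : 0 ≤ K)
    {I : ℝ × ℝ} {κ : ℕ} (hκ : 0 < κ) (ha : plo ≤ I.1) (hI : I.1 ≤ I.2) (hb : I.2 ≤ phi)
    (hpc : pc ≤ I.2)
    {D : ℝ → ℕ} {s τ n err : ℝ} (hn : 0 < n)
    (hobs : ∀ j < κ, |observedRate D s τ κ j - n * lam (testPrice I κ j)| ≤ n * err) :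
    |bestInventoryPrice (n * x) D s τ κ I - max pc I.1| ≤ K * (K * gridGap I κ + 2 * err) := by
  have hmem : ∀ j < κ, testPrice I κ j ∈ Icc plo phi := fun j hj =>
    have := testPrice_mem hI hj
    ⟨ha.trans this.1, this.2.trans hb⟩
  have hg : 0 ≤ gridGap I κ := div_nonneg (by linarith) (Nat.cast_nonneg _)
  unfold bestInventoryPrice
  obtain ⟨k1, k2⟩ := argMaxBelow_spec hκ fun j => -|observedRate D s τ κ j - n * x|
  set k := argMaxBelow κ fun j => -|observedRate D s τ κ j - n * x|
  have herr : 0 ≤ err := by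
    have := (abs_nonneg _).trans (hobs 0 hκ)
    exact le_of_mul_le_mul_left (by simpa using this) hn
  have key : ∀ j < κ, |lam (testPrice I κ k) - x| ≤ |lam (testPrice I κ j) - x| + 2 * err := by
    intro j hj
    have a1 := k2 j hj
    have oj := hobs j hj
    have ok := hobs k k1
    have e : ∀ i, n * |lam (testPrice I κ i) - x| = |n * lam (testPrice I κ i) - n * x| := fun i => by
      rw [← mul_sub, abs_mul, abs_of_pos hn]
    have b1 := abs_sub_le (n * lam (testPrice I κ k)) (observedRate D s τ κ k) (n * x)
    rw [abs_sub_comm (n * lam (testPrice I κ k)) (observedRate D s τ κ k)] at b1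
    have b2 := abs_sub_le (observedRate D s τ κ j) (n * lam (testPrice I κ j)) (n * x)
    refine le_of_mul_le_mul_left (a := n) ?_ hn
    rw [mul_add, e, e]
    linarith
  have pk := hmem k k1
  by_cases hcase : lam pc = x ∧ I.1 ≤ pc
  · obtain ⟨hx, hac⟩ := hcase
    rw [max_eq_left hac]
    obtain ⟨j, hj, h2, h3⟩ := exists_testPrice_near hκ ⟨hac, hpc⟩
    have b1 := key j hj
    rw [← hx] at b1
    have b2 := h.lipschitz _ (hmem j hj) _ h.pc_mem
    have b3 : |testPrice I κ j - pc| ≤ gridGap I κ := by rw [abs_le]; constructor <;> linarith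
    have b4 := mul_le_mul_of_nonneg_left b3 hK
    exact (h.lipschitz_inv _ pk _ h.pc_mem).trans (mul_le_mul_of_nonneg_left (by linarith) hK)
  -- In the remaining case all tested rates are at most `x`, so the left end point, itself a test
  -- price, is the best choice.
  · have haI : I.1 ∈ Icc plo phi := ⟨ha, hI.trans hb⟩
    have hfact : max pc I.1 = I.1 ∧ lam I.1 ≤ x := by
      rcases h.clearing with h1 | ⟨h1, h2⟩
      · have hlt : pc < I.1 := by
          by_contra hc; exact hcase ⟨h1, not_lt.1 hc⟩
        exact ⟨max_eq_right hlt.le, h1 ▸ (h.anti.antitoneOn h.pc_mem haI hlt.le)⟩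
      · exact ⟨max_eq_right (h1 ▸ ha), (h.anti.antitoneOn h.pc_mem haI (h1 ▸ ha)).trans h2⟩
    rw [hfact.1]
    have b1 := key 0 hκ
    have e0 : testPrice I κ 0 = I.1 := by simp [testPrice]
    have hkI := testPrice_mem hI k1
    have hlk := h.anti.antitoneOn haI pk hkI.1
    rw [e0, abs_of_nonpos (by linarith [hfact.2]), abs_of_nonpos (by linarith [hfact.2])] at b1
    refine (h.lipschitz_inv _ pk _ haI).trans (mul_le_mul_of_nonneg_left ?_ hK)
    rw [abs_of_nonpos (by linarith)]
    have := mul_nonneg hK hg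
    linarith

/-- Near the optimum the revenue loss is quadratic. -/
theorem revenue_loss_le (h : MarketBounds plo phi x B K Q ε lam pu pc) (hQ : 0 ≤ Q) (hε : 0 < ε)
    (hB : 0 ≤ B)
    {a b p : ℝ} (ha : plo ≤ a) (hb : b ≤ phi) (hpu : a ≤ pu) (hpD : max pu pc ≤ b)
    (hp : p ∈ Icc a b) :
    max pu pc * lam (max pu pc) - (Q + B ^ 2 / ε ^ 2) * (b - a) ^ 2 ≤ p * lam p := by
  have hpm : p ∈ Icc plo phi := ⟨ha.trans hp.1, hp.2.trans hb⟩
  have h1 := h.isMax _ h.max_mem'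
  have hpub := (le_max_left pu pc).trans hpD
  rcases h.le_sq with h2 | h2
  -- If `pu = plo`, the interval reaches from `plo` to beyond `pD ≥ plo + ε`; its length is at least
  -- `ε`, and any bounded loss is quadratic in it.
  · have h3 : ε ≤ b - a := by linarith [h.max_mem.1, h.max_mem'.1]
    have h4 : 1 ≤ (b - a) ^ 2 / ε ^ 2 := by
      rw [one_le_div (by positivity)]; exact pow_le_pow_left₀ hε.le h3 2
    have h5 : 0 ≤ p * lam p := mul_nonneg (h.plo_nonneg.trans hpm.1) (h.nonneg _ hpm)
    have h6 : max pu pc * lam (max pu pc) ≤ B ^ 2 := by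
      rw [sq]
      exact mul_le_mul (h.max_mem'.2.trans h.phi_le) (h.le_bound _ h.max_mem')
        (h.nonneg _ h.max_mem') hB
    have h7 : B ^ 2 ≤ B ^ 2 / ε ^ 2 * (b - a) ^ 2 := by
      rw [div_mul_eq_mul_div, mul_div_assoc]
      exact le_mul_of_one_le_right (by positivity) h4
    have : 0 ≤ Q * (b - a) ^ 2 := by positivity
    linarith
  · have h3 := h2 p hpm
    have h4 : (p - pu) ^ 2 ≤ (b - a) ^ 2 := by
      rw [← sq_abs (p - pu)]
      refine pow_le_pow_left₀ (abs_nonneg _) ?_ 2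
      rw [abs_le]; constructor <;> linarith [hp.1, hp.2]
    have h5 := mul_le_mul_of_nonneg_left h4 hQ
    have : 0 ≤ B ^ 2 / ε ^ 2 * (b - a) ^ 2 := by positivity
    linarith

/-- Prices whose mean is above the optimal one do not, on average, consume too much inventory. -/
theorem sum_lam_le (h : MarketBounds plo phi x B K Q ε lam pu pc) (hQ : 0 ≤ Q)
    {I : ℝ × ℝ} {κ : ℕ} (hκ : 0 < κ) (ha : plo ≤ I.1) (hb : I.2 ≤ phi)
    (hpD : max pu pc ∈ Icc I.1 I.2)
    (hmean : max pu pc - I.1 ≤ (I.2 - I.1) * (1 / 2 - 1 / (2 * κ))) :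
    ∑ j ∈ Finset.range κ, lam (testPrice I κ j) ≤ κ * (x + Q * (I.2 - I.1) ^ 2) := by
  obtain ⟨s, hs, hslope⟩ := h.slope
  have hκ' : (0 : ℝ) < κ := by exact_mod_cast hκ
  set pD := max pu pc with hpDdef
  have hterm : ∀ j ∈ Finset.range κ, lam (testPrice I κ j) ≤
      (x + Q * (I.2 - I.1) ^ 2) - s * (testPrice I κ j - pD) := by
    intro j hj
    have hmem := testPrice_mem (hpD.1.trans hpD.2) (Finset.mem_range.1 hj)
    have h1 := hslope _ ⟨ha.trans hmem.1, hmem.2.trans hb⟩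
    have h2 : (testPrice I κ j - pD) ^ 2 ≤ (I.2 - I.1) ^ 2 := by
      rw [← sq_abs (testPrice I κ j - pD)]
      refine pow_le_pow_left₀ (abs_nonneg _) ?_ 2
      rw [abs_le]; constructor <;> linarith [hmem.1, hmem.2, hpD.1, hpD.2]
    have h3 := mul_le_mul_of_nonneg_left h2 hQ
    have h4 := h.lam_max_le
    linarith
  refine (Finset.sum_le_sum hterm).trans ?_
  rw [Finset.sum_sub_distrib, Finset.sum_const, Finset.card_range, nsmul_eq_mul, ← Finset.mul_sum]
  -- The left end points of `κ` equal parts have the mean `I.1 + (I.2 - I.1) * (1 / 2 - 1 / (2 *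
  -- κ))`. So `hmean` says that the average test price is at least `pD`, and the linear term of the
  -- slope bound may be dropped.
  have hsum : ∀ m : ℕ, ∑ j ∈ Finset.range m, (testPrice I κ j - pD) =
      m * (I.1 - pD) + gridGap I κ * (m * (m - 1) / 2) := by
    intro m
    induction m with
    | zero => simp
    | succ m ih =>
      rw [Finset.sum_range_succ, ih, testPrice]; push_cast; ring
  have hnn : 0 ≤ ∑ j ∈ Finset.range κ, (testPrice I κ j - pD) := by
    rw [hsum]
    have e : gridGap I κ * (κ * (κ - 1) / 2) = κ * ((I.2 - I.1) * (1 / 2 - 1 / (2 * κ))) := by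
      unfold gridGap; field_simp
    rw [e, ← mul_add]
    exact mul_nonneg hκ'.le (by linarith)
  have := mul_nonneg hs hnn
  linarith

end MarketBounds

theorem IsConcentrated.observedRate_sub_le {n L B T : ℝ} {lam P : ℝ → ℝ} {D : ℝ → ℕ}
    (h : IsConcentrated n L B T lam P D) {s τ p : ℝ} {κ j : ℕ} (hn : 0 < n)
    (hs : 0 ≤ s) (hΔ : 0 < τ / κ) (hj : j < κ) (hT : s + τ ≤ T)
    (hL : L ≤ n * B * (τ / κ))
    (hP : ∀ r ∈ Ioc (s + j * (τ / κ)) (s + (j + 1) * (τ / κ)), P r = p) :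
    |observedRate D s τ κ j - n * lam p| ≤ n * (11 * √(L * B / (n * (τ / κ)))) := by
  have hκ' : (0 : ℝ) < κ := by exact_mod_cast (Nat.zero_le j).trans_lt hj
  set Δ := τ / κ with hΔdef
  have hκΔ : κ * Δ = τ := mul_div_cancel₀ _ hκ'.ne'
  have hj' : (j : ℝ) + 1 ≤ κ := by exact_mod_cast hj
  have hle : (j + 1) * Δ ≤ κ * Δ := mul_le_mul_of_nonneg_right hj' hΔ.le
  have hj0 : 0 ≤ (j : ℝ) * Δ := by positivity
  have h1 := h.dev (s + j * Δ) (s + (j + 1) * Δ) p (n * B * Δ) (by linarith) (by linarith)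
    (by linarith) hP (by apply le_of_eq; ring) hL
  have e1 : s + (j + 1) * Δ - (s + j * Δ) = Δ := by ring
  rw [e1] at h1
  have e2 : observedRate D s τ κ j - n * lam p =
      (((D (s + (j + 1) * Δ) : ℝ) - D (s + j * Δ)) - n * Δ * lam p) / Δ := by
    rw [observedRate, ← hΔdef]; field_simp
  rw [e2, abs_div, abs_of_pos hΔ, div_le_iff₀ hΔ]
  refine h1.trans (le_of_eq ?_)
  have e3 : √(L * (n * B * Δ)) = n * Δ * √(L * B / (n * Δ)) := by
    have : L * (n * B * Δ) = (n * Δ) ^ 2 * (L * B / (n * Δ)) := by field_simp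
    rw [this, Real.sqrt_mul (by positivity), Real.sqrt_sq (by positivity)]
  rw [e3]; ring

namespace DPA

/-! ### The learning rounds along a concentrated path -/

/-- A run of the algorithm along the path `D`, in a market with inventory `n x` per unit of time. -/
structure IsRun (A : DPA) (x B K Q ε : ℝ) (lam : ℝ → ℝ) (pu pc : ℝ) (D : ℝ → ℕ) : Prop where
  valid : A.Valid
  B_pos : 0 < B
  K_pos : 0 < K
  Q_pos : 0 < Q
  ε_pos : 0 < ε
  x_nonneg : 0 ≤ x
  target : A.X / A.T = A.n * x
  market : MarketBounds A.plo A.phi x B K Q ε lam pu pc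
  conc : IsConcentrated A.n A.L B A.T lam (A.priceInStock D) D

/-- The market is so large that the rounds of the algorithm work as intended. -/
structure IsLarge (A : DPA) (B K Q ε c R : ℝ) : Prop where
  L_ge : 64 ≤ A.L
  sq_K : 4 * K ^ 2 ≤ √A.L
  sq_Q : 8 * Q ^ 2 ≤ A.L
  mix : K * ε ≤ 2 * (Q * B) * √A.L
  one_le_R : 1 ≤ R
  R_le : R ≤ √A.L
  c_pos : 0 < c
  two_powU : c * 2 ^ A.lastU ≤ 2 * ε
  two_powC : c * 2 ^ A.lastC ≤ 2 * ε
  horizon : A.L ≤ A.n * B * A.T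
  time : A.startU (A.lastU + 1) + A.startC (A.lastC + 1) ≤ A.T
  stepU : ∀ i ≤ A.lastU, A.L ≤ A.n * B * (A.tauU i / A.gridU i)
  kappaU : ∀ i ≤ A.lastU, 6 ≤ A.kappaU i
  gapU : ∀ i ≤ A.lastU, A.L * (B * A.widthU i / A.kappaU i) ≤ ε
  errU : ∀ i ≤ A.lastU, 16 * (Q * B) * (11 * √(A.L * B / (A.n * (A.tauU i / A.gridU i)))) ≤
    A.L * (c * A.widthU i / (2 * A.kappaU i)) ^ 2
  stepC : ∀ i ≤ A.lastC, A.L ≤ A.n * B * (A.tauC i / A.gridC i)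
  kappaC : ∀ i ≤ A.lastC, 6 ≤ A.kappaC i
  gapC : ∀ i ≤ A.lastC, A.L * (B * A.widthC i / A.kappaC i) ≤ ε
  errC : ∀ i ≤ A.lastC, 8 * K * (11 * √(A.L * B / (A.n * (A.tauC i / A.gridC i)))) ≤
    R * √A.L * (c * A.widthC i / (2 * A.kappaC i))

variable {A : DPA} {x B K Q ε c R : ℝ} {lam : ℝ → ℝ} {pu pc : ℝ} {D : ℝ → ℕ}

theorem IsLarge.sqrt_ge (h : A.IsLarge B K Q ε c R) : 8 ≤ √A.L := by
  rw [Real.le_sqrt' (by norm_num)]; linarith [h.L_ge]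

theorem IsLarge.sq_sqrt (h : A.IsLarge B K Q ε c R) : √A.L * √A.L = A.L :=
  Real.mul_self_sqrt (by linarith [h.L_ge])

theorem Valid.widthU_pos (h : A.Valid) (i : ℕ) : 0 < A.widthU i := Real.rpow_pos_of_pos h.n_pos _

theorem Valid.widthC_pos (h : A.Valid) (i : ℕ) : 0 < A.widthC i := Real.rpow_pos_of_pos h.n_pos _

/-- The recursion behind the exponents: the next interval consists of `log n` gaps of the present
grid. -/
theorem Valid.widthU_succ (h : A.Valid) (i : ℕ) :
    A.widthU (i + 1) = A.L * A.widthU i / A.kappaU i := by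
  have hL := h.L_pos
  rw [eq_div_iff (h.kappaU_pos i).ne']
  unfold widthU kappaU
  rw [← mul_assoc, ← Real.rpow_add h.n_pos, mul_comm]
  congr 2
  rw [pow_succ]; ring

theorem Valid.widthC_succ (h : A.Valid) (i : ℕ) :
    A.widthC (i + 1) = A.L * A.widthC i / A.kappaC i := by
  have hL := h.L_pos
  rw [eq_div_iff (h.kappaC_pos i).ne']
  unfold widthC kappaC
  rw [← mul_assoc, ← Real.rpow_add h.n_pos, mul_comm]
  congr 2
  rw [pow_succ]; ring

/-- Bounds for the grid gap of a round in terms of the nominal width. -/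
theorem gridGap_bounds {I : ℝ × ℝ} {κ W B c c' L : ℝ} (hκ : 1 ≤ κ) (hL : 0 ≤ L)
    (hc : c ≤ c') (hc0 : 0 < c)
    (hW : 0 < W) (hlow : c' * W ≤ I.2 - I.1) (hup : I.2 - I.1 ≤ B * W) :
    0 < gridGap I ⌈κ⌉₊ ∧ gridGap I ⌈κ⌉₊ ≤ I.2 - I.1 ∧ gridGap I ⌈κ⌉₊ ≤ B * W / κ ∧
      c * W / (2 * κ) ≤ gridGap I ⌈κ⌉₊ ∧ L * gridGap I ⌈κ⌉₊ ≤ B * (L * W / κ) ∧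
      c' / 2 * (L * W / κ) ≤ L * gridGap I ⌈κ⌉₊ := by
  have h1 := Nat.le_ceil κ
  have h2 := (Nat.ceil_lt_add_one (show 0 ≤ κ by linarith)).le
  have hκ0 : 0 < κ := by linarith
  have hk0 : (0 : ℝ) < ⌈κ⌉₊ := by linarith
  have hw0 : 0 < I.2 - I.1 := lt_of_lt_of_le (mul_pos (hc0.trans_le hc) hW) hlow
  have hcW := mul_le_mul_of_nonneg_right hc hW.le
  have a1 : gridGap I ⌈κ⌉₊ ≤ B * W / κ := by
    unfold gridGap
    exact div_le_div₀ (hw0.le.trans hup) hup hκ0 h1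
  have a2 : c' * W / (2 * κ) ≤ gridGap I ⌈κ⌉₊ := by
    unfold gridGap
    exact div_le_div₀ hw0.le hlow hk0 (by linarith)
  refine ⟨div_pos hw0 hk0, div_le_self hw0.le (by linarith), a1, le_trans ?_ a2, ?_, ?_⟩
  · exact div_le_div_of_nonneg_right hcW (by linarith)
  · calc L * gridGap I ⌈κ⌉₊ ≤ L * (B * W / κ) := mul_le_mul_of_nonneg_left a1 hL
      _ = _ := by ring
  · calc c' / 2 * (L * W / κ) = L * (c' * W / (2 * κ)) := by field_simp
      _ ≤ _ := mul_le_mul_of_nonneg_left a2 hL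

/-- The state of Step 2 at the beginning of round `i`. -/
structure StateU (A : DPA) (x B Q ε : ℝ) (lam : ℝ → ℝ) (pu pc : ℝ) (D : ℝ → ℕ) (i : ℕ) : Prop where
  left : (A.intervalU D i).1 ≤ pu
  right : max pu pc ≤ (A.intervalU D i).2
  lower : 2 * ε / 2 ^ i * A.widthU i ≤ (A.intervalU D i).2 - (A.intervalU D i).1
  upper : (A.intervalU D i).2 - (A.intervalU D i).1 ≤ B * A.widthU i
  mean : ∑ j ∈ Finset.range (A.gridU i), lam (testPrice (A.intervalU D i) (A.gridU i) j) ≤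
    A.gridU i * (x + (Q + B / ε ^ 2) * ((A.intervalU D i).2 - (A.intervalU D i).1) ^ 2)

/-- The average loss per unit of time in round `i` of Step 2. -/
noncomputable def lossU (A : DPA) (B Q ε : ℝ) (i : ℕ) : ℝ :=
  (Q + B ^ 2 / ε ^ 2 + B / ε ^ 2 + (1 + B) / (16 * (Q * B))) * (1 + A.L) * B ^ 2 * A.widthU i ^ 2

theorem IsRun.width_le (h : A.IsRun x B K Q ε lam pu pc D) : 2 * ε ≤ A.phi - A.plo ∧
    A.phi - A.plo ≤ B := by
  have h1 := h.market.max_mem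
  have h2 := h.market.phi_le
  have h3 := h.market.plo_nonneg
  constructor
  · linarith [h1.1, h1.2]
  · linarith

theorem IsRun.stateU_zero (h : A.IsRun x B K Q ε lam pu pc D) :
    A.StateU x B Q ε lam pu pc D 0 := by
  obtain ⟨h1, h2⟩ := h.width_le
  have hw : A.widthU 0 = 1 := by simp [widthU]
  have hε := h.ε_pos
  have hB := h.B_pos
  refine ⟨h.market.pu_mem.1, h.market.max_mem'.2, by rw [hw, pow_zero, div_one, mul_one]; exact h1,
      by rw [hw, mul_one]; exact h2, ?_⟩
  have hterm : ∀ j ∈ Finset.range (A.gridU 0), lam (testPrice (A.intervalU D 0) (A.gridU 0) j) ≤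
      x + (Q + B / ε ^ 2) * ((A.intervalU D 0).2 - (A.intervalU D 0).1) ^ 2 := by
    intro j hj
    have hI := h.valid.isPriceInterval_intervalU D 0
    have hm := hI.subset (testPrice_mem hI.le (Finset.mem_range.1 hj))
    refine (h.market.le_bound _ hm).trans ?_
    -- The first interval is not placed around `pD`, but it is longer than `ε`, so the trivial bound
    -- `B` on the demand rate is good enough. This is the origin of the term `B / ε ^ 2`.
    have h3 : 1 ≤ (A.phi - A.plo) ^ 2 / ε ^ 2 := by
      rw [one_le_div (by positivity)]
      exact pow_le_pow_left₀ hε.le (by linarith) 2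
    have h4 : B ≤ B / ε ^ 2 * (A.phi - A.plo) ^ 2 := by
      rw [div_mul_eq_mul_div, mul_div_assoc]
      exact le_mul_of_one_le_right hB.le h3
    have h5 : 0 ≤ Q * (A.phi - A.plo) ^ 2 := mul_nonneg h.Q_pos.le (sq_nonneg _)
    have h6 := h.x_nonneg
    change B ≤ x + (Q + B / ε ^ 2) * (A.phi - A.plo) ^ 2
    linarith
  refine (Finset.sum_le_sum hterm).trans ?_
  rw [Finset.sum_const, Finset.card_range, nsmul_eq_mul]

theorem div_two_pow_le {c ε : ℝ} {i m : ℕ} (hε : 0 < ε) (hi : i ≤ m) (h : c * 2 ^ m ≤ 2 * ε) :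
    c ≤ 2 * ε / 2 ^ i := by
  rw [le_div_iff₀ (by positivity)]
  rcases le_or_gt c 0 with hc | hc
  · have : c * 2 ^ i ≤ 0 := mul_nonpos_of_nonpos_of_nonneg hc (by positivity)
    linarith
  · exact (mul_le_mul_of_nonneg_left (pow_le_pow_right₀ (by norm_num) hi) hc.le).trans h

/-- One round of Step 2. -/
theorem IsRun.roundU (h : A.IsRun x B K Q ε lam pu pc D) (hl : A.IsLarge B K Q ε c R) {i : ℕ}
    (hi : i ≤ A.lastU) (hno : ∀ k < i, ¬ A.Breaks D k) (hs : A.StateU x B Q ε lam pu pc D i) :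
    Ledger A.n (max pu pc * lam (max pu pc)) x A.T (A.priceInStock D) D (A.startU i)
      (A.startU (i + 1)) (A.tauU i * A.lossU B Q ε i) ∧
    |A.hatUOn D i (A.intervalU D i) - pu| ≤ √A.L / 2 * gridGap (A.intervalU D i) (A.gridU i) ∧
    |A.hatCOn D i (A.intervalU D i) - max pc (A.intervalU D i).1| ≤
      √A.L / 2 * gridGap (A.intervalU D i) (A.gridU i) := by
  have hv := h.valid
  have hm := h.market
  have hB := h.B_pos
  have hK := h.K_pos
  have hQ := h.Q_pos
  have hε := h.ε_pos
  have hn := hv.n_pos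
  have hL := hv.L_pos
  have hI := hv.isPriceInterval_intervalU D i
  have hκ6 := hl.kappaU i hi
  set I := A.intervalU D i with hIdef
  obtain ⟨g0, gw, gκ, gc, -, -⟩ := gridGap_bounds (I := I) (κ := A.kappaU i) (by linarith)
    hL.le (div_two_pow_le hε hi hl.two_powU) hl.c_pos (hv.widthU_pos i) hs.lower hs.upper
  have hgrid : ⌈A.kappaU i⌉₊ = A.gridU i := rfl
  rw [hgrid] at g0 gw gκ gc
  set g := gridGap I (A.gridU i) with hg
  set err := 11 * √(A.L * B / (A.n * (A.tauU i / A.gridU i))) with herr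
  have herr0 : 0 ≤ err := by positivity
  have hT : A.startU i + A.tauU i ≤ A.T := by
    rw [← startU_succ]
    have := hv.startU_strictMono.monotone (show i + 1 ≤ A.lastU + 1 by omega)
    have := hl.time
    have := hv.startC_nonneg (A.lastC + 1)
    linarith
  have hP : ∀ j < A.gridU i, ∀ r ∈ Ioc (A.startU i + j * (A.tauU i / A.gridU i))
      (A.startU i + (j + 1) * (A.tauU i / A.gridU i)),
      A.priceInStock D r = testPrice I (A.gridU i) j :=
    fun j hj r hr => hv.priceInStock_roundU hi hno hj hr
  have hobs : ∀ j < A.gridU i, |observedRate D (A.startU i) (A.tauU i) (A.gridU i) j -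
      A.n * lam (testPrice I (A.gridU i) j)| ≤ A.n * err := fun j hj =>
    h.conc.observedRate_sub_le hn (hv.startU_nonneg i) (hv.stepU_pos i) hj hT (hl.stepU i hi)
      (hP j hj)
  -- the estimation error is small compared with the grid gap
  have e1 : 16 * (Q * B) * err ≤ A.L * g ^ 2 := by
    refine (hl.errU i hi).trans (mul_le_mul_of_nonneg_left ?_ hL.le)
    have := hl.c_pos
    have := hv.widthU_pos i
    have := hv.kappaU_pos i
    exact pow_le_pow_left₀ (by positivity) gc 2
  have hLg : A.L * g ≤ ε :=
    (mul_le_mul_of_nonneg_left gκ hL.le).trans (hl.gapU i hi)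
  have hQB : 0 < Q * B := mul_pos hQ hB
  have hsq := hl.sq_sqrt
  have hpuI : pu ∈ Icc I.1 I.2 := ⟨hs.left, (le_max_left _ _).trans hs.right⟩
  have hpDI : max pu pc ∈ Icc I.1 I.2 := ⟨hs.left.trans (le_max_left _ _), hs.right⟩
  refine ⟨?_, ?_, ?_⟩
  · rw [startU_succ]
    have hw0 : 0 < I.2 - I.1 := g0.trans_le gw
    have hwW : (I.2 - I.1) ^ 2 ≤ (B * A.widthU i) ^ 2 := pow_le_pow_left₀ hw0.le hs.upper 2
    have herrw : err ≤ A.L / (16 * (Q * B)) * (I.2 - I.1) ^ 2 := by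
      rw [div_mul_eq_mul_div, le_div_iff₀ (by positivity)]
      have := pow_le_pow_left₀ g0.le gw 2
      have := mul_le_mul_of_nonneg_left this hL.le
      linarith
    set C1 := Q + B ^ 2 / ε ^ 2 + B / ε ^ 2 with hC1
    have hC10 : 0 ≤ C1 := by positivity
    have hbound : C1 * (I.2 - I.1) ^ 2 + (1 + B) * err ≤ A.lossU B Q ε i := by
      have s1 : C1 * (I.2 - I.1) ^ 2 ≤ C1 * (1 + A.L) * (B * A.widthU i) ^ 2 :=
        calc C1 * (I.2 - I.1) ^ 2 ≤ C1 * (B * A.widthU i) ^ 2 :=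
              mul_le_mul_of_nonneg_left hwW hC10
          _ ≤ _ := by
              refine mul_le_mul_of_nonneg_right ?_ (sq_nonneg _)
              exact le_mul_of_one_le_right hC10 (by linarith)
      have s2 : (1 + B) * err ≤ (1 + B) / (16 * (Q * B)) * (1 + A.L) * (B * A.widthU i) ^ 2 :=
        calc (1 + B) * err ≤ (1 + B) * (A.L / (16 * (Q * B)) * (I.2 - I.1) ^ 2) :=
              mul_le_mul_of_nonneg_left herrw (by linarith)
          _ = (1 + B) / (16 * (Q * B)) * A.L * (I.2 - I.1) ^ 2 := by ring
          _ ≤ (1 + B) / (16 * (Q * B)) * (1 + A.L) * (I.2 - I.1) ^ 2 := by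
              refine mul_le_mul_of_nonneg_right ?_ (sq_nonneg _)
              exact mul_le_mul_of_nonneg_left (by linarith) (by positivity)
          _ ≤ _ := mul_le_mul_of_nonneg_left hwW (by positivity)
      unfold lossU
      rw [← hC1]
      nlinarith [s1, s2]
    refine ledger_round h.conc.profile hn.le (hv.startU_nonneg i) (hv.tauU_pos i) (hv.gridU_pos i)
      hT hP (B := B) (err := err) (lam := lam) (e1 := (Q + B ^ 2 / ε ^ 2) * (I.2 - I.1) ^ 2)
      (e2 := (Q + B / ε ^ 2) * (I.2 - I.1) ^ 2) (fun j hj => ?_) hobs herr0 (fun j hj => ?_) hs.mean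
      ?_ ?_
    · have := hI.subset (testPrice_mem hI.le hj)
      exact ⟨hm.plo_nonneg.trans this.1, this.2.trans hm.phi_le⟩
    · exact hm.revenue_loss_le hQ.le hε hB.le hI.left hI.right hs.left hs.right
        (testPrice_mem hI.le hj)
    · have : 0 ≤ B / ε ^ 2 * (I.2 - I.1) ^ 2 := by positivity
      rw [hC1] at hbound
      linarith
    · have : 0 ≤ B ^ 2 / ε ^ 2 * (I.2 - I.1) ^ 2 := by positivity
      have : 0 ≤ B * err := by positivity
      rw [hC1] at hbound
      linarith
  · have h1 := hm.bestRevenuePrice_near hQ.le (hv.gridU_pos i) hI.left hI.right hpuI hn hobs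
    refine abs_le_of_sq_le_sq (h1.trans ?_) (by positivity)
    -- The admissible squared distance `L / 4 * g ^ 2` is shared equally between the grid error, by
    -- `sq_Q`, and the observation error, by `e1`.
    have h2 : Q ^ 2 * g ^ 2 ≤ A.L / 8 * g ^ 2 :=
      mul_le_mul_of_nonneg_right (by linarith [hl.sq_Q]) (sq_nonneg _)
    have h3 : (√A.L / 2 * g) ^ 2 = A.L / 4 * g ^ 2 := by
      rw [mul_pow, div_pow, Real.sq_sqrt hL.le]; ring
    rw [h3]
    linarith
  · have h1 := hm.bestInventoryPrice_near hK.le (hv.gridU_pos i) hI.left hI.le hI.right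
      ((le_max_right pu pc).trans hs.right) hn hobs
    rw [← h.target] at h1
    refine h1.trans ?_
    have h2 : K ^ 2 * g ≤ √A.L / 4 * g :=
      mul_le_mul_of_nonneg_right (by linarith [hl.sq_K]) g0.le
    -- The accuracy required for `pu` is more than enough for `pc`: as `L * g ≤ ε`, an error of
    -- order `L * g ^ 2` is of order `ε * g`, which `mix` compares with `√L * g`.
    have h3 : 2 * K * err ≤ √A.L / 4 * g := by
      have a1 : 16 * (Q * B) * err ≤ ε * g := by
        have := mul_le_mul_of_nonneg_right hLg g0.le
        linarith
      have a2 : K * (16 * (Q * B) * err) ≤ K * (ε * g) := mul_le_mul_of_nonneg_left a1 hK.le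
      have a3 := mul_le_mul_of_nonneg_right hl.mix g0.le
      have a4 : (Q * B) * (2 * K * err) ≤ (Q * B) * (√A.L / 4 * g) := by linarith
      exact le_of_mul_le_mul_left a4 hQB
    linarith

/-- The consequences of a round of Step 2 for the next interval. -/
theorem IsRun.roundU_hat (h : A.IsRun x B K Q ε lam pu pc D) (hl : A.IsLarge B K Q ε c R) {i : ℕ}
    (hi : i ≤ A.lastU) (hno : ∀ k < i, ¬ A.Breaks D k) (hs : A.StateU x B Q ε lam pu pc D i) :
    (A.Breaks D i → pu < pc) ∧ (¬ A.Breaks D i →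
      |A.hatOn D i (A.intervalU D i) - max pu pc| ≤
        √A.L / 2 * gridGap (A.intervalU D i) (A.gridU i) ∧
      A.hatOn D i (A.intervalU D i) - 5 / 2 * √A.L * gridGap (A.intervalU D i) (A.gridU i) ≤ pu) := by
  obtain ⟨-, hu, hc⟩ := h.roundU hl hi hno hs
  have hg := (h.valid.isPriceInterval_intervalU D i).gridGap_nonneg (A.gridU i)
  have hleft := hs.left
  unfold Breaks hatOn
  set I := A.intervalU D i
  set g := gridGap I (A.gridU i)
  set U := A.hatUOn D i I
  set C := A.hatCOn D i I
  have hℓg : 0 ≤ √A.L * g := mul_nonneg (Real.sqrt_nonneg _) hg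
  have hu' := abs_le.1 hu
  have hc' := abs_le.1 hc
  -- If `pc ≤ pu`, the estimate of `pc` exceeds that of `pu` by at most `√L * g`, half the
  -- threshold, so a transition is excluded. Without transition the larger estimate is at most `pu +
  -- (1 / 2 + 2) * √L * g`.
  refine ⟨fun hb => ?_, fun hb => ⟨?_, ?_⟩⟩
  · by_contra hle
    push Not at hle
    have : max pc I.1 ≤ pu := max_le hle hleft
    linarith [hu'.1, hc'.2]
  · have e : max pu pc = max (max pc I.1) pu := by
      rw [max_comm pc, max_assoc, max_comm I.1, max_eq_left (hleft.trans (le_max_right pc pu)),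
        max_comm]
    rw [e]
    exact (abs_max_sub_max_le_max _ _ _ _).trans (max_le hc hu)
  · push Not at hb
    rcases le_total C U with h1 | h1
    · rw [max_eq_right h1]; linarith [hu'.2]
    · rw [max_eq_left h1]; linarith [hu'.2]

/-- Truncation is inactive, since `L * g ≤ ε` while `pD` keeps the distance `ε` from both ends. With
`√L ≥ 8` the left part `L / 3 * g` exceeds `5 / 2 * √L * g`, which keeps `pu`; and `√L / 2 + L / 3 ≤
L * (1 / 2 - 1 / 12)`, together with `κ ≥ 6`, puts the average test price above `pD`. -/
theorem IsRun.stateU_succ (h : A.IsRun x B K Q ε lam pu pc D) (hl : A.IsLarge B K Q ε c R) {i : ℕ}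
    (hi : i + 1 ≤ A.lastU) (hno : ∀ k < i + 1, ¬ A.Breaks D k)
    (hs : A.StateU x B Q ε lam pu pc D i) : A.StateU x B Q ε lam pu pc D (i + 1) := by
  have hv := h.valid
  have hm := h.market
  have hL := hv.L_pos
  obtain ⟨h1, h2⟩ := (h.roundU_hat hl (by omega) (fun k hk => hno k (by omega)) hs).2
    (hno i (by omega))
  have hI := hv.isPriceInterval_intervalU D i
  have hκ6 := hl.kappaU i (by omega)
  obtain ⟨g0, gw, gκ, gc, gup, glow⟩ := gridGap_bounds (I := A.intervalU D i) (κ := A.kappaU i)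
    (by linarith) hL.le (div_two_pow_le h.ε_pos (by omega) hl.two_powU) hl.c_pos (hv.widthU_pos i)
    hs.lower hs.upper
  have hgrid : ⌈A.kappaU i⌉₊ = A.gridU i := rfl
  rw [hgrid] at g0 gw gκ gc gup glow
  rw [← hv.widthU_succ] at gup glow
  have hLg : A.L * gridGap (A.intervalU D i) (A.gridU i) ≤ ε :=
    (mul_le_mul_of_nonneg_left gκ hL.le).trans (hl.gapU i (by omega))
  have hnext : A.intervalU D (i + 1) = A.truncate
      (A.hatOn D i (A.intervalU D i) - A.L / 3 * gridGap (A.intervalU D i) (A.gridU i))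
      (A.hatOn D i (A.intervalU D i) + 2 * A.L / 3 * gridGap (A.intervalU D i) (A.gridU i)) := rfl
  set g := gridGap (A.intervalU D i) (A.gridU i) with hg
  set p := A.hatOn D i (A.intervalU D i) with hp
  have hℓ : 8 * (√A.L * g) ≤ A.L * g := by
    have := mul_le_mul_of_nonneg_right (mul_le_mul_of_nonneg_right hl.sqrt_ge
      (Real.sqrt_nonneg A.L)) g0.le
    rw [hl.sq_sqrt] at this; linarith
  have hℓ0 : 0 < √A.L * g := mul_pos (by linarith [hl.sqrt_ge]) g0
  have h1' := abs_le.1 h1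
  have hD := hm.max_mem
  have hI1 : (A.intervalU D (i + 1)).1 = p - A.L / 3 * g := by
    rw [hnext]; exact max_eq_right (by linarith [hD.1, h1'.1])
  have hI2 : (A.intervalU D (i + 1)).2 = p + 2 * A.L / 3 * g := by
    rw [hnext]; exact min_eq_right (by linarith [hD.2, h1'.2])
  have hwidth : (A.intervalU D (i + 1)).2 - (A.intervalU D (i + 1)).1 = A.L * g := by
    rw [hI1, hI2]; ring
  have hleft : (A.intervalU D (i + 1)).1 ≤ pu := by rw [hI1]; linarith
  have hright : max pu pc ≤ (A.intervalU D (i + 1)).2 := by rw [hI2]; linarith [h1'.1]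
  refine ⟨hleft, hright, ?_, ?_, ?_⟩
  · rw [hwidth]
    refine le_trans (le_of_eq ?_) glow
    rw [pow_succ]; field_simp
  · rw [hwidth]; exact gup
  · have hI' := hv.isPriceInterval_intervalU D (i + 1)
    have hmean := hm.sum_lam_le h.Q_pos.le (hv.gridU_pos (i + 1)) hI'.left hI'.right
      ⟨hleft.trans (le_max_left _ _), hright⟩ (by
        have hκ : (6 : ℝ) ≤ A.gridU (i + 1) := (hl.kappaU _ hi).trans (Nat.le_ceil _)
        have h3 : 1 / (2 * (A.gridU (i + 1) : ℝ)) ≤ 1 / 12 :=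
          one_div_le_one_div_of_le (by norm_num) (by linarith)
        rw [hwidth, hI1]
        have h4 := mul_le_mul_of_nonneg_left h3 (show 0 ≤ A.L * g by linarith)
        linarith [h1'.1])
    refine hmean.trans (mul_le_mul_of_nonneg_left ?_ (Nat.cast_nonneg _))
    have : 0 ≤ B / ε ^ 2 * ((A.intervalU D (i + 1)).2 - (A.intervalU D (i + 1)).1) ^ 2 := by
      have := h.B_pos; positivity
    linarith

theorem IsRun.stateU (h : A.IsRun x B K Q ε lam pu pc D) (hl : A.IsLarge B K Q ε c R) {i : ℕ}
    (hi : i ≤ A.lastU) (hno : ∀ k < i, ¬ A.Breaks D k) : A.StateU x B Q ε lam pu pc D i := by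
  induction i with
  | zero => exact h.stateU_zero
  | succ i ih =>
    exact h.stateU_succ hl hi hno (ih (by omega) fun k hk => hno k (by omega))

/-- The account of Step 2 up to the end of round `i`. -/
theorem IsRun.ledgerU (h : A.IsRun x B K Q ε lam pu pc D) (hl : A.IsLarge B K Q ε c R) {i : ℕ}
    (hi : i ≤ A.lastU) (hno : ∀ k < i, ¬ A.Breaks D k) :
    Ledger A.n (max pu pc * lam (max pu pc)) x A.T (A.priceInStock D) D 0 (A.startU (i + 1))
      (∑ k ∈ Finset.range (i + 1), A.tauU k * A.lossU B Q ε k) := by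
  have hv := h.valid
  have hT : A.startU (i + 1) ≤ A.T := by
    have := hv.startU_strictMono.monotone (show i + 1 ≤ A.lastU + 1 by omega)
    have := hl.time
    have := hv.startC_nonneg (A.lastC + 1)
    linarith
  have := Ledger.sum h.conc.profile (n := A.n) (f := max pu pc * lam (max pu pc)) (x := x)
    (P := A.priceInStock D) (s := 0) (b := A.tauU) (e := fun k => A.tauU k * A.lossU B Q ε k)
    (m := i + 1) le_rfl (by rw [zero_add]; exact hT) (fun k => (hv.tauU_pos k).le)
    (fun k hk => by
      rw [zero_add, zero_add]
      have hno' : ∀ j < k, ¬ A.Breaks D j := fun j hj => hno j (by omega)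
      exact (h.roundU hl (by omega) hno' (h.stateU hl (by omega) hno')).1)
  rwa [zero_add] at this

/-- A final period with a constant price. -/
theorem IsRun.ledger_final (h : A.IsRun x B K Q ε lam pu pc D) (hl : A.IsLarge B K Q ε c R)
    {s p e0 : ℝ} (hs : 0 ≤ s) (hsT : s ≤ A.T) (hp : p ∈ Icc A.plo A.phi)
    (hP : ∀ r ∈ Ioc s A.T, A.priceInStock D r = p) (he0 : 0 ≤ e0)
    (hf : max pu pc * lam (max pu pc) - e0 ≤ p * lam p) (hx : lam p ≤ x + e0) :
    Ledger A.n (max pu pc * lam (max pu pc)) x A.T (A.priceInStock D) D s A.T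
      (A.T * e0 + (B + 1) * (11 * √(A.L * (B * A.T) / A.n))) := by
  have hn := h.valid.n_pos
  have hB := h.B_pos
  have hT := h.valid.T_pos
  have hdev := h.conc.dev s A.T p (A.n * B * A.T) hs hsT le_rfl hP
    (mul_le_mul_of_nonneg_left (by linarith) (by positivity)) hl.horizon
  refine ledger_const h.conc.profile hn.le hs hsT le_rfl hP (h.market.plo_nonneg.trans hp.1)
    (hp.2.trans h.market.phi_le) (hdev.trans (le_of_eq ?_)) (by positivity) he0 hf hx le_rfl
  have : A.L * (A.n * B * A.T) = (A.n : ℝ) ^ 2 * (A.L * (B * A.T) / A.n) := by field_simp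
  rw [this, Real.sqrt_mul (by positivity), Real.sqrt_sq hn.le]; ring

/-- The final price lies between `pD` and `pu + 5 * √L * g`. The lower bound keeps the demand rate
below `x`; the upper one makes the revenue loss at most `25 * Q * L * g ^ 2`. -/
theorem IsRun.ledger_finalU (h : A.IsRun x B K Q ε lam pu pc D) (hl : A.IsLarge B K Q ε c R)
    (hno : ∀ k ≤ A.lastU, ¬ A.Breaks D k) :
    Ledger A.n (max pu pc * lam (max pu pc)) x A.T (A.priceInStock D) D 0 A.T
      (∑ k ∈ Finset.range (A.lastU + 1), A.tauU k * A.lossU B Q ε k +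
        (A.T * (25 * Q * (A.L * (B * A.widthU A.lastU / A.kappaU A.lastU) ^ 2)) +
          (B + 1) * (11 * √(A.L * (B * A.T) / A.n)))) := by
  have hv := h.valid
  have hm := h.market
  have hL := hv.L_pos
  have hQ := h.Q_pos
  have hno' : ∀ k < A.lastU, ¬ A.Breaks D k := fun k hk => hno k hk.le
  have hs := h.stateU hl le_rfl hno'
  have h1 := h.ledgerU hl le_rfl hno'
  refine h1.trans h.conc.profile ?_
  obtain ⟨h2, h3⟩ := (h.roundU_hat hl le_rfl hno' hs).2 (hno _ le_rfl)
  have hI := hv.isPriceInterval_intervalU D A.lastU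
  obtain ⟨g0, gw, gκ, gc, -, -⟩ := gridGap_bounds (I := A.intervalU D A.lastU)
    (κ := A.kappaU A.lastU)
    (by linarith [hl.kappaU _ le_rfl]) hL.le (div_two_pow_le h.ε_pos le_rfl hl.two_powU) hl.c_pos
    (hv.widthU_pos _) hs.lower hs.upper
  have hgrid : ⌈A.kappaU A.lastU⌉₊ = A.gridU A.lastU := rfl
  rw [hgrid] at g0 gw gκ gc
  have hLg : A.L * gridGap (A.intervalU D A.lastU) (A.gridU A.lastU) ≤ ε :=
    (mul_le_mul_of_nonneg_left gκ hL.le).trans (hl.gapU _ le_rfl)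
  have hfin : A.finalU D = min A.phi (A.hatOn D A.lastU (A.intervalU D A.lastU) +
    2 * √A.L * gridGap (A.intervalU D A.lastU) (A.gridU A.lastU)) := rfl
  set g := gridGap (A.intervalU D A.lastU) (A.gridU A.lastU) with hg
  set p := A.hatOn D A.lastU (A.intervalU D A.lastU) with hp
  have hℓ : 8 * (√A.L * g) ≤ A.L * g := by
    have := mul_le_mul_of_nonneg_right (mul_le_mul_of_nonneg_right hl.sqrt_ge
      (Real.sqrt_nonneg A.L)) g0.le
    rw [hl.sq_sqrt] at this; linarith
  have hℓ0 : 0 < √A.L * g := mul_pos (by linarith [hl.sqrt_ge]) g0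
  have h2' := abs_le.1 h2
  have hD := hm.max_mem
  have hfD : max pu pc ≤ A.finalU D := by
    rw [hfin]; exact le_min hm.max_mem'.2 (by linarith [h2'.1])
  have hfu : A.finalU D ≤ pu + 5 * (√A.L * g) := by
    rw [hfin]; exact (min_le_right _ _).trans (by linarith)
  have hpumax := le_max_left pu pc
  have hE : 25 * Q * (A.L * g ^ 2) ≤
      25 * Q * (A.L * (B * A.widthU A.lastU / A.kappaU A.lastU) ^ 2) :=
    mul_le_mul_of_nonneg_left (mul_le_mul_of_nonneg_left (pow_le_pow_left₀ g0.le gκ 2) hL.le)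
      (by positivity)
  have hE0 : 0 ≤ 25 * Q * (A.L * g ^ 2) := by positivity
  refine h.ledger_final hl (hv.startU_nonneg _) h1.le_end (hv.finalU_mem D)
    (fun r hr => priceInStock_finalU hno hr.1) (hE0.trans hE) ?_ ?_
  · refine le_trans (sub_le_sub_left hE _) ?_
    rcases hm.le_sq with h4 | h4
    -- Without transition `pD` is within `3 * √L * g < ε` of `pu`, so `pu` cannot be `plo`.
    · exfalso
      linarith [hD.1, h2'.1]
    · have h5 := h4 _ (hv.finalU_mem D)
      have h6 := hm.isMax _ hm.max_mem'
      have h7 : (A.finalU D - pu) ^ 2 ≤ (5 * (√A.L * g)) ^ 2 :=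
        pow_le_pow_left₀ (by linarith) (by linarith) 2
      have h8 : (5 * (√A.L * g)) ^ 2 = 25 * (A.L * g ^ 2) := by
        rw [mul_pow, mul_pow, Real.sq_sqrt hL.le]; ring
      rw [h8] at h7
      have := mul_le_mul_of_nonneg_left h7 hQ.le
      linarith
  · have h4 := hm.anti.antitoneOn hm.max_mem' (hv.finalU_mem D) hfD
    linarith [hm.lam_max_le]

/-! Step 3. -/

/-- The state of Step 3 at the beginning of round `i`. -/
structure StateC (A : DPA) (B ε pc : ℝ) (D : ℝ → ℕ) (s₀ : ℝ) (i : ℕ) : Prop where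
  left : (A.intervalC D s₀ i).1 ≤ pc
  right : pc ≤ (A.intervalC D s₀ i).2
  lower : 2 * ε / 2 ^ i * A.widthC i ≤ (A.intervalC D s₀ i).2 - (A.intervalC D s₀ i).1
  upper : (A.intervalC D s₀ i).2 - (A.intervalC D s₀ i).1 ≤ B * A.widthC i

/-- The average loss per unit of time in round `i` of Step 3. -/
noncomputable def lossC (A : DPA) (B K R : ℝ) (i : ℕ) : ℝ :=
  (K + (1 + B) * R / (8 * K)) * (1 + √A.L) * B * A.widthC i

theorem IsRun.lam_pc_le (h : A.IsRun x B K Q ε lam pu pc D) : lam pc ≤ x := by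
  rcases h.market.clearing with h1 | h1
  · exact h1.le
  · exact h1.2

/-- One round of Step 3. -/
theorem IsRun.roundC (h : A.IsRun x B K Q ε lam pu pc D) (hl : A.IsLarge B K Q ε c R)
    (hlt : pu < pc) {i k : ℕ}
    (hi : i ≤ A.lastU) (hb : A.Breaks D i) (hno : ∀ k < i, ¬ A.Breaks D k) (hk : k ≤ A.lastC)
    (hs : A.StateC B ε pc D (A.startU (i + 1)) k) :
    Ledger A.n (max pu pc * lam (max pu pc)) x A.T (A.priceInStock D) D
      (A.startU (i + 1) + A.startC k) (A.startU (i + 1) + A.startC (k + 1))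
      (A.tauC k * A.lossC B K R k) ∧
    |A.hatQOn D (A.startU (i + 1)) k (A.intervalC D (A.startU (i + 1)) k) - pc| ≤
      R * √A.L / 2 * gridGap (A.intervalC D (A.startU (i + 1)) k) (A.gridC k) := by
  have hv := h.valid
  have hm := h.market
  have hB := h.B_pos
  have hK := h.K_pos
  have hε := h.ε_pos
  have hn := hv.n_pos
  have hL := hv.L_pos
  set s₀ := A.startU (i + 1) with hs₀
  have hI := hv.isPriceInterval_intervalC D s₀ k
  have hκ6 := hl.kappaC k hk
  set I := A.intervalC D s₀ k with hIdef
  obtain ⟨g0, gw, gκ, gc, -, -⟩ := gridGap_bounds (I := I) (κ := A.kappaC k) (by linarith)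
    hL.le (div_two_pow_le hε hk hl.two_powC) hl.c_pos (hv.widthC_pos k) hs.lower hs.upper
  have hgrid : ⌈A.kappaC k⌉₊ = A.gridC k := rfl
  rw [hgrid] at g0 gw gκ gc
  set g := gridGap I (A.gridC k) with hg
  have hR : 0 ≤ R := zero_le_one.trans hl.one_le_R
  set err := 11 * √(A.L * B / (A.n * (A.tauC k / A.gridC k))) with herr
  have herr0 : 0 ≤ err := by positivity
  have hs0 : 0 ≤ s₀ + A.startC k := add_nonneg (hv.startU_nonneg _) (hv.startC_nonneg k)
  have hT : s₀ + A.startC k + A.tauC k ≤ A.T := by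
    rw [add_assoc, ← startC_succ]
    have := hv.startU_strictMono.monotone (show i + 1 ≤ A.lastU + 1 by omega)
    have := hv.startC_strictMono.monotone (show k + 1 ≤ A.lastC + 1 by omega)
    have := hl.time
    linarith
  have hP : ∀ j < A.gridC k, ∀ r ∈ Ioc (s₀ + A.startC k + j * (A.tauC k / A.gridC k))
      (s₀ + A.startC k + (j + 1) * (A.tauC k / A.gridC k)),
      A.priceInStock D r = testPrice I (A.gridC k) j :=
    fun j hj r hr => hv.priceInStock_roundC hi hb hno hk hj hr
  have hobs : ∀ j < A.gridC k, |observedRate D (s₀ + A.startC k) (A.tauC k) (A.gridC k) j -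
      A.n * lam (testPrice I (A.gridC k) j)| ≤ A.n * err := fun j hj =>
    h.conc.observedRate_sub_le hn hs0 (hv.stepC_pos k) hj hT (hl.stepC k hk) (hP j hj)
  -- In contrast to Step 2, the observation error may be a large multiple of `√L * g`; the constant
  -- `R` absorbs the factor.
  have e1 : 8 * K * err ≤ R * √A.L * g :=
    (hl.errC k hk).trans (mul_le_mul_of_nonneg_left gc (mul_nonneg hR (Real.sqrt_nonneg _)))
  have hmax : max pu pc = pc := max_eq_right hlt.le
  refine ⟨?_, ?_⟩
  · rw [startC_succ, ← add_assoc]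
    have hw0 : 0 < I.2 - I.1 := g0.trans_le gw
    have herrw : err ≤ R * √A.L / (8 * K) * (I.2 - I.1) := by
      rw [div_mul_eq_mul_div, le_div_iff₀ (by positivity)]
      have := mul_le_mul_of_nonneg_left gw (mul_nonneg hR (Real.sqrt_nonneg A.L))
      linarith
    have hℓ0 : 0 ≤ √A.L := Real.sqrt_nonneg _
    have hbound : K * (I.2 - I.1) + (1 + B) * err ≤ A.lossC B K R k := by
      have s1 : K * (I.2 - I.1) ≤ K * (1 + √A.L) * (B * A.widthC k) :=
        calc K * (I.2 - I.1) ≤ K * (B * A.widthC k) := mul_le_mul_of_nonneg_left hs.upper hK.le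
          _ ≤ _ := by
              refine mul_le_mul_of_nonneg_right ?_ (hw0.le.trans hs.upper)
              exact le_mul_of_one_le_right hK.le (by linarith)
      have s2 : (1 + B) * err ≤ (1 + B) * R / (8 * K) * (1 + √A.L) * (B * A.widthC k) :=
        calc (1 + B) * err ≤ (1 + B) * (R * √A.L / (8 * K) * (I.2 - I.1)) :=
              mul_le_mul_of_nonneg_left herrw (by linarith)
          _ = (1 + B) * R / (8 * K) * √A.L * (I.2 - I.1) := by ring
          _ ≤ (1 + B) * R / (8 * K) * (1 + √A.L) * (I.2 - I.1) := by
              refine mul_le_mul_of_nonneg_right ?_ hw0.le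
              exact mul_le_mul_of_nonneg_left (by linarith) (by positivity)
          _ ≤ _ := mul_le_mul_of_nonneg_left hs.upper (by positivity)
      unfold lossC
      linarith
    have hpcI : ∀ p ∈ Icc I.1 I.2, |p - pc| ≤ I.2 - I.1 := fun p hp => by
      rw [abs_le]; constructor <;> linarith [hp.1, hp.2, hs.left, hs.right]
    refine ledger_round h.conc.profile hn.le hs0 (hv.tauC_pos k) (hv.gridC_pos k)
      hT hP (B := B) (err := err) (lam := lam) (e1 := K * (I.2 - I.1))
      (e2 := K * (I.2 - I.1)) (fun j hj => ?_) hobs herr0 (fun j hj => ?_) ?_ ?_ ?_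
    · have := hI.subset (testPrice_mem hI.le hj)
      exact ⟨hm.plo_nonneg.trans this.1, this.2.trans hm.phi_le⟩
    · have hmem := testPrice_mem hI.le hj
      have h1 := hm.lipschitz_mul _ (hI.subset hmem) _ hm.pc_mem
      have h2 := mul_le_mul_of_nonneg_left (hpcI _ hmem) hK.le
      rw [hmax]
      linarith [(abs_le.1 h1).1]
    · have hterm : ∀ j ∈ Finset.range (A.gridC k), lam (testPrice I (A.gridC k) j) ≤
          x + K * (I.2 - I.1) := by
        intro j hj
        have hmem := testPrice_mem hI.le (Finset.mem_range.1 hj)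
        have h1 := hm.lipschitz _ (hI.subset hmem) _ hm.pc_mem
        have h2 := mul_le_mul_of_nonneg_left (hpcI _ hmem) hK.le
        linarith [(abs_le.1 h1).2, h.lam_pc_le]
      refine (Finset.sum_le_sum hterm).trans ?_
      rw [Finset.sum_const, Finset.card_range, nsmul_eq_mul]
    · linarith
    · have : 0 ≤ B * err := by positivity
      linarith
  · have h1 := hm.bestInventoryPrice_near hK.le (hv.gridC_pos k) hI.left hI.le hI.right
      hs.right hn hobs
    rw [← h.target, max_eq_left hs.left] at h1
    refine h1.trans ?_
    have h2 : K ^ 2 * g ≤ √A.L / 4 * g :=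
      mul_le_mul_of_nonneg_right (by linarith [hl.sq_K]) g0.le
    have h3 : √A.L * g ≤ R * (√A.L * g) :=
      le_mul_of_one_le_left (mul_nonneg (Real.sqrt_nonneg _) g0.le) hl.one_le_R
    linarith

/-- The estimate is off by at most `R * √L / 2 * g`, which is at most half the length of the next
interval because `R ≤ √L`. A symmetric interval will do, as the loss in Step 3 is only bounded
linearly. -/
theorem IsRun.stateC (h : A.IsRun x B K Q ε lam pu pc D) (hl : A.IsLarge B K Q ε c R)
    (hlt : pu < pc) {i : ℕ}
    (hi : i ≤ A.lastU) (hb : A.Breaks D i) (hno : ∀ k < i, ¬ A.Breaks D k) {k : ℕ}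
    (hk : k ≤ A.lastC) : A.StateC B ε pc D (A.startU (i + 1)) k := by
  have hv := h.valid
  have hm := h.market
  have hL := hv.L_pos
  induction k with
  | zero =>
    obtain ⟨h1, h2⟩ := h.width_le
    have hw : A.widthC 0 = 1 := by simp [widthC]
    exact ⟨hm.pc_mem.1, hm.pc_mem.2, by rw [hw, pow_zero, div_one, mul_one]; exact h1,
      by rw [hw, mul_one]; exact h2⟩
  | succ k ih =>
    have hs := ih (by omega)
    obtain ⟨-, h1⟩ := h.roundC hl hlt hi hb hno (by omega) hs
    have hnext : A.intervalC D (A.startU (i + 1)) (k + 1) = A.truncate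
      (A.hatQOn D (A.startU (i + 1)) k (A.intervalC D (A.startU (i + 1)) k) -
        A.L / 2 * gridGap (A.intervalC D (A.startU (i + 1)) k) (A.gridC k))
      (A.hatQOn D (A.startU (i + 1)) k (A.intervalC D (A.startU (i + 1)) k) +
        A.L / 2 * gridGap (A.intervalC D (A.startU (i + 1)) k) (A.gridC k)) := rfl
    set s₀ := A.startU (i + 1)
    obtain ⟨g0, gw, gκ, gc, gup, glow⟩ := gridGap_bounds (I := A.intervalC D s₀ k)
      (κ := A.kappaC k) (by linarith [hl.kappaC k (by omega)]) hL.le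
      (div_two_pow_le h.ε_pos (by omega) hl.two_powC) hl.c_pos (hv.widthC_pos k) hs.lower hs.upper
    have hgrid : ⌈A.kappaC k⌉₊ = A.gridC k := rfl
    rw [hgrid] at g0 gw gκ gc gup glow
    rw [← hv.widthC_succ] at gup glow
    have hLg : A.L * gridGap (A.intervalC D s₀ k) (A.gridC k) ≤ ε :=
      (mul_le_mul_of_nonneg_left gκ hL.le).trans (hl.gapC k (by omega))
    set g := gridGap (A.intervalC D s₀ k) (A.gridC k) with hg
    set p := A.hatQOn D s₀ k (A.intervalC D s₀ k) with hp
    have hℓ : R * √A.L * g ≤ A.L * g := by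
      have := mul_le_mul_of_nonneg_right (mul_le_mul_of_nonneg_right hl.R_le
        (Real.sqrt_nonneg A.L)) g0.le
      rwa [hl.sq_sqrt] at this
    have h1' := abs_le.1 h1
    have hD := hm.max_mem
    rw [max_eq_right hlt.le] at hD
    have hI1 : (A.intervalC D s₀ (k + 1)).1 = p - A.L / 2 * g := by
      rw [hnext]; exact max_eq_right (by linarith [hD.1, h1'.1])
    have hI2 : (A.intervalC D s₀ (k + 1)).2 = p + A.L / 2 * g := by
      rw [hnext]; exact min_eq_right (by linarith [hD.2, h1'.2])
    have hwidth : (A.intervalC D s₀ (k + 1)).2 - (A.intervalC D s₀ (k + 1)).1 = A.L * g := by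
      rw [hI1, hI2]; ring
    refine ⟨by rw [hI1]; linarith [h1'.2], by rw [hI2]; linarith [h1'.1], ?_, ?_⟩
    · rw [hwidth]
      refine le_trans (le_of_eq ?_) glow
      rw [pow_succ]; field_simp
    · rw [hwidth]; exact gup

/-- A transition certifies `pu < pc`, hence `pD = pc`, and from there on Lipschitz bounds suffice.
The rounds of Step 2 up to and including the transition are covered by `ledgerU`. -/
theorem IsRun.ledger_finalC (h : A.IsRun x B K Q ε lam pu pc D) (hl : A.IsLarge B K Q ε c R)
    {i : ℕ} (hi : i ≤ A.lastU) (hb : A.Breaks D i) (hno : ∀ k < i, ¬ A.Breaks D k) :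
    Ledger A.n (max pu pc * lam (max pu pc)) x A.T (A.priceInStock D) D 0 A.T
      (∑ k ∈ Finset.range (i + 1), A.tauU k * A.lossU B Q ε k +
        (∑ k ∈ Finset.range (A.lastC + 1), A.tauC k * A.lossC B K R k +
          (A.T * (K * (R * √A.L * (B * A.widthC A.lastC / A.kappaC A.lastC))) +
            (B + 1) * (11 * √(A.L * (B * A.T) / A.n))))) := by
  have hv := h.valid
  have hm := h.market
  have hL := hv.L_pos
  have hK := h.K_pos
  have hlt : pu < pc := (h.roundU_hat hl hi hno (h.stateU hl hi hno)).1 hb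
  have hmax : max pu pc = pc := max_eq_right hlt.le
  refine (h.ledgerU hl hi hno).trans h.conc.profile ?_
  have hT : A.startU (i + 1) + A.startC (A.lastC + 1) ≤ A.T := by
    have := hv.startU_strictMono.monotone (show i + 1 ≤ A.lastU + 1 by omega)
    have := hl.time
    linarith
  have h1 : Ledger A.n (max pu pc * lam (max pu pc)) x A.T (A.priceInStock D) D (A.startU (i + 1))
      (A.startU (i + 1) + A.startC (A.lastC + 1))
      (∑ k ∈ Finset.range (A.lastC + 1), A.tauC k * A.lossC B K R k) :=
    Ledger.sum h.conc.profile (b := A.tauC) (e := fun k => A.tauC k * A.lossC B K R k)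
      (hv.startU_nonneg _) hT (fun k => (hv.tauC_pos k).le)
      (fun k hk => (h.roundC hl hlt hi hb hno (by omega)
        (h.stateC hl hlt hi hb hno (by omega))).1)
  refine h1.trans h.conc.profile ?_
  have hs := h.stateC hl hlt hi hb hno le_rfl
  obtain ⟨-, h2⟩ := h.roundC hl hlt hi hb hno le_rfl hs
  obtain ⟨g0, gw, gκ, gc, -, -⟩ := gridGap_bounds (I := A.intervalC D (A.startU (i + 1)) A.lastC)
    (κ := A.kappaC A.lastC) (by linarith [hl.kappaC _ le_rfl]) hL.le
    (div_two_pow_le h.ε_pos le_rfl hl.two_powC) hl.c_pos (hv.widthC_pos _) hs.lower hs.upper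
  have hgrid : ⌈A.kappaC A.lastC⌉₊ = A.gridC A.lastC := rfl
  rw [hgrid] at g0 gw gκ gc
  have h3 : K * |A.finalC D (A.startU (i + 1)) - pc| ≤
      K * (R * √A.L * (B * A.widthC A.lastC / A.kappaC A.lastC)) := by
    refine mul_le_mul_of_nonneg_left ?_ hK.le
    have hℓ0 := mul_nonneg (zero_le_one.trans hl.one_le_R) (Real.sqrt_nonneg A.L)
    have h4 := mul_le_mul_of_nonneg_left gκ hℓ0
    have h5 := mul_nonneg hℓ0 g0.le
    have h6 : |A.finalC D (A.startU (i + 1)) - pc| ≤ _ := h2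
    linarith
  have hfm := hv.finalC_mem D (A.startU (i + 1))
  refine h.ledger_final hl (add_nonneg (hv.startU_nonneg _) (hv.startC_nonneg _)) hT hfm
    (fun r hr => hv.priceInStock_finalC hi hb hno hr.1)
    ((mul_nonneg hK.le (abs_nonneg _)).trans h3) ?_ ?_
  · rw [hmax]
    linarith [(abs_le.1 (hm.lipschitz_mul _ hfm _ hm.pc_mem)).1]
  · linarith [(abs_le.1 (hm.lipschitz _ hfm _ hm.pc_mem)).2, h.lam_pc_le]

end DPA

/-! ### Large markets -/

theorem Real.eventually_log_pow_le (C : ℝ) (k : ℕ) {a : ℝ} (ha : 0 < a) :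
    ∀ᶠ n : ℕ in Filter.atTop, C * Real.log n ^ k ≤ (n : ℝ) ^ a := by
  have h1 := (isLittleO_log_rpow_rpow_atTop (k : ℝ) ha).bound (c := (|C| + 1)⁻¹) (by positivity)
  have h2 := tendsto_natCast_atTop_atTop (R := ℝ) |>.eventually h1
  filter_upwards [h2, Filter.eventually_ge_atTop 1] with n hn h1n
  have hlog : 0 ≤ Real.log n := Real.log_nonneg (by exact_mod_cast h1n)
  have hC : 0 < |C| + 1 := by positivity
  rw [Real.rpow_natCast, Real.norm_of_nonneg (pow_nonneg hlog k),
    Real.norm_of_nonneg (Real.rpow_nonneg n.cast_nonneg a), inv_mul_eq_div, le_div_iff₀ hC] at hn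
  calc C * Real.log n ^ k ≤ (|C| + 1) * Real.log n ^ k :=
        mul_le_mul_of_nonneg_right (by linarith [le_abs_self C]) (by positivity)
    _ ≤ _ := by linarith

/-- For irrational `δ` the exponents `(1 - δ) q ^ i - (1 - 2 δ)` do not vanish. -/
theorem exists_last_pos_exponent {δ : ℝ} (h0 : 0 < δ) (h1 : δ < 1 / 2) (hirr : Irrational δ) {q : ℚ}
    (hq0 : 0 ≤ q) (hq1 : q < 1) :
    ∃ l : ℕ, (∀ i ≤ l, 0 < (1 - δ) * (q : ℝ) ^ i - (1 - 2 * δ)) ∧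
      (1 - δ) * (q : ℝ) ^ (l + 1) - (1 - 2 * δ) < 0 := by
  classical
  have hne : ∀ i : ℕ, (1 - δ) * (q : ℝ) ^ i - (1 - 2 * δ) ≠ 0 := by
    intro i hi
    have hr1 : (q : ℝ) ^ i ≤ 1 := pow_le_one₀ (by exact_mod_cast hq0) (by exact_mod_cast hq1.le)
    refine hirr ⟨(1 - q ^ i) / (2 - q ^ i), ?_⟩
    push_cast
    rw [div_eq_iff (by linarith)]
    linarith
  have hex : ∃ i : ℕ, (1 - δ) * (q : ℝ) ^ i - (1 - 2 * δ) < 0 := by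
    have ht := tendsto_pow_atTop_nhds_zero_of_lt_one (r := (q : ℝ)) (by exact_mod_cast hq0)
      (by exact_mod_cast hq1)
    obtain ⟨i, hi⟩ := (ht.eventually (gt_mem_nhds (show (0 : ℝ) < 1 - 2 * δ by linarith))).exists
    refine ⟨i, ?_⟩
    have hq : (0 : ℝ) ≤ (q : ℝ) ^ i := pow_nonneg (by exact_mod_cast hq0) i
    nlinarith
  have hpos : Nat.find hex ≠ 0 := by
    intro h
    have := Nat.find_spec hex
    rw [h] at this
    norm_num at this
    linarith
  refine ⟨Nat.find hex - 1, fun i hi => ?_, ?_⟩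
  · have := Nat.find_min hex (m := i) (by omega)
    exact lt_of_le_of_ne (not_lt.1 this) (hne i).symm
  · rw [Nat.sub_add_cancel (Nat.pos_of_ne_zero hpos)]
    exact Nat.find_spec hex

/-! ### Arithmetic of the exponents in the schedule. -/

namespace DPA

variable {A : DPA} {x B K Q ε c R : ℝ} {lam : ℝ → ℝ} {pu pc : ℝ} {D : ℝ → ℕ}

/-- The observation error is of order `√(L / (n τ / κ))`. By this identity it is of order `w ^ 2 / L
^ (3 / 2)` with `w` the next width, the quadratic accuracy that locating `pu` demands. -/
theorem Valid.step_mul_widthU (h : A.Valid) (i : ℕ) :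
    A.n * (A.tauU i / A.kappaU i) * A.widthU (i + 1) ^ 4 = A.T * A.L ^ 4 := by
  have hL := h.L_pos
  have hn := h.n_pos
  unfold tauU kappaU widthU
  rw [← Real.rpow_natCast (_ ^ (_ : ℝ)), ← Real.rpow_mul hn.le]
  have e : (A.n : ℝ) ^ (1 - 2 * A.δ - (1 - A.δ) * (3 / 5 : ℝ) ^ i) = (A.n : ℝ) ^
      ((-1 : ℝ) + (1 / 5 : ℝ) * (3 / 5 : ℝ) ^ i * (1 - A.δ) -
        -(1 / 2 : ℝ) * (1 - A.δ) * (1 - (3 / 5 : ℝ) ^ (i + 1)) * (4 : ℕ)) := by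
    congr 1; push_cast; ring
  rw [e, Real.rpow_sub hn, Real.rpow_add hn, Real.rpow_neg_one]
  have p1 := (Real.rpow_pos_of_pos hn ((1 / 5 : ℝ) * (3 / 5 : ℝ) ^ i * (1 - A.δ))).ne'
  have p2 := (Real.rpow_pos_of_pos hn
    (-(1 / 2 : ℝ) * (1 - A.δ) * (1 - (3 / 5 : ℝ) ^ (i + 1)) * (4 : ℕ))).ne'
  field_simp

/-- Here the observation error is of order `w / √L` with `w` the next width; linear accuracy is
enough for `pc`. -/
theorem Valid.step_mul_widthC (h : A.Valid) (i : ℕ) :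
    A.n * (A.tauC i / A.kappaC i) * A.widthC (i + 1) ^ 2 = A.T * A.L ^ 2 := by
  have hL := h.L_pos
  have hn := h.n_pos
  unfold tauC kappaC widthC
  rw [← Real.rpow_natCast (_ ^ (_ : ℝ)), ← Real.rpow_mul hn.le]
  have e : (A.n : ℝ) ^ (1 - 2 * A.δ - (1 - A.δ) * (2 / 3 : ℝ) ^ i) = (A.n : ℝ) ^
      ((-1 : ℝ) + (1 / 3 : ℝ) * (2 / 3 : ℝ) ^ i * (1 - A.δ) -
        -(1 - A.δ) * (1 - (2 / 3 : ℝ) ^ (i + 1)) * (2 : ℕ)) := by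
    congr 1; push_cast; ring
  rw [e, Real.rpow_sub hn, Real.rpow_add hn, Real.rpow_neg_one]
  have p1 := (Real.rpow_pos_of_pos hn ((1 / 3 : ℝ) * (2 / 3 : ℝ) ^ i * (1 - A.δ))).ne'
  have p2 := (Real.rpow_pos_of_pos hn (-(1 - A.δ) * (1 - (2 / 3 : ℝ) ^ (i + 1)) * (2 : ℕ))).ne'
  field_simp

/-- A round loses about `w ^ 2` per unit of time, up to a logarithm. The lengths `τ` are chosen so
that all rounds cost the same, and this cost is the target `n ^ (-δ)`. -/
theorem Valid.tauU_mul_widthU (h : A.Valid) (i : ℕ) :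
    A.tauU i * A.widthU i ^ 2 = A.T * A.L ^ 5 * (A.n : ℝ) ^ (-A.δ) := by
  have hn := h.n_pos
  unfold tauU widthU
  rw [← Real.rpow_natCast (_ ^ (_ : ℝ)), ← Real.rpow_mul hn.le]
  have e : (A.n : ℝ) ^ (-A.δ) = (A.n : ℝ) ^ (1 - 2 * A.δ - (1 - A.δ) * (3 / 5 : ℝ) ^ i) *
      (A.n : ℝ) ^ (-(1 / 2 : ℝ) * (1 - A.δ) * (1 - (3 / 5 : ℝ) ^ i) * (2 : ℕ)) := by
    rw [← Real.rpow_add hn]; congr 1; push_cast; ring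
  rw [e]; ring

theorem Valid.tauC_mul_widthC (h : A.Valid) (i : ℕ) :
    A.tauC i * A.widthC i = A.T * A.L ^ 3 * (A.n : ℝ) ^ (-A.δ) := by
  have hn := h.n_pos
  unfold tauC widthC
  have e : (A.n : ℝ) ^ (-A.δ) = (A.n : ℝ) ^ (1 - 2 * A.δ - (1 - A.δ) * (2 / 3 : ℝ) ^ i) *
      (A.n : ℝ) ^ (-(1 - A.δ) * (1 - (2 / 3 : ℝ) ^ i)) := by
    rw [← Real.rpow_add hn]; congr 1; ring
  rw [e]; ring

theorem Valid.one_le_n (h : A.Valid) : (1 : ℝ) ≤ A.n := by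
  have h2 := h.two_le
  have h3 : 1 ≤ A.n := by omega
  exact_mod_cast h3

theorem Valid.widthU_succ_le (h : A.Valid) (hδ : A.δ ≤ 1) (i : ℕ) :
    A.widthU (i + 1) ≤ (A.n : ℝ) ^ (-((1 - A.δ) / 5)) := by
  have hn := h.one_le_n
  refine Real.rpow_le_rpow_of_exponent_le hn ?_
  have : (3 / 5 : ℝ) ^ i ≤ 1 := pow_le_one₀ (by norm_num) (by norm_num)
  rw [pow_succ]
  nlinarith

theorem Valid.widthC_succ_le (h : A.Valid) (hδ : A.δ ≤ 1) (i : ℕ) :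
    A.widthC (i + 1) ≤ (A.n : ℝ) ^ (-((1 - A.δ) / 5)) := by
  have hn := h.one_le_n
  refine Real.rpow_le_rpow_of_exponent_le hn ?_
  have : (2 / 3 : ℝ) ^ i ≤ 1 := pow_le_one₀ (by norm_num) (by norm_num)
  rw [pow_succ]
  nlinarith

theorem sqrt_L_le (hL : 1 ≤ A.L) : √A.L ≤ A.L := by
  rw [Real.sqrt_le_left (by linarith)]; nlinarith

/-- The ratio `w / κ` is the next width divided by `L`, and the exponent of the square of that width
is below `-δ` exactly under `hl`. So `l`, which does not depend on `n`, bounds the number of rounds.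
-/
theorem Valid.stopU_of_exponent (h : A.Valid) (hL : 1 ≤ A.L) {l : ℕ}
    (hl : (1 - A.δ) * (3 / 5 : ℝ) ^ (l + 1) - (1 - 2 * A.δ) < 0) :
    (A.widthU l / A.kappaU l) ^ 2 * √A.L < (A.n : ℝ) ^ (-A.δ) * A.L ^ (7 / 2 : ℝ) := by
  have hn := h.n_pos
  have hL0 := h.L_pos
  have h1n : (1 : ℝ) < A.n := by
    have : (2 : ℝ) ≤ A.n := by exact_mod_cast h.two_le
    linarith
  have e : A.widthU l / A.kappaU l = A.widthU (l + 1) / A.L := by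
    rw [h.widthU_succ]; field_simp
  have h2 : A.widthU (l + 1) ^ 2 < (A.n : ℝ) ^ (-A.δ) := by
    unfold widthU
    rw [← Real.rpow_natCast (_ ^ (_ : ℝ)), ← Real.rpow_mul hn.le]
    refine Real.rpow_lt_rpow_of_exponent_lt h1n ?_
    push_cast; linarith
  have h3 : √A.L / A.L ^ 2 ≤ A.L ^ (7 / 2 : ℝ) := by
    have h4 : (1 : ℝ) ≤ A.L ^ (7 / 2 : ℝ) := Real.one_le_rpow hL (by norm_num)
    refine le_trans ?_ h4
    rw [div_le_one (by positivity)]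
    nlinarith [sqrt_L_le hL]
  rw [e]
  calc (A.widthU (l + 1) / A.L) ^ 2 * √A.L = A.widthU (l + 1) ^ 2 * (√A.L / A.L ^ 2) := by
        rw [div_pow]; ring
    _ ≤ A.widthU (l + 1) ^ 2 * A.L ^ (7 / 2 : ℝ) := mul_le_mul_of_nonneg_left h3 (by positivity)
    _ < _ := mul_lt_mul_of_pos_right h2 (Real.rpow_pos_of_pos hL0 _)

theorem Valid.stopC_of_exponent (h : A.Valid) (hL : 1 ≤ A.L) {l : ℕ}
    (hl : (1 - A.δ) * (2 / 3 : ℝ) ^ (l + 1) - (1 - 2 * A.δ) < 0) :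
    A.widthC l / A.kappaC l * √A.L < (A.n : ℝ) ^ (-A.δ) * A.L ^ (5 / 2 : ℝ) := by
  have hn := h.n_pos
  have hL0 := h.L_pos
  have h1n : (1 : ℝ) < A.n := by
    have : (2 : ℝ) ≤ A.n := by exact_mod_cast h.two_le
    linarith
  have e : A.widthC l / A.kappaC l = A.widthC (l + 1) / A.L := by
    rw [h.widthC_succ]; field_simp
  have h2 : A.widthC (l + 1) < (A.n : ℝ) ^ (-A.δ) := by
    unfold widthC
    refine Real.rpow_lt_rpow_of_exponent_lt h1n ?_
    linarith
  have h3 : √A.L / A.L ≤ A.L ^ (5 / 2 : ℝ) := by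
    have h4 : (1 : ℝ) ≤ A.L ^ (5 / 2 : ℝ) := Real.one_le_rpow hL (by norm_num)
    refine le_trans ?_ h4
    rw [div_le_one (by positivity)]
    exact sqrt_L_le hL
  rw [e]
  calc A.widthC (l + 1) / A.L * √A.L = A.widthC (l + 1) * (√A.L / A.L) := by ring
    _ ≤ A.widthC (l + 1) * A.L ^ (5 / 2 : ℝ) :=
      mul_le_mul_of_nonneg_left h3 (h.widthC_pos _).le
    _ < _ := mul_lt_mul_of_pos_right h2 (Real.rpow_pos_of_pos hL0 _)

/-- The nominal width after the last round of Step 2. -/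
theorem Valid.widthU_last_le (h : A.Valid) (hL : 1 ≤ A.L) {l : ℕ}
    (hl : (A.widthU l / A.kappaU l) ^ 2 * √A.L < (A.n : ℝ) ^ (-A.δ) * A.L ^ (7 / 2 : ℝ)) :
    A.L * (A.widthU l / A.kappaU l) ^ 2 ≤ (A.n : ℝ) ^ (-A.δ) * A.L ^ 6 := by
  have hn := Real.rpow_pos_of_pos h.n_pos (-A.δ)
  have h1 : (1 : ℝ) ≤ √A.L := Real.one_le_sqrt.2 hL
  have h2 : A.L ^ (7 / 2 : ℝ) ≤ A.L ^ 5 := by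
    rw [← Real.rpow_natCast]
    exact Real.rpow_le_rpow_of_exponent_le hL (by norm_num)
  have h3 : (A.widthU l / A.kappaU l) ^ 2 ≤ (A.n : ℝ) ^ (-A.δ) * A.L ^ 5 := by
    have := mul_le_mul_of_nonneg_left h2 hn.le
    nlinarith [sq_nonneg (A.widthU l / A.kappaU l)]
  have := mul_le_mul_of_nonneg_left h3 h.L_pos.le
  nlinarith

/-- The nominal width after the last round of Step 3. -/
theorem Valid.widthC_last_le (h : A.Valid) (hL : 1 ≤ A.L) {l : ℕ}
    (hl : A.widthC l / A.kappaC l * √A.L < (A.n : ℝ) ^ (-A.δ) * A.L ^ (5 / 2 : ℝ)) :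
    √A.L * (A.widthC l / A.kappaC l) ≤ (A.n : ℝ) ^ (-A.δ) * A.L ^ 6 := by
  have hn := Real.rpow_pos_of_pos h.n_pos (-A.δ)
  have h2 : A.L ^ (5 / 2 : ℝ) ≤ A.L ^ 6 := by
    rw [← Real.rpow_natCast]
    exact Real.rpow_le_rpow_of_exponent_le hL (by norm_num)
  have := mul_le_mul_of_nonneg_left h2 hn.le
  linarith

theorem Valid.fluctuation_le (h : A.Valid) (hL : 1 ≤ A.L) (hδ : A.δ ≤ 1 / 2) (c : ℝ) :
    √(A.L * c / A.n) ≤ √c * ((A.n : ℝ) ^ (-A.δ) * A.L ^ 6) := by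
  have hn := h.n_pos
  have h1 : √(A.L * c / A.n) = √c * (√A.L * (A.n : ℝ) ^ (-(1 / 2 : ℝ))) := by
    rw [Real.sqrt_div' _ hn.le, Real.sqrt_mul h.L_pos.le, Real.rpow_neg hn.le, ← Real.sqrt_eq_rpow]
    ring
  have h2 : (A.n : ℝ) ^ (-(1 / 2 : ℝ)) ≤ (A.n : ℝ) ^ (-A.δ) :=
    Real.rpow_le_rpow_of_exponent_le h.one_le_n (by linarith)
  have h3 : √A.L ≤ A.L ^ 6 := (sqrt_L_le hL).trans (le_self_pow₀ hL (by norm_num))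
  rw [h1]
  refine mul_le_mul_of_nonneg_left ?_ (Real.sqrt_nonneg c)
  rw [mul_comm]
  exact mul_le_mul h2 h3 (Real.sqrt_nonneg _) (Real.rpow_nonneg hn.le _)

theorem Valid.tauU_mul_lossU_le (h : A.Valid) (hL : 1 ≤ A.L) (hB : 0 < B) (hQ : 0 < Q) (i : ℕ) :
    A.tauU i * A.lossU B Q ε i ≤ 2 * A.T *
      ((Q + B ^ 2 / ε ^ 2 + B / ε ^ 2 + (1 + B) / (16 * (Q * B))) * B ^ 2) *
      ((A.n : ℝ) ^ (-A.δ) * A.L ^ 6) := by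
  have hn := Real.rpow_pos_of_pos h.n_pos (-A.δ)
  set k := (Q + B ^ 2 / ε ^ 2 + B / ε ^ 2 + (1 + B) / (16 * (Q * B))) * B ^ 2 with hk
  have hk0 : 0 ≤ k := by positivity
  have hT := h.T_pos
  have e : A.tauU i * A.lossU B Q ε i = k * (1 + A.L) * (A.tauU i * A.widthU i ^ 2) := by
    unfold lossU; rw [hk]; ring
  rw [e, h.tauU_mul_widthU]
  have h1 : A.T * A.L ^ 5 * (A.n : ℝ) ^ (-A.δ) * (1 + A.L) ≤
      A.T * A.L ^ 5 * (A.n : ℝ) ^ (-A.δ) * (2 * A.L) := by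
    have := h.L_pos
    exact mul_le_mul_of_nonneg_left (by linarith) (by positivity)
  have := mul_le_mul_of_nonneg_left h1 hk0
  nlinarith

theorem Valid.tauC_mul_lossC_le (h : A.Valid) (hL : 1 ≤ A.L) (hB : 0 < B) (hK : 0 < K) (hR : 0 ≤ R)
    (i : ℕ) :
    A.tauC i * A.lossC B K R i ≤ 2 * A.T * ((K + (1 + B) * R / (8 * K)) * B) *
      ((A.n : ℝ) ^ (-A.δ) * A.L ^ 6) := by
  have hn := Real.rpow_pos_of_pos h.n_pos (-A.δ)
  set k := (K + (1 + B) * R / (8 * K)) * B with hk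
  have hk0 : 0 ≤ k := by positivity
  have hT := h.T_pos
  have hL0 := h.L_pos
  have e : A.tauC i * A.lossC B K R i = k * ((1 + √A.L) * (A.tauC i * A.widthC i)) := by
    unfold lossC; rw [hk]; ring
  rw [e, h.tauC_mul_widthC]
  have h1 : (1 + √A.L) * (A.T * A.L ^ 3 * (A.n : ℝ) ^ (-A.δ)) ≤
      2 * A.L ^ 3 * (A.T * A.L ^ 3 * (A.n : ℝ) ^ (-A.δ)) := by
    have h2 : A.L ≤ A.L ^ 3 := le_self_pow₀ hL (by norm_num)
    have := sqrt_L_le hL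
    exact mul_le_mul_of_nonneg_right (by linarith) (by positivity)
  have := mul_le_mul_of_nonneg_left h1 hk0
  calc _ ≤ _ := this
    _ = _ := by ring

theorem lastU_spec {l : ℕ}
    (hl : (A.widthU l / A.kappaU l) ^ 2 * √A.L < (A.n : ℝ) ^ (-A.δ) * A.L ^ (7 / 2 : ℝ)) :
    A.lastU ≤ l ∧ (A.widthU A.lastU / A.kappaU A.lastU) ^ 2 * √A.L <
      (A.n : ℝ) ^ (-A.δ) * A.L ^ (7 / 2 : ℝ) :=
  ⟨Nat.sInf_le hl, Nat.sInf_mem (s := {i | (A.widthU i / A.kappaU i) ^ 2 * √A.L <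
    (A.n : ℝ) ^ (-A.δ) * A.L ^ (7 / 2 : ℝ)}) ⟨l, hl⟩⟩

theorem lastC_spec {l : ℕ}
    (hl : A.widthC l / A.kappaC l * √A.L < (A.n : ℝ) ^ (-A.δ) * A.L ^ (5 / 2 : ℝ)) :
    A.lastC ≤ l ∧ A.widthC A.lastC / A.kappaC A.lastC * √A.L <
      (A.n : ℝ) ^ (-A.δ) * A.L ^ (5 / 2 : ℝ) :=
  ⟨Nat.sInf_le hl, Nat.sInf_mem (s := {i | A.widthC i / A.kappaC i * √A.L <
    (A.n : ℝ) ^ (-A.δ) * A.L ^ (5 / 2 : ℝ)}) ⟨l, hl⟩⟩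

theorem sum_range_le_of_le {f : ℕ → ℝ} {m l : ℕ} {b : ℝ} (hb : 0 ≤ b) (hm : m ≤ l)
    (hf : ∀ i ≤ m, f i ≤ b) : ∑ i ∈ Finset.range (m + 1), f i ≤ (l + 1) * b := by
  refine (Finset.sum_le_card_nsmul _ _ b fun i hi =>
    hf i (by rw [Finset.mem_range] at hi; omega)).trans ?_
  rw [Finset.card_range, nsmul_eq_mul]
  refine mul_le_mul_of_nonneg_right ?_ hb
  have : m + 1 ≤ l + 1 := by omega
  exact_mod_cast this

end DPA

/-! ### Size of the errors and choice of the constants. -/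

namespace DPA

variable {A : DPA} {x B K Q ε c R : ℝ} {lam : ℝ → ℝ} {pu pc : ℝ} {D : ℝ → ℕ}

theorem ceil_le_two_mul {κ : ℝ} (hκ : 1 ≤ κ) : (⌈κ⌉₊ : ℝ) ≤ 2 * κ := by
  have := (Nat.ceil_lt_add_one (show 0 ≤ κ by linarith)).le
  linarith

theorem half_le_step {n τ κ : ℝ} (hn : 0 ≤ n) (hτ : 0 ≤ τ) (hκ : 1 ≤ κ) :
    n * (τ / κ) / 2 ≤ n * (τ / ⌈κ⌉₊) := by
  have h1 : τ / (2 * κ) ≤ τ / ⌈κ⌉₊ :=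
    div_le_div_of_nonneg_left hτ (by exact_mod_cast Nat.ceil_pos.2 (by linarith)) (ceil_le_two_mul hκ)
  have := mul_le_mul_of_nonneg_left h1 hn
  calc n * (τ / κ) / 2 = n * (τ / (2 * κ)) := by field_simp
    _ ≤ _ := this

theorem Valid.L_le_kappaU (h : A.Valid) (hδ : A.δ ≤ 1) (i : ℕ) : A.L ≤ A.kappaU i := by
  unfold kappaU
  refine le_mul_of_one_le_left h.L_pos.le (Real.one_le_rpow h.one_le_n ?_)
  have : 0 ≤ 1 - A.δ := by linarith
  positivity

theorem Valid.L_le_kappaC (h : A.Valid) (hδ : A.δ ≤ 1) (i : ℕ) : A.L ≤ A.kappaC i := by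
  unfold kappaC
  refine le_mul_of_one_le_left h.L_pos.le (Real.one_le_rpow h.one_le_n ?_)
  have : 0 ≤ 1 - A.δ := by linarith
  positivity

theorem Valid.le_stepU (h : A.Valid) (hδ : A.δ ≤ 1) (hL : 1 ≤ A.L) (i : ℕ) :
    A.T * A.L ^ 4 / (2 * A.widthU (i + 1) ^ 4) ≤ A.n * (A.tauU i / A.gridU i) := by
  have h1 := half_le_step h.n_pos.le (h.tauU_pos i).le (hL.trans (h.L_le_kappaU hδ i))
  refine le_trans (le_of_eq ?_) h1
  have := h.widthU_pos (i + 1)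
  rw [← h.step_mul_widthU i]; field_simp

theorem Valid.le_stepC (h : A.Valid) (hδ : A.δ ≤ 1) (hL : 1 ≤ A.L) (i : ℕ) :
    A.T * A.L ^ 2 / (2 * A.widthC (i + 1) ^ 2) ≤ A.n * (A.tauC i / A.gridC i) := by
  have h1 := half_le_step h.n_pos.le (h.tauC_pos i).le (hL.trans (h.L_le_kappaC hδ i))
  refine le_trans (le_of_eq ?_) h1
  have := h.widthC_pos (i + 1)
  rw [← h.step_mul_widthC i]; field_simp

theorem Valid.width_succ_le_one (h : A.Valid) (hδ : A.δ ≤ 1) (i : ℕ) :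
    A.widthU (i + 1) ≤ 1 ∧ A.widthC (i + 1) ≤ 1 := by
  have h1 : (A.n : ℝ) ^ (-((1 - A.δ) / 5)) ≤ 1 :=
    Real.rpow_le_one_of_one_le_of_nonpos h.one_le_n (by linarith)
  exact ⟨(h.widthU_succ_le hδ i).trans h1, (h.widthC_succ_le hδ i).trans h1⟩

theorem sqrt_div_le_of_le {a b s : ℝ} (hs : 0 < s) (hb : s ≤ b) (ha : 0 ≤ a) : √(a / b) ≤ √(a / s) :=
  Real.sqrt_le_sqrt (div_le_div_of_nonneg_left ha hs hb)

/-- In terms of the present round the right-hand side is a constant times `√L * (w / κ) ^ 2`. The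
tolerance in `errU` has `L` in place of `√L`, so any constant is beaten for large `n`. -/
theorem Valid.errU_le (h : A.Valid) (hδ : A.δ ≤ 1) (hL : 1 ≤ A.L) (hB : 0 < B) (i : ℕ) :
    √(A.L * B / (A.n * (A.tauU i / A.gridU i))) ≤
      √(2 * B / A.T) / √A.L * (A.widthU (i + 1) ^ 2 / A.L) := by
  have hT := h.T_pos
  have hL0 := h.L_pos
  have hw := h.widthU_pos (i + 1)
  refine (sqrt_div_le_of_le (by positivity) (h.le_stepU hδ hL i) (by positivity)).trans
    (le_of_eq ?_)
  rw [← Real.sqrt_div' _ hL0.le, Real.sqrt_eq_iff_mul_self_eq (by positivity) (by positivity)]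
  rw [mul_mul_mul_comm, Real.mul_self_sqrt (by positivity)]
  field_simp

/-- In terms of the present round this is a constant times `√L * w / κ`, the very order of the
tolerance. There is no factor to spare, which is why `R` is needed. -/
theorem Valid.errC_le (h : A.Valid) (hδ : A.δ ≤ 1) (hL : 1 ≤ A.L) (hB : 0 < B) (i : ℕ) :
    √(A.L * B / (A.n * (A.tauC i / A.gridC i))) ≤
      √(2 * B / A.T) / √A.L * A.widthC (i + 1) := by
  have hT := h.T_pos
  have hL0 := h.L_pos
  have hw := h.widthC_pos (i + 1)
  refine (sqrt_div_le_of_le (by positivity) (h.le_stepC hδ hL i) (by positivity)).trans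
    (le_of_eq ?_)
  rw [← Real.sqrt_div' _ hL0.le, Real.sqrt_eq_iff_mul_self_eq (by positivity) (by positivity)]
  rw [mul_mul_mul_comm, Real.mul_self_sqrt (by positivity)]
  field_simp

theorem le_step_of_width {n B T L w τ : ℝ} {k : ℕ} (hL : 1 ≤ L) (hB : 0 < B)
    (hT : 0 < T) (hw : 0 < w) (hw1 : w ≤ 1) (hBT : 2 ≤ B * T * L) {m : ℕ} (hm : 2 ≤ m)
    (h : T * L ^ m / (2 * w ^ k) ≤ n * τ) : L ≤ n * B * τ := by
  have h1 : T * L ^ m / 2 ≤ T * L ^ m / (2 * w ^ k) := by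
    refine div_le_div_of_nonneg_left (by positivity) (by positivity) ?_
    have := pow_le_one₀ (n := k) hw.le hw1
    linarith
  have h2 : L ^ 2 ≤ L ^ m := pow_le_pow_right₀ hL hm
  have h3 := mul_le_mul_of_nonneg_left (h1.trans h) hB.le
  have h4 : T * L ^ 2 ≤ T * L ^ m := mul_le_mul_of_nonneg_left h2 hT.le
  have h5 := mul_le_mul_of_nonneg_left h4 hB.le
  have h6 := mul_le_mul_of_nonneg_right hBT (show 0 ≤ L by linarith)
  nlinarith

/-- Relative to `T` a round has a negative power of `n` as its length, up to logarithms. Taking `b =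
2 * (l + 1)` leaves at most half of the season to Step 2; `startC_le` does the same for Step 3. -/
theorem Valid.startU_le (h : A.Valid) {m l : ℕ} {b : ℝ} (hm : m ≤ l)
    (hb : ∀ i ≤ l, b * A.L ^ 5 ≤ (A.n : ℝ) ^ ((1 - A.δ) * (3 / 5 : ℝ) ^ i - (1 - 2 * A.δ))) :
    b * A.startU (m + 1) ≤ (l + 1) * A.T := by
  have hT := h.T_pos
  unfold startU
  rw [Finset.mul_sum]
  refine sum_range_le_of_le hT.le hm fun i hi => ?_
  have hn := h.n_pos
  have h1 := hb i (hi.trans hm)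
  unfold tauU
  rw [show 1 - 2 * A.δ - (1 - A.δ) * (3 / 5 : ℝ) ^ i =
    -((1 - A.δ) * (3 / 5 : ℝ) ^ i - (1 - 2 * A.δ)) by ring, Real.rpow_neg hn.le]
  set e := (A.n : ℝ) ^ ((1 - A.δ) * (3 / 5 : ℝ) ^ i - (1 - 2 * A.δ)) with he
  have he0 : 0 < e := Real.rpow_pos_of_pos hn _
  calc b * (A.T * (e⁻¹ * A.L ^ 5)) = A.T * (b * A.L ^ 5 / e) := by ring
    _ ≤ A.T * 1 := mul_le_mul_of_nonneg_left ((div_le_one he0).2 h1) hT.le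
    _ = A.T := mul_one _

theorem Valid.startC_le (h : A.Valid) {m l : ℕ} {b : ℝ} (hm : m ≤ l)
    (hb : ∀ i ≤ l, b * A.L ^ 3 ≤ (A.n : ℝ) ^ ((1 - A.δ) * (2 / 3 : ℝ) ^ i - (1 - 2 * A.δ))) :
    b * A.startC (m + 1) ≤ (l + 1) * A.T := by
  have hT := h.T_pos
  unfold startC
  rw [Finset.mul_sum]
  refine sum_range_le_of_le hT.le hm fun i hi => ?_
  have hn := h.n_pos
  have h1 := hb i (hi.trans hm)
  unfold tauC
  rw [show 1 - 2 * A.δ - (1 - A.δ) * (2 / 3 : ℝ) ^ i =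
    -((1 - A.δ) * (2 / 3 : ℝ) ^ i - (1 - 2 * A.δ)) by ring, Real.rpow_neg hn.le]
  set e := (A.n : ℝ) ^ ((1 - A.δ) * (2 / 3 : ℝ) ^ i - (1 - 2 * A.δ)) with he
  have he0 : 0 < e := Real.rpow_pos_of_pos hn _
  calc b * (A.T * (e⁻¹ * A.L ^ 3)) = A.T * (b * A.L ^ 3 / e) := by ring
    _ ≤ A.T * 1 := mul_le_mul_of_nonneg_left ((div_le_one he0).2 h1) hT.le
    _ = A.T := mul_one _

/-- The error term of the ledger when Step 2 ends without transition. -/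
noncomputable def errorU (A : DPA) (B Q ε : ℝ) : ℝ :=
  ∑ k ∈ Finset.range (A.lastU + 1), A.tauU k * A.lossU B Q ε k +
    (A.T * (25 * Q * (A.L * (B * A.widthU A.lastU / A.kappaU A.lastU) ^ 2)) +
      (B + 1) * (11 * √(A.L * (B * A.T) / A.n)))

/-- The error term of the ledger when Step 3 is entered. -/
noncomputable def errorC (A : DPA) (B K Q ε R : ℝ) : ℝ :=
  ∑ k ∈ Finset.range (A.lastU + 1), A.tauU k * A.lossU B Q ε k +
    (∑ k ∈ Finset.range (A.lastC + 1), A.tauC k * A.lossC B K R k +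
      (A.T * (K * (R * √A.L * (B * A.widthC A.lastC / A.kappaC A.lastC))) +
        (B + 1) * (11 * √(A.L * (B * A.T) / A.n))))

theorem Valid.errorU_le (h : A.Valid) (hL : 1 ≤ A.L) (hδ : A.δ ≤ 1 / 2) (hB : 0 < B) (hQ : 0 < Q)
    {l : ℕ} (hm : A.lastU ≤ l)
    (hl : (A.widthU A.lastU / A.kappaU A.lastU) ^ 2 * √A.L <
      (A.n : ℝ) ^ (-A.δ) * A.L ^ (7 / 2 : ℝ)) :
    A.errorU B Q ε ≤ ((l + 1) * (2 * A.T *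
      ((Q + B ^ 2 / ε ^ 2 + B / ε ^ 2 + (1 + B) / (16 * (Q * B))) * B ^ 2)) +
      A.T * (25 * Q * B ^ 2) + (B + 1) * (11 * √(B * A.T))) *
      ((A.n : ℝ) ^ (-A.δ) * A.L ^ 6) := by
  have hT := h.T_pos
  set z := (A.n : ℝ) ^ (-A.δ) * A.L ^ 6 with hz
  have hz0 : 0 < z := mul_pos (Real.rpow_pos_of_pos h.n_pos _) (pow_pos h.L_pos _)
  have h1 := sum_range_le_of_le (f := fun k => A.tauU k * A.lossU B Q ε k)
    (b := 2 * A.T * ((Q + B ^ 2 / ε ^ 2 + B / ε ^ 2 + (1 + B) / (16 * (Q * B))) * B ^ 2) * z)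
    (by positivity) hm fun i _ => h.tauU_mul_lossU_le hL hB hQ i
  have h2 := mul_le_mul_of_nonneg_left (h.widthU_last_le hL hl)
    (show 0 ≤ A.T * (25 * Q * B ^ 2) by positivity)
  have h3 := mul_le_mul_of_nonneg_left (h.fluctuation_le hL hδ (B * A.T))
    (show 0 ≤ (B + 1) * 11 by positivity)
  have e : A.T * (25 * Q * (A.L * (B * A.widthU A.lastU / A.kappaU A.lastU) ^ 2)) =
    A.T * (25 * Q * B ^ 2) * (A.L * (A.widthU A.lastU / A.kappaU A.lastU) ^ 2) := by ring
  unfold errorU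
  rw [e]
  linarith

theorem Valid.errorC_le (h : A.Valid) (hL : 1 ≤ A.L) (hδ : A.δ ≤ 1 / 2) (hB : 0 < B) (hQ : 0 < Q)
    (hK : 0 < K) (hR : 0 ≤ R) {l l' : ℕ} (hm : A.lastU ≤ l) (hm' : A.lastC ≤ l')
    (hl : A.widthC A.lastC / A.kappaC A.lastC * √A.L <
      (A.n : ℝ) ^ (-A.δ) * A.L ^ (5 / 2 : ℝ)) :
    A.errorC B K Q ε R ≤ ((l + 1) * (2 * A.T *
      ((Q + B ^ 2 / ε ^ 2 + B / ε ^ 2 + (1 + B) / (16 * (Q * B))) * B ^ 2)) +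
      (l' + 1) * (2 * A.T * ((K + (1 + B) * R / (8 * K)) * B)) +
      A.T * (K * R * B) + (B + 1) * (11 * √(B * A.T))) *
      ((A.n : ℝ) ^ (-A.δ) * A.L ^ 6) := by
  have hT := h.T_pos
  set z := (A.n : ℝ) ^ (-A.δ) * A.L ^ 6 with hz
  have hz0 : 0 < z := mul_pos (Real.rpow_pos_of_pos h.n_pos _) (pow_pos h.L_pos _)
  have h1 := sum_range_le_of_le (f := fun k => A.tauU k * A.lossU B Q ε k)
    (b := 2 * A.T * ((Q + B ^ 2 / ε ^ 2 + B / ε ^ 2 + (1 + B) / (16 * (Q * B))) * B ^ 2) * z)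
    (by positivity) hm fun i _ => h.tauU_mul_lossU_le hL hB hQ i
  have h1' := sum_range_le_of_le (f := fun k => A.tauC k * A.lossC B K R k)
    (b := 2 * A.T * ((K + (1 + B) * R / (8 * K)) * B) * z)
    (by positivity) hm' fun i _ => h.tauC_mul_lossC_le hL hB hK hR i
  have h2 := mul_le_mul_of_nonneg_left (h.widthC_last_le hL hl)
    (show 0 ≤ A.T * (K * R * B) by positivity)
  have h3 := mul_le_mul_of_nonneg_left (h.fluctuation_le hL hδ (B * A.T))
    (show 0 ≤ (B + 1) * 11 by positivity)
  have e : A.T * (K * (R * √A.L * (B * A.widthC A.lastC / A.kappaC A.lastC))) =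
    A.T * (K * R * B) * (√A.L * (A.widthC A.lastC / A.kappaC A.lastC)) := by ring
  unfold errorC
  rw [e]
  linarith

theorem exists_isLarge {δ T : ℝ} (h0 : 0 < δ) (h1 : δ < 1 / 2) (hirr : Irrational δ)
    (hB : 0 < B) (hK : 0 < K) (hQ : 0 < Q) (hε : 0 < ε) (hT : 0 < T) :
    ∃ c R E : ℝ, 0 ≤ E ∧ ∀ᶠ n : ℕ in Filter.atTop, ∀ A : DPA, A.Valid → A.n = n → A.δ = δ → A.T = T →
      A.IsLarge B K Q ε c R ∧ A.errorU B Q ε ≤ E * ((n : ℝ) ^ (-δ) * Real.log n ^ 6) ∧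
        A.errorC B K Q ε R ≤ E * ((n : ℝ) ^ (-δ) * Real.log n ^ 6) := by
  obtain ⟨lU, hU1, hU2⟩ := exists_last_pos_exponent h0 h1 hirr (q := 3 / 5) (by norm_num) (by norm_num)
  obtain ⟨lC, hC1, hC2⟩ := exists_last_pos_exponent h0 h1 hirr (q := 2 / 3) (by norm_num) (by norm_num)
  push_cast at hU1 hU2 hC1 hC2
  -- Rounding up the number of test prices may halve the interval, relative to its nominal width, in
  -- each round. As the number of rounds is bounded, `c` is a lower bound for all the factors `2 * ε
  -- / 2 ^ i`.
  obtain ⟨c, hc⟩ : ∃ c, c = 2 * ε / 2 ^ max lU lC := ⟨_, rfl⟩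
  have hc0 : 0 < c := by rw [hc]; positivity
  -- Here `176 = 2 * 8 * 11`: the factor `8 * K` and the deviation constant `11` of `errC`, and the
  -- `2` in its denominator.
  obtain ⟨R, hR⟩ : ∃ R, R = max 1 (176 * K * √(2 * B / T) / c) := ⟨_, rfl⟩
  have hR1 : 1 ≤ R := hR ▸ le_max_left _ _
  have hR2 : 176 * K * √(2 * B / T) ≤ R * c := by
    rw [← div_le_iff₀ hc0, hR]; exact le_max_right _ _
  have htwo : ∀ m, m ≤ max lU lC → c * 2 ^ m ≤ 2 * ε := by
    intro m hm
    rw [hc, div_mul_eq_mul_div, div_le_iff₀ (by positivity)]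
    exact mul_le_mul_of_nonneg_left (pow_le_pow_right₀ (by norm_num) hm) (by positivity)
  obtain ⟨kU, hkU⟩ : ∃ k, k =
    (Q + B ^ 2 / ε ^ 2 + B / ε ^ 2 + (1 + B) / (16 * (Q * B))) * B ^ 2 := ⟨_, rfl⟩
  obtain ⟨kC, hkC⟩ : ∃ k, k = (K + (1 + B) * R / (8 * K)) * B := ⟨_, rfl⟩
  have hkU0 : 0 ≤ kU := by rw [hkU]; positivity
  have hkC0 : 0 ≤ kC := by rw [hkC]; positivity
  refine ⟨c, R, (lU + 1) * (2 * T * kU) + (lC + 1) * (2 * T * kC) + T * (25 * Q * B ^ 2) +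
    T * (K * R * B) + (B + 1) * (11 * √(B * T)), by positivity, ?_⟩
  have hlog := Real.tendsto_log_atTop.comp (tendsto_natCast_atTop_atTop (R := ℝ))
  have hsq := Real.tendsto_sqrt_atTop.comp hlog
  have evU : ∀ᶠ n : ℕ in Filter.atTop, ∀ i ∈ Finset.range (lU + 1),
      2 * ((lU : ℝ) + 1) * Real.log n ^ 5 ≤
        (n : ℝ) ^ ((1 - δ) * (3 / 5 : ℝ) ^ i - (1 - 2 * δ)) := by
    rw [Filter.eventually_all_finset]
    intro i hi
    exact Real.eventually_log_pow_le _ 5 (hU1 i (by rw [Finset.mem_range] at hi; omega))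
  have evC : ∀ᶠ n : ℕ in Filter.atTop, ∀ i ∈ Finset.range (lC + 1),
      2 * ((lC : ℝ) + 1) * Real.log n ^ 3 ≤
        (n : ℝ) ^ ((1 - δ) * (2 / 3 : ℝ) ^ i - (1 - 2 * δ)) := by
    rw [Filter.eventually_all_finset]
    intro i hi
    exact Real.eventually_log_pow_le _ 3 (hC1 i (by rw [Finset.mem_range] at hi; omega))
  filter_upwards [hlog.eventually_ge_atTop 64, hsq.eventually_ge_atTop (4 * K ^ 2),
    hlog.eventually_ge_atTop (8 * Q ^ 2), hsq.eventually_ge_atTop (K * ε / (2 * (Q * B))),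
    hsq.eventually_ge_atTop R, Real.eventually_log_pow_le (1 / (B * T)) 1 one_pos, evU, evC,
    hlog.eventually_ge_atTop (2 / (B * T)),
    Real.eventually_log_pow_le (B / ε) 0 (show 0 < (1 - δ) / 5 by linarith),
    hsq.eventually_ge_atTop (704 * (Q * B) * √(2 * B / T) / c ^ 2)]
    with n e1 e2 e3 e4 e5 e6 e7 e8 e9 e10 e11
  rintro A hA rfl rfl rfl
  change 64 ≤ A.L at e1
  change 4 * K ^ 2 ≤ √A.L at e2
  change 8 * Q ^ 2 ≤ A.L at e3
  change _ ≤ √A.L at e4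
  change R ≤ √A.L at e5
  change _ ≤ A.L at e9
  change _ ≤ √A.L at e11
  have hL1 : 1 ≤ A.L := by linarith
  have hL0 : 0 < A.L := by linarith
  have hs0 : 0 < √A.L := Real.sqrt_pos.2 hL0
  have hn := hA.n_pos
  have hδ1 : A.δ ≤ 1 := by linarith
  obtain ⟨hlU, hcU⟩ := lastU_spec (hA.stopU_of_exponent hL1 hU2)
  obtain ⟨hlC, hcC⟩ := lastC_spec (hA.stopC_of_exponent hL1 hC2)
  have hBT : 2 ≤ B * A.T * A.L := by
    rw [div_le_iff₀ (by positivity)] at e9; linarith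
  have hsmall : ∀ w : ℝ, w ≤ (A.n : ℝ) ^ (-((1 - A.δ) / 5)) → B * w ≤ ε := by
    intro w hw
    rw [Real.rpow_neg hn.le] at hw
    have hp := Real.rpow_pos_of_pos hn ((1 - A.δ) / 5)
    rw [pow_zero, mul_one, div_le_iff₀ hε] at e10
    calc B * w ≤ B * ((A.n : ℝ) ^ ((1 - A.δ) / 5))⁻¹ := mul_le_mul_of_nonneg_left hw hB.le
      _ ≤ ε := by rw [← div_eq_mul_inv, div_le_iff₀ hp]; linarith
  refine ⟨⟨e1, e2, e3, ?_, hR1, e5, hc0, ?_, ?_, ?_, ?_, ?_, ?_, ?_, ?_, ?_, ?_, ?_, ?_⟩, ?_, ?_⟩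
  · rw [div_le_iff₀ (by positivity)] at e4; linarith
  · exact htwo _ (hlU.trans (le_max_left _ _))
  · exact htwo _ (hlC.trans (le_max_right _ _))
  · rw [pow_one, Real.rpow_one, div_mul_eq_mul_div, one_mul, div_le_iff₀ (by positivity)] at e6
    change A.L ≤ _ at e6
    linarith
  · have h2 := hA.startU_le hlU (b := 2 * ((lU : ℝ) + 1)) fun i hi =>
      e7 i (by rw [Finset.mem_range]; omega)
    have h3 := hA.startC_le hlC (b := 2 * ((lC : ℝ) + 1)) fun i hi =>
      e8 i (by rw [Finset.mem_range]; omega)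
    have h4 : 2 * A.startU (A.lastU + 1) ≤ A.T := by
      refine le_of_mul_le_mul_left ?_ (show (0 : ℝ) < lU + 1 by positivity); linarith
    have h5 : 2 * A.startC (A.lastC + 1) ≤ A.T := by
      refine le_of_mul_le_mul_left ?_ (show (0 : ℝ) < lC + 1 by positivity); linarith
    linarith
  · exact fun i _ => le_step_of_width hL1 hB hA.T_pos (hA.widthU_pos _)
      (hA.width_succ_le_one hδ1 i).1 hBT (by norm_num) (hA.le_stepU hδ1 hL1 i)
  · exact fun i _ => by linarith [hA.L_le_kappaU hδ1 i]
  · intro i _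
    have := hsmall _ (hA.widthU_succ_le hδ1 i)
    rw [hA.widthU_succ] at this
    calc _ = B * (A.L * A.widthU i / A.kappaU i) := by ring
      _ ≤ ε := this
  · intro i _
    have hk := hA.kappaU_pos i
    have h2 := hA.errU_le hδ1 hL1 hB i
    have hw := hA.widthU_pos (i + 1)
    have e : A.L * (c * A.widthU i / (2 * A.kappaU i)) ^ 2 =
        c ^ 2 / 4 * (A.widthU (i + 1) ^ 2 / A.L) := by
      rw [hA.widthU_succ]; field_simp; ring
    rw [e]
    have h3 := mul_le_mul_of_nonneg_left h2 (show 0 ≤ 176 * (Q * B) by positivity)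
    have h4 : 176 * (Q * B) * (√(2 * B / A.T) / √A.L) ≤ c ^ 2 / 4 := by
      rw [← mul_div_assoc, div_le_iff₀ hs0]
      rw [div_le_iff₀ (by positivity)] at e11
      linarith
    have h5 := mul_le_mul_of_nonneg_right h4 (show 0 ≤ A.widthU (i + 1) ^ 2 / A.L by positivity)
    linarith
  · exact fun i _ => le_step_of_width hL1 hB hA.T_pos (hA.widthC_pos _)
      (hA.width_succ_le_one hδ1 i).2 hBT (by norm_num) (hA.le_stepC hδ1 hL1 i)
  · exact fun i _ => by linarith [hA.L_le_kappaC hδ1 i]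
  · intro i _
    have := hsmall _ (hA.widthC_succ_le hδ1 i)
    rw [hA.widthC_succ] at this
    calc _ = B * (A.L * A.widthC i / A.kappaC i) := by ring
      _ ≤ ε := this
  · intro i _
    have hk := hA.kappaC_pos i
    have h2 := hA.errC_le hδ1 hL1 hB i
    have hw := hA.widthC_pos (i + 1)
    have e : R * √A.L * (c * A.widthC i / (2 * A.kappaC i)) =
        R * c / 2 / √A.L * A.widthC (i + 1) := by
      rw [hA.widthC_succ]
      have hss := Real.mul_self_sqrt hL0.le
      field_simp
      rw [pow_two, hss, mul_comm]
    rw [e]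
    have h3 := mul_le_mul_of_nonneg_left h2 (show 0 ≤ 88 * K by positivity)
    have h4 : 88 * K * (√(2 * B / A.T) / √A.L) ≤ R * c / 2 / √A.L := by
      rw [← mul_div_assoc]
      exact div_le_div_of_nonneg_right (by linarith) hs0.le
    have h5 := mul_le_mul_of_nonneg_right h4 hw.le
    linarith
  · refine (hA.errorU_le hL1 h1.le hB hQ hlU hcU).trans ?_
    refine mul_le_mul_of_nonneg_right ?_ (by positivity)
    rw [← hkU]
    have hT' := hA.T_pos
    have : 0 ≤ (lC + 1) * (2 * A.T * kC) + A.T * (K * R * B) := by positivity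
    linarith
  · refine (hA.errorC_le hL1 h1.le hB hQ hK (by linarith) hlU hlC hcC).trans ?_
    refine mul_le_mul_of_nonneg_right ?_ (by positivity)
    rw [← hkU, ← hkC]
    have hT' := hA.T_pos
    have : 0 ≤ A.T * (25 * Q * B ^ 2) := by positivity
    linarith

end DPA

/-! ### The regret bound -/

namespace DPA

variable {A : DPA} {x B K Q ε c R : ℝ} {lam : ℝ → ℝ} {pu pc : ℝ} {D : ℝ → ℕ}

theorem Valid.lossU_nonneg (h : A.Valid) (hB : 0 < B) (hQ : 0 < Q) (i : ℕ) :
    0 ≤ A.lossU B Q ε i := by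
  have := h.L_pos
  unfold lossU
  positivity

/-- The ledger of the whole selling season. -/
theorem IsRun.ledger (h : A.IsRun x B K Q ε lam pu pc D) (hl : A.IsLarge B K Q ε c R) {e : ℝ}
    (hU : A.errorU B Q ε ≤ e) (hC : A.errorC B K Q ε R ≤ e) :
    Ledger A.n (max pu pc * lam (max pu pc)) x A.T (A.priceInStock D) D 0 A.T e := by
  classical
  have hn := h.valid.n_pos.le
  by_cases hex : ∃ k, k ≤ A.lastU ∧ A.Breaks D k
  · obtain ⟨hi, hb⟩ := Nat.find_spec hex
    have hno : ∀ k < Nat.find hex, ¬ A.Breaks D k := fun k hk hbk =>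
      Nat.find_min hex hk ⟨hk.le.trans hi, hbk⟩
    refine (h.ledger_finalC hl hi hb hno).mono hn (le_trans ?_ hC)
    unfold errorC
    gcongr
    exact fun _ _ _ => mul_nonneg (h.valid.tauU_pos _).le (h.valid.lossU_nonneg h.B_pos h.Q_pos _)
  · push Not at hex
    exact (h.ledger_finalU hl hex).mono hn hU

/-- The demand that cannot be served is at most the excess on the ledger plus `1`, from rounding the
inventory down, and each such unit is worth at most `B`. -/
theorem IsRun.le_revenue (h : A.IsRun x B K Q ε lam pu pc D) (hl : A.IsLarge B K Q ε c R) {e : ℝ}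
    (he : 0 ≤ e) (hU : A.errorU B Q ε ≤ e) (hC : A.errorC B K Q ε R ≤ e) :
    A.n * (A.T * (max pu pc * lam (max pu pc)) - e) - B * (A.n * e + 1) ≤
      ∑ k ∈ Finset.Icc 1 (min (D A.T) ⌊A.X⌋₊), A.priceInStock D (hitTime A.T D k) := by
  have hled := h.ledger hl hU hC
  have hn := h.valid.n_pos.le
  refine le_trans ?_ (periodRevenue_le_sum_min h.conc.profile h.B_pos.le
    (fun t => (h.valid.priceInStock_mem D t).2.trans h.market.phi_le) ⌊A.X⌋₊)
  have h1 := hled.rev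
  have h2 := hled.dem
  rw [sub_zero] at h1 h2
  rw [h.conc.profile.zero, Nat.cast_zero, sub_zero] at h2
  have h3 : A.X = A.n * (A.T * x) := by
    have := h.target
    rw [div_eq_iff h.valid.T_pos.ne'] at this
    rw [this]; ring
  have h4 := (Nat.lt_floor_add_one A.X).le
  have h5 : max ((D A.T : ℝ) - ⌊A.X⌋₊) 0 ≤ A.n * e + 1 := by
    refine max_le ?_ (by positivity)
    linarith
  have := mul_le_mul_of_nonneg_left h5 h.B_pos.le
  linarith

/-- The expected revenue, in terms of the losses on a typical path and the probability of an
atypical one. -/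
theorem le_expectedRevenue {Ω : Type*} [MeasurableSpace Ω] {μ : Measure Ω} [IsProbabilityMeasure μ]
    {f : Ω → ℝ} {G : Set Ω} {r V b p : ℝ} (hf : Measurable f) (h0 : ∀ ω, 0 ≤ f ω) (hb : ∀ ω, f ω ≤ b)
    (hG : MeasurableSet G) (hr : ∀ ω ∈ G, r ≤ f ω) (hrV : r ≤ V) (hV : 0 ≤ V)
    (hp : μ.real Gᶜ ≤ p) : r - p * V ≤ ∫ ω, f ω ∂μ := by
  have hint : Integrable f μ := Integrable.of_bound hf.aestronglyMeasurable b
    (Filter.Eventually.of_forall fun ω => by rw [Real.norm_of_nonneg (h0 ω)]; exact hb ω)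
  -- Nothing prevents `r` from being negative; replacing it by `max r 0` keeps the loss on the
  -- complement of `G` below `p * V`.
  have h1 : ∫ ω, G.indicator (fun _ => max r 0) ω ∂μ ≤ ∫ ω, f ω ∂μ := by
    refine integral_mono ((integrable_const _).indicator hG) hint fun ω => ?_
    by_cases hω : ω ∈ G
    · rw [indicator_of_mem hω]; exact max_le (hr ω hω) (h0 ω)
    · rw [indicator_of_notMem hω]; exact h0 ω
  rw [integral_indicator_const _ hG, smul_eq_mul] at h1
  have h2 : μ.real G = 1 - μ.real Gᶜ := by rw [probReal_compl_eq_one_sub hG]; ring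
  rw [h2] at h1
  have h3 : μ.real Gᶜ * max r 0 ≤ p * V :=
    mul_le_mul hp (max_le hrV hV) (le_max_right _ _) (measureReal_nonneg.trans hp)
  linarith [le_max_left r 0]

theorem Valid.expectedRevenue_nonneg (hv : A.Valid) (hplo : 0 ≤ A.plo) (hX : 0 ≤ A.X)
    (hr : IsRegularRate A.T lam A.priceInStock) (h0 : lam A.pInf = 0)
    {Ω : Type*} [MeasurableSpace Ω] (μ : Measure Ω) {N : ℝ≥0 → Ω → ℕ}
    (hN : IsUnitPoissonProcess μ N) : 0 ≤ expectedRevenue μ N A.T lam A.policy := by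
  refine integral_nonneg fun ω => ?_
  change 0 ≤ revenue A.T (stopPolicy A.X A.pInf A.priceInStock) _
  rw [policy_eq, revenue_stopPolicy hv.isSampledPolicy hr (hN.paths ω) hv.T_pos.le hX h0]
  exact Finset.sum_nonneg fun k _ => hplo.trans (hv.priceInStock_mem _ _).1

theorem isRegularRate_of_marketBounds (hv : A.Valid) (hB : 0 ≤ B) (h0 : lam A.pInf = 0)
    (hm : MarketBounds A.plo A.phi x B K Q ε lam pu pc) :
    IsRegularRate A.T (fun p => A.n * lam p) A.priceInStock := by
  obtain ⟨g, hg, hgb, hlam⟩ := hm.exists_measurable_eq hB h0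
  exact hv.isRegularRate (g := fun p => A.n * g p) (hg.const_mul _) (B := A.n * B)
    (fun p => ⟨mul_nonneg hv.n_pos.le (hgb p).1, mul_le_mul_of_nonneg_left (hgb p).2 hv.n_pos.le⟩)
    fun p hp => by rw [hlam p (Or.inl hp)]

/-- What the algorithm loses in a large market, relative to the deterministic problem. -/
theorem IsLarge.regret_le (hl : A.IsLarge B K Q ε c R) (hv : A.Valid) (hB : 0 < B) (hK : 0 < K)
    (hQ : 0 < Q) (hε : 0 < ε) (hx : 0 ≤ x) (hX : A.X = A.n * (x * A.T)) (h0 : lam A.pInf = 0)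
    (hm : MarketBounds A.plo A.phi x B K Q ε lam pu pc) {e : ℝ} (he : 0 ≤ e)
    (hU : A.errorU B Q ε ≤ e) (hC : A.errorC B K Q ε R ≤ e)
    {Ω : Type*} [MeasurableSpace Ω] (μ : Measure Ω) [IsProbabilityMeasure μ]
    (N : ℝ≥0 → Ω → ℕ) (hN : IsUnitPoissonProcess μ N) :
    regret μ N A.plo A.phi A.pInf A.X A.T (fun p => A.n * lam p) A.policy ≤
      (1 + B) * K / (A.T * ε ^ 2) * e + (B * K / (A.T * ε ^ 2) + 2 * (B * A.T + 3) ^ 2) / A.n := by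
  have hn := hv.n_pos
  have hT := hv.T_pos
  have hL1 : 1 ≤ A.L := by linarith [hl.L_ge]
  have hX0 : 0 ≤ A.X := by rw [hX]; positivity
  have hr := isRegularRate_of_marketBounds hv hB.le h0 hm
  have h0' : (fun p => A.n * lam p) A.pInf = 0 := by simp [h0]
  set f := max pu pc * lam (max pu pc) with hf
  have hf0 : ε ^ 2 / K ≤ f := hm.value_pos
  have hfpos : 0 < f := lt_of_lt_of_le (by positivity) hf0
  set V := A.n * A.T * f with hV
  have hVpos : 0 < V := by positivity
  have hS := hv.isSampledPolicy
  set H := ⌈A.n * B * A.T⌉₊ + 1 with hH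
  have hJ : A.n * (A.T * f - e) - B * (A.n * e + 1) - 2 * (B * A.T + 3) ^ 2 / A.n * V ≤
      expectedRevenue μ N A.T (fun p => A.n * lam p) A.policy := by
    unfold expectedRevenue
    rw [policy_eq]
    have hrev : ∀ ω, revenue A.T (stopPolicy A.X A.pInf A.priceInStock) (demandPath A.T
        (fun p => A.n * lam p) (stopPolicy A.X A.pInf A.priceInStock) (fun t => N t ω)) = _ :=
      fun ω => revenue_stopPolicy hS hr (hN.paths ω) hT.le hX0 h0'
    have hb1 : ∀ D t, 0 ≤ A.priceInStock D t ∧ A.priceInStock D t ≤ B := fun D t =>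
      ⟨hm.plo_nonneg.trans (hv.priceInStock_mem D t).1,
        (hv.priceInStock_mem D t).2.trans hm.phi_le⟩
    refine le_expectedRevenue (G := {ω | IsRegularPath H (3 * A.L) (fun t => N t ω)})
      (b := ⌊A.X⌋₊ * B)
      (revenue_measurable hN.measurable hN.paths hS hr A.measurable_priceInStock hT.le hX0 h0')
      (fun ω => ?_) (fun ω => ?_) (IsRegularPath.measurableSet hN.measurable H _) (fun ω hω => ?_)
      ?_ hVpos.le ?_
    · rw [hrev]
      exact Finset.sum_nonneg fun k _ => (hb1 _ _).1
    · rw [hrev]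
      refine (Finset.sum_le_card_nsmul _ _ B fun k _ => (hb1 _ _).2).trans ?_
      rw [Nat.card_Icc, Nat.add_sub_cancel, nsmul_eq_mul]
      exact mul_le_mul_of_nonneg_right (Nat.cast_le.2 (min_le_right _ _)) hB.le
    · rw [hrev]
      have hpath := hS.isDemandPath hr (ν := fun t => N t ω)
      have hconc := hpath.isConcentrated (B := B) hT.le hL1 (hN.paths ω) hω (fun s => by
          have hp := hv.priceInStock_mem (sampledDemand (fun p => A.n * lam p) A.priceInStock
            A.sampleTimes fun t => N t ω) s
          exact ⟨mul_nonneg hn.le (hm.nonneg _ hp), mul_le_mul_of_nonneg_left (hm.le_bound _ hp) hn.le⟩)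
        (by rw [hH]; push_cast; linarith [Nat.le_ceil (A.n * B * A.T)])
      have hrun : A.IsRun x B K Q ε lam pu pc (sampledDemand (fun p => A.n * lam p) A.priceInStock
          A.sampleTimes fun t => N t ω) :=
        ⟨hv, hB, hK, hQ, hε, hx, by rw [hX]; field_simp, hm, hconc⟩
      exact hrun.le_revenue hl he hU hC
    · rw [hV]
      have : 0 ≤ B * (A.n * e + 1) + A.n * e := by positivity
      linarith
    · refine (measure_not_isRegularPath_le hN H (c := 3 * A.L) (by linarith)).trans ?_
      -- The factor `3` in the definition of the good event pays for the order `n ^ 2` of pairs in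
      -- the union bound and leaves `1 / n`.
      have hexp : Real.exp (-(3 * A.L)) = 1 / (A.n : ℝ) ^ 3 := by
        have : Real.exp A.L = A.n := Real.exp_log hn
        rw [Real.exp_neg, show 3 * A.L = ((3 : ℕ) : ℝ) * A.L by norm_num, Real.exp_nat_mul, this,
          one_div]
      have hH1 : (H : ℝ) + 1 ≤ A.n * (B * A.T + 3) := by
        have h1 := (Nat.ceil_lt_add_one (show 0 ≤ A.n * B * A.T by positivity)).le
        have h2 := hv.one_le_n
        rw [hH]; push_cast; linarith
      have hsq : ((H : ℝ) + 1) ^ 2 ≤ (A.n * (B * A.T + 3)) ^ 2 :=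
        pow_le_pow_left₀ (by positivity) hH1 2
      rw [hexp]
      calc 2 * ((H : ℝ) + 1) ^ 2 * (1 / (A.n : ℝ) ^ 3)
          ≤ 2 * (A.n * (B * A.T + 3)) ^ 2 * (1 / (A.n : ℝ) ^ 3) := by gcongr
        _ = 2 * (B * A.T + 3) ^ 2 / A.n := by field_simp
  obtain ⟨hJD0, hJD⟩ : 0 < deterministicValue A.plo A.phi A.pInf A.X A.T (fun p => A.n * lam p) ∧
      deterministicValue A.plo A.phi A.pInf A.X A.T (fun p => A.n * lam p) ≤ V := by
    have hm' : MarketBounds A.plo A.phi (x * A.T / A.T) B K Q ε lam pu pc := by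
      rwa [mul_div_cancel_right₀ _ hT.ne']
    rw [hX]
    exact hm'.deterministicValue_bounds hB.le hK hε hT hn h0
  have hJ0 := hv.expectedRevenue_nonneg hm.plo_nonneg hX0 hr h0' μ hN
  unfold regret
  -- The expected revenue is nonnegative, so the deterministic value may be replaced by its upper
  -- bound `V`.
  have h1 := div_le_div_of_nonneg_left hJ0 hJD0 hJD
  refine le_trans (sub_le_sub_left h1 1) ?_
  rw [sub_le_comm, le_div_iff₀ hVpos]
  refine le_trans ?_ hJ
  obtain ⟨k, hk⟩ : ∃ k, k = K / (A.T * ε ^ 2) := ⟨_, rfl⟩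
  -- The value `V` is at least `n T ε ^ 2 / K`, so losses proportional to `n` are turned into
  -- relative ones with a constant that does not depend on the prices.
  have hkV : A.n ≤ k * V := by
    have h2 := mul_le_mul_of_nonneg_left hf0 (show 0 ≤ k * (A.n * A.T) by rw [hk]; positivity)
    calc (A.n : ℝ) = k * (A.n * A.T) * (ε ^ 2 / K) := by rw [hk]; field_simp
      _ ≤ _ := h2
      _ = k * V := by rw [hV]; ring
  have h3 := mul_le_mul_of_nonneg_left hkV (show 0 ≤ (1 + B) * e by positivity)
  have h4 : B ≤ B * k * V / A.n := by
    rw [le_div_iff₀ hn, mul_assoc]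
    exact mul_le_mul_of_nonneg_left hkV hB.le
  have e1 : (1 + B) * K / (A.T * ε ^ 2) * e +
      (B * K / (A.T * ε ^ 2) + 2 * (B * A.T + 3) ^ 2) / A.n =
      (1 + B) * k * e + (B * k / A.n + 2 * (B * A.T + 3) ^ 2 / A.n) := by rw [hk]; ring
  rw [e1]
  have e2 : (1 - ((1 + B) * k * e + (B * k / A.n + 2 * (B * A.T + 3) ^ 2 / A.n))) * V =
      V - (1 + B) * e * (k * V) - B * k * V / A.n - 2 * (B * A.T + 3) ^ 2 / A.n * V := by ring
  rw [e2]
  have e3 : A.n * (A.T * f - e) = V - A.n * e := by rw [hV]; ring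
  rw [e3]
  linarith

end DPA

theorem theorem1 (δ : ℝ) (hδ : δ < 1 / 2) :
    ∃ δ' : ℝ, δ < δ' ∧ δ' < 1 / 2 ∧
      ∀ M K mL mU ε x T : ℝ, 0 < M → 0 < K → 0 < mL → 0 < mU → 0 < ε → 0 < x → 0 < T →
        ∃ C : ℝ, ∀ plo phi pInf : ℝ, 0 ≤ plo → plo < phi → phi ≤ pInf →
          ∀ Γ : Set (ℝ → ℝ),
            (∀ lam ∈ Γ, IsDemandFunction plo phi pInf M K mL mU lam) →
            (∀ lam ∈ Γ, ∃ p ∈ Icc (plo + ε) (phi - ε), IsDeterministicPrice plo phi x T lam p) →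
            ∀ n : ℕ, 2 ≤ n → ∀ lam ∈ Γ,
              IsAdmissible plo phi pInf (n * x) T (fun p => n * lam p)
                (DPA.policy ⟨n, δ', plo, phi, pInf, n * x, T⟩) ∧
              ∀ (Ω : Type*) [MeasurableSpace Ω] (μ : Measure Ω) [IsProbabilityMeasure μ]
                (N : ℝ≥0 → Ω → ℕ), IsUnitPoissonProcess μ N →
                regret μ N plo phi pInf (n * x) T (fun p => n * lam p)
                    (DPA.policy ⟨n, δ', plo, phi, pInf, n * x, T⟩)
                  ≤ C * Real.log n ^ (7 / 2 : ℝ) / (n : ℝ) ^ δ := by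
  -- Irrationality excludes rounds with vanishing exponent, whose length would be `T` times a power
  -- of `log n`. The maximum is needed because `δ` may be negative.
  obtain ⟨δ', hirr, hδ1, hδ2⟩ := exists_irrational_btwn (max_lt hδ (show (0 : ℝ) < 1 / 2 by norm_num))
  have hδδ : δ < δ' := (le_max_left _ _).trans_lt hδ1
  have hδ0 : 0 < δ' := (le_max_right _ _).trans_lt hδ1
  refine ⟨δ', hδδ, hδ2, fun M K mL mU ε x T hM hK hmL hmU hε hx hT => ?_⟩
  obtain ⟨B, Q, hB, hQ, hmarket⟩ := IsDemandFunction.exists_marketBounds M K mL mU ε hM hK hmL hmU hε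
  obtain ⟨c, R, E, hE, hlarge⟩ := DPA.exists_isLarge hδ0 hδ2 hirr hB hK hQ hε hT
  have hlog : ∀ᶠ n : ℕ in Filter.atTop, 1 ≤ Real.log n :=
    (Real.tendsto_log_atTop.comp (tendsto_natCast_atTop_atTop (R := ℝ))).eventually_ge_atTop 1
  obtain ⟨n₀, hn₀⟩ := Filter.eventually_atTop.1 (hlarge.and (hlog.and
    (Real.eventually_log_pow_le 1 6 (sub_pos.2 hδδ))))
  obtain ⟨a, ha⟩ : ∃ a, a = (1 + B) * K / (T * ε ^ 2) * E := ⟨_, rfl⟩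
  obtain ⟨b, hb⟩ : ∃ b, b = B * K / (T * ε ^ 2) + 2 * (B * T + 3) ^ 2 := ⟨_, rfl⟩
  have ha0 : 0 ≤ a := by rw [ha]; positivity
  have hb0 : 0 ≤ b := by rw [hb]; positivity
  have hl2 : 0 < Real.log 2 := Real.log_pos (by norm_num)
  have hl2' : 0 < Real.log 2 ^ (7 / 2 : ℝ) := Real.rpow_pos_of_pos hl2 _
  refine ⟨a + b + n₀ / Real.log 2 ^ (7 / 2 : ℝ), ?_⟩
  intro plo phi pInf hplo hlt _ Γ hΓ hΓ' n hn lam hlam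
  obtain ⟨pu, pc, hm⟩ := hmarket plo phi pInf x T lam hplo hlt hx hT (hΓ lam hlam) (hΓ' lam hlam)
  have h0 : lam pInf = 0 := (hΓ lam hlam).cutoff
  obtain ⟨A, hA⟩ : ∃ A : DPA, A = ⟨n, δ', plo, phi, pInf, n * x, T⟩ := ⟨_, rfl⟩
  have hv : A.Valid := by rw [hA]; exact ⟨hn, hlt, hT⟩
  have hn0 : (0 : ℝ) < n := by exact_mod_cast (by omega : 0 < n)
  have hn1 : (1 : ℝ) ≤ n := by exact_mod_cast (by omega : 1 ≤ n)
  have hX0 : (0 : ℝ) ≤ n * x := by positivity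
  have hm' : MarketBounds A.plo A.phi (x / T) B K Q ε lam pu pc := by rw [hA]; exact hm
  have h0' : (n : ℝ) * lam pInf = 0 := by rw [h0, mul_zero]
  have hr : IsRegularRate A.T (fun p => n * lam p) A.priceInStock := by
    have := DPA.isRegularRate_of_marketBounds (A := A) hv hB.le (by rw [hA]; exact h0) hm'
    rwa [show A.n = n by rw [hA]] at this
  have hadm := hv.isAdmissible hr (by rw [hA]; exact hX0) (by rw [hA]; exact h0')
  refine ⟨by rw [hA] at hadm; exact hadm, ?_⟩
  intro Ω _ μ _ N hN
  have hnδ := Real.rpow_pos_of_pos hn0 δ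
  rw [le_div_iff₀ hnδ]
  have hlogn : Real.log 2 ≤ Real.log n := Real.log_le_log (by norm_num) (by exact_mod_cast hn)
  have hpow : Real.log 2 ^ (7 / 2 : ℝ) ≤ Real.log n ^ (7 / 2 : ℝ) :=
    Real.rpow_le_rpow hl2.le hlogn (by norm_num)
  -- For `n < n₀` the regret is at most `1`, and `n ^ δ ≤ n₀`; dividing by the least value of the
  -- logarithmic factor, attained at `n = 2`, gives the last part of the constant.
  rcases lt_or_ge n n₀ with hnn | hnn
  · have hJ0 := hv.expectedRevenue_nonneg (by rw [hA]; exact hplo) (by rw [hA]; exact hX0) hr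
      (by rw [hA]; exact h0') μ hN
    rw [hA] at hJ0
    have hreg : regret μ N plo phi pInf (n * x) T (fun p => n * lam p)
        (DPA.policy ⟨n, δ', plo, phi, pInf, n * x, T⟩) ≤ 1 :=
      sub_le_self _ (div_nonneg hJ0 (hm.deterministicValue_bounds hB.le hK hε hT hn0 h0).1.le)
    calc _ ≤ 1 * (n : ℝ) ^ δ := mul_le_mul_of_nonneg_right hreg hnδ.le
      _ ≤ n₀ := by
        rw [one_mul]
        calc (n : ℝ) ^ δ ≤ (n : ℝ) ^ (1 : ℝ) := Real.rpow_le_rpow_of_exponent_le hn1 (by linarith)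
          _ = n := Real.rpow_one _
          _ ≤ n₀ := by exact_mod_cast hnn.le
      _ = n₀ / Real.log 2 ^ (7 / 2 : ℝ) * Real.log 2 ^ (7 / 2 : ℝ) := by field_simp
      _ ≤ (a + b + n₀ / Real.log 2 ^ (7 / 2 : ℝ)) * Real.log n ^ (7 / 2 : ℝ) := by
        refine mul_le_mul (by linarith) hpow hl2'.le (by positivity)
  · obtain ⟨hl, hlog1, hpoly⟩ := hn₀ n hnn
    obtain ⟨hl, hU, hC⟩ := hl A hv (by rw [hA]) (by rw [hA]) (by rw [hA])
    have hreg := hl.regret_le hv hB hK hQ hε (x := x / T) (by positivity)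
      (by rw [hA]; change (n : ℝ) * x = n * (x / T * T); field_simp) (by rw [hA]; exact h0) hm'
      (by positivity) hU hC μ N hN
    rw [hA] at hreg
    refine (mul_le_mul_of_nonneg_right hreg hnδ.le).trans ?_
    change ((1 + B) * K / (T * ε ^ 2) * (E * ((n : ℝ) ^ (-δ') * Real.log n ^ 6)) +
      (B * K / (T * ε ^ 2) + 2 * (B * T + 3) ^ 2) / n) * (n : ℝ) ^ δ ≤ _
    rw [← hb, ← mul_assoc, ← ha]
    -- The gap between `δ` and `δ'` absorbs all logarithms, so for large `n` the logarithmic factor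
    -- in the claim is used only through being at least `1`.
    have h1 : (n : ℝ) ^ (-δ') * Real.log n ^ 6 * (n : ℝ) ^ δ ≤ 1 := by
      rw [one_mul] at hpoly
      calc (n : ℝ) ^ (-δ') * Real.log n ^ 6 * (n : ℝ) ^ δ
          ≤ (n : ℝ) ^ (-δ') * (n : ℝ) ^ (δ' - δ) * (n : ℝ) ^ δ := by gcongr
        _ = 1 := by
          rw [← Real.rpow_add hn0, ← Real.rpow_add hn0, show -δ' + (δ' - δ) + δ = 0 by ring,
            Real.rpow_zero]
    have h2 : (n : ℝ) ^ δ / n ≤ 1 := by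
      rw [div_le_one hn0]
      calc (n : ℝ) ^ δ ≤ (n : ℝ) ^ (1 : ℝ) := Real.rpow_le_rpow_of_exponent_le hn1 (by linarith)
        _ = n := Real.rpow_one _
    have h3 : (1 : ℝ) ≤ Real.log n ^ (7 / 2 : ℝ) := Real.one_le_rpow hlog1 (by norm_num)
    have h4 : 0 ≤ n₀ / Real.log 2 ^ (7 / 2 : ℝ) := by positivity
    calc _ = a * ((n : ℝ) ^ (-δ') * Real.log n ^ 6 * (n : ℝ) ^ δ) + b * ((n : ℝ) ^ δ / n) := by ring
      _ ≤ a * 1 + b * 1 := by gcongr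
      _ ≤ (a + b + n₀ / Real.log 2 ^ (7 / 2 : ℝ)) * 1 := by linarith
      _ ≤ _ := mul_le_mul_of_nonneg_left h3 (by positivity)
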